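/- **Setup.** A unit has covariates $X$, a binary treatment $T\in\{0,1\}$, potential surrogates $S(0),S(1)$, real potential outcomes $Y(0),Y(1)$ and a labelling indicator $R\in\{0,1\}$ ($X$ and $S(t)$ take values in standard Borel spaces, e.g. subsets of Euclidean space). Put $S=S(T)$, $Y=Y(T)$. The population is given by the conditional law of $(X,T,S(0),S(1),Y(0),Y(1))$ given $R=1$, the one given $R=0$, and $\mathbb P(R=1)=\rho\in[0,1)$; the regime in which the number of labelled units is negligible relative to the number of unlabelled units is $\rho=0$. Unconditional laws are the mixtures of the two conditional laws with weights $\rho$ and $1-\rho$. Let $\delta^*=\mathbb E[Y(1)]-\mathbb E[Y(0)]$, $e^*(x)=\mathbb P(T=1\mid X=x)$, $\mu^*(t,x)=\mathbb E[Y\mid R=1,T=t,X=x]$, $\tilde\mu^*(t,x,s)=\mathbb E[Y\mid R=1,T=t,X=x,S=s]$, and let $\lambda^*(x)=f^*(x)/f^*(x\mid R=1)$ be the density of the law of $X$ with respect to its law given $R=1$. **Assumptions.** For $t=0,1$: $(Y(t),S(t))\perp T\mid X$; $R\perp Y(t)\mid (X,T=t,S(t))$; $R\perp S(t)\mid (T,X)$;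 and $R\perp T\mid X$ (independence of $R$ means that the conditional laws given $R=1$ and $R=0$ agree, i.e. it is required when the two conditional laws are mixed with $\mathbb P(R=1)=q$, for $0<q<1$). For constants $\epsilon\in(0,1/2)$ and $C$: $\epsilon\le e^*(X)\le 1-\epsilon$ almost surely; $\lambda^*$ exists and $\lambda^*(X)\le C$ almost surely. Finally $\mathbb E[Y^2\mid R=1]<\infty$. **Settings.** (I) One observes i.i.d. draws from the law of $(X,T,Y)$ given $R=1$ and knows the unconditional law of $(X,T)$. (II) One observes i.i.d. draws from the law of $(X,T,S,Y)$ given $R=1$ and knows the unconditional law of $(X,T)$. (III) One observes i.i.d. draws from the law of $(X,T,S,Y)$ given $R=1$ and knows the unconditional law of $(X,T,S)$. The model in each setting consists of all populations that satisfy the assumptions (with the same $\rho,\epsilon,C$) and have the known law. A regular submodel is a one-parameter curve in the model through the true population whose observed laws are differentiable in quadratic mean there, with square-integrable score, and along which $\mathbb E[Y^2\mid R=1]$ stays bounded locally. The efficient influence function of $\delta^*$ is the element of the closed linear span of the scores that represents the derivative of $\delta^*$ along every regular submodel; the efficiency lower bound is the supremum of the Cramér–Rao bounds $\dot\delta^2/\mathbb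 E[g^2\mid R=1]$ over the regular submodels, where $g$ is the score and $\dot\delta$ is the derivative of $\delta^*$ along the submodel. **Theorem.** In settings I and II the efficient influence function of $\delta^*$ is $$\tilde\psi_I=\tilde\psi_{II}=\frac{T\lambda^*(X)}{e^*(X)}\bigl(Y-\mu^*(1,X)\bigr)-\frac{(1-T)\lambda^*(X)}{1-e^*(X)}\bigl(Y-\mu^*(0,X)\bigr),$$ and the efficiency lower bounds are $\tilde V^*_j=\mathbb E[\tilde\psi_j^2\mid R=1]$, $j=I,II$; in particular $\tilde V_I^*=\tilde V_{II}^*$. In setting III the efficient influence function is $$\tilde\psi=\frac{T\lambda^*(X)}{e^*(X)}\bigl(Y-\tilde\mu^*(1,X,S)\bigr)-\frac{(1-T)\lambda^*(X)}{1-e^*(X)}\bigl(Y-\tilde\mu^*(0,X,S)\bigr),$$ and the efficiency lower bound is $\tilde V^*=\mathbb E[\tilde\psi^2\mid R=1]$. All three bounds are finite, and the efficiency gain from surrogates is $$\tilde V^*_I-\tilde V^*=\tilde V^*_{II}-\tilde V^*=\mathbb E\left[\frac{\lambda^{*2}(X)}{e^*(X)}\operatorname{Var}\{\tilde\mu^*(1,X,S(1))\mid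 X\}+\frac{\lambda^{*2}(X)}{1-e^*(X)}\operatorname{Var}\{\tilde\mu^*(0,X,S(0))\mid X\}\,\Big|\,R=1\right].$$ -/

import Mathlib

open MeasureTheory ProbabilityTheory Filter Topology
open scoped ENNReal NNReal

noncomputable section

/-! ### The population -/

/-- All variables of one unit except the labelling indicator:
covariates, treatment (`true` is treated), the two potential surrogates, the two potential
outcomes. -/
abbrev FullData (𝒳 𝒮 : Type*) := 𝒳 × Bool × (Bool → 𝒮) × (Bool → ℝ)

namespace FullData

variable {𝒳 𝒮 : Type*}

/-- covariates `X` -/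
def X (w : FullData 𝒳 𝒮) : 𝒳 := w.1

/-- treatment `T` -/
def T (w : FullData 𝒳 𝒮) : Bool := w.2.1

/-- potential surrogate `S(t)` -/
def Spot (t : Bool) (w : FullData 𝒳 𝒮) : 𝒮 := w.2.2.1 t

/-- potential outcome `Y(t)` -/
def Ypot (t : Bool) (w : FullData 𝒳 𝒮) : ℝ := w.2.2.2 t

/-- realized surrogate `S = S(T)` -/
def S (w : FullData 𝒳 𝒮) : 𝒮 := Spot (T w) w

/-- realized outcome `Y = Y(T)` -/
def Y (w : FullData 𝒳 𝒮) : ℝ := Ypot (T w) w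

/-- the pair `(X, T)` -/
def XT (w : FullData 𝒳 𝒮) : 𝒳 × Bool := (X w, T w)

/-- the triple `(X, T, S)` -/
def XTS (w : FullData 𝒳 𝒮) : 𝒳 × Bool × 𝒮 := (X w, T w, S w)

/-- the triple `(X, T, Y)` -/
def XTY (w : FullData 𝒳 𝒮) : 𝒳 × Bool × ℝ := (X w, T w, Y w)

/-- the quadruple `(X, T, S, Y)` -/
def XTSY (w : FullData 𝒳 𝒮) : 𝒳 × Bool × 𝒮 × ℝ := (X w, T w, S w, Y w)

variable [MeasurableSpace 𝒳] [MeasurableSpace 𝒮]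

theorem measurable_X : Measurable (X : FullData 𝒳 𝒮 → 𝒳) := measurable_fst

theorem measurable_T : Measurable (T : FullData 𝒳 𝒮 → Bool) :=
  measurable_fst.comp measurable_snd

theorem measurable_Spot (t : Bool) : Measurable (Spot t : FullData 𝒳 𝒮 → 𝒮) :=
  (measurable_pi_apply t).comp (measurable_fst.comp (measurable_snd.comp measurable_snd))

end FullData

open FullData

/-- A population, given by the conditional laws of the full data given `R = 1` (labelled) and given
`R = 0` (unlabelled). The marginal probability `ρ` of `R = 1`, which may be zero, is kept
separate, so that conditioning on `R = 1` makes sense also when `ρ = 0`. -/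
structure Population (𝒳 𝒮 : Type*) [MeasurableSpace 𝒳] [MeasurableSpace 𝒮] where
  /-- the law given `R = 1` -/
  lab : ProbabilityMeasure (FullData 𝒳 𝒮)
  /-- the law given `R = 0` -/
  unl : ProbabilityMeasure (FullData 𝒳 𝒮)

namespace Population

variable {𝒳 𝒮 : Type*} [MeasurableSpace 𝒳] [MeasurableSpace 𝒮]

/-- The law given `R = 1`, as a measure. -/
abbrev labelled (P : Population 𝒳 𝒮) : Measure (FullData 𝒳 𝒮) := P.lab

/-- The unconditional law of the full data when `R = 1` has probability `ρ`. -/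
abbrev law (ρ : ℝ) (P : Population 𝒳 𝒮) : Measure (FullData 𝒳 𝒮) :=
  ρ.toNNReal • (P.lab : Measure (FullData 𝒳 𝒮)) +
    (1 - ρ).toNNReal • (P.unl : Measure (FullData 𝒳 𝒮))

/-- The joint law of the full data and `R` when `R = 1` has probability `q`. -/
abbrev joint (q : ℝ) (P : Population 𝒳 𝒮) : Measure (FullData 𝒳 𝒮 × Bool) :=
  q.toNNReal • (P.lab : Measure (FullData 𝒳 𝒮)).map (fun w => (w, true)) +
    (1 - q).toNNReal • (P.unl : Measure (FullData 𝒳 𝒮)).map (fun w => (w, false))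

/-- The average treatment effect `E[Y(1)] - E[Y(0)]`. -/
def ate (ρ : ℝ) (P : Population 𝒳 𝒮) : ℝ :=
  (∫ w, Ypot true w ∂(P.law ρ)) - ∫ w, Ypot false w ∂(P.law ρ)

/-- The propensity score `e(x) = P(T = 1 | X = x)`. -/
def e (ρ : ℝ) (P : Population 𝒳 𝒮) (x : 𝒳) : ℝ :=
  (condDistrib T X (P.law ρ) x).real {true}

/-- The density ratio `λ(x) = f(x) / f(x | R = 1)`. -/
def lam (ρ : ℝ) (P : Population 𝒳 𝒮) (x : 𝒳) : ℝ :=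
  (((P.law ρ).map X).rnDeriv (P.labelled.map X) x).toReal

/-- `μ(t, x) = E[Y | R = 1, T = t, X = x]`. -/
def mu (P : Population 𝒳 𝒮) (t : Bool) (x : 𝒳) : ℝ :=
  ∫ y, y ∂(condDistrib Y XT P.labelled (x, t))

/-- `μ̃(t, x, s) = E[Y | R = 1, T = t, X = x, S = s]`. -/
def muTilde (P : Population 𝒳 𝒮) (t : Bool) (x : 𝒳) (s : 𝒮) : ℝ :=
  ∫ y, y ∂(condDistrib Y XTS P.labelled (x, t, s))

/-- `Var{μ̃(t, X, S(t)) | X = x}`, with respect to the unconditional law. -/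
def condVar (ρ : ℝ) (P : Population 𝒳 𝒮) (t : Bool) (x : 𝒳) : ℝ :=
  variance id (condDistrib (fun w => P.muTilde t (X w) (Spot t w)) X (P.law ρ) x)

/-- The assumptions on the population. Independence of `R` and another variable compares the
conditional laws given `R = 1` and given `R = 0`; it is expressed under the joint laws in which
`R = 1` has probability `q`, where `0 < q < 1`. -/
structure Admissible [StandardBorelSpace 𝒳] [StandardBorelSpace 𝒮]
    (ρ ε C : ℝ) (P : Population 𝒳 𝒮) : Prop where
  /-- `(Y(t), S(t)) ⊥ T | X` -/
  unconfounded : ∀ t : Bool,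
    CondIndepFun (MeasurableSpace.comap X inferInstance) measurable_X.comap_le
      (fun w => (Ypot t w, Spot t w)) T (P.law ρ)
  /-- `R ⊥ Y(t) | (X, T = t, S(t))` -/
  missing_at_random : ∀ q : ℝ, 0 < q → q < 1 → ∀ t : Bool,
    CondIndepFun
      (MeasurableSpace.comap (fun v : FullData 𝒳 𝒮 × Bool => (X v.1, Spot t v.1)) inferInstance)
      ((measurable_X.comp measurable_fst).prodMk
        ((measurable_Spot t).comp measurable_fst)).comap_le
      (fun v => v.2) (fun v => Ypot t v.1) ((P.joint q)[|{v | T v.1 = t}])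
  /-- `R ⊥ S(t) | (T, X)` -/
  surrogate_mar : ∀ q : ℝ, 0 < q → q < 1 → ∀ t : Bool,
    CondIndepFun
      (MeasurableSpace.comap (fun v : FullData 𝒳 𝒮 × Bool => (T v.1, X v.1)) inferInstance)
      ((measurable_T.comp measurable_fst).prodMk (measurable_X.comp measurable_fst)).comap_le
      (fun v => v.2) (fun v => Spot t v.1) (P.joint q)
  /-- `R ⊥ T | X` -/
  treatment_mar : ∀ q : ℝ, 0 < q → q < 1 →
    CondIndepFun
      (MeasurableSpace.comap (fun v : FullData 𝒳 𝒮 × Bool => X v.1) inferInstance)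
      (measurable_X.comp measurable_fst).comap_le
      (fun v => v.2) (fun v => T v.1) (P.joint q)
  /-- strict overlap of the treatment propensity score -/
  overlap : ∀ᵐ w ∂(P.law ρ), ε ≤ P.e ρ (X w) ∧ P.e ρ (X w) ≤ 1 - ε
  /-- the density ratio exists -/
  absolutelyContinuous : (P.law ρ).map X ≪ P.labelled.map X
  /-- the density ratio is bounded by `C` -/
  lam_le : ∀ᵐ w ∂(P.law ρ), P.lam ρ (X w) ≤ C
  /-- the outcome has a finite second moment on the labelled data -/
  memLp_Y : MemLp Y 2 P.labelled

/-- The model in which the unconditional law of `known` is known: all admissible populations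
that agree with `P` in that law. -/
def model [StandardBorelSpace 𝒳] [StandardBorelSpace 𝒮] {K : Type*} [MeasurableSpace K]
    (ρ ε C : ℝ) (known : FullData 𝒳 𝒮 → K) (P : Population 𝒳 𝒮) : Set (Population 𝒳 𝒮) :=
  {P₁ | P₁.Admissible ρ ε C ∧ (P₁.law ρ).map known = (P.law ρ).map known}

end Population

/-! ### Semiparametric efficiency from i.i.d. labelled observations -/

/-- The squared `L²` remainder `∫ ((√dQ - √dQ₀) / t - (g / 2) √dQ₀)²` of differentiability in
quadratic mean. It does not depend on the dominating measure, which here is `Q + Q₀`. -/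
def dqmRemainder {O : Type*} [MeasurableSpace O] (Q Q₀ : Measure O) (g : O → ℝ) (t : ℝ) : ℝ≥0∞ :=
  ∫⁻ w, ENNReal.ofReal
    (((√(Q.rnDeriv (Q + Q₀) w).toReal - √(Q₀.rnDeriv (Q + Q₀) w).toReal) / t
      - g w / 2 * √(Q₀.rnDeriv (Q + Q₀) w).toReal) ^ 2) ∂(Q + Q₀)

section Efficiency

variable {𝒳 𝒮 O : Type*} [MeasurableSpace 𝒳] [MeasurableSpace 𝒮] [MeasurableSpace O]

/-- The law of one labelled observation, when `obs` is what is observed of a labelled unit. -/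
abbrev obsLaw (obs : FullData 𝒳 𝒮 → O) (P : Population 𝒳 𝒮) : Measure O := P.labelled.map obs

/-- `path` is a smooth and regular one-dimensional parametric submodel of `M` through `P` whose
score for the observed data, i.e. for the law of `obs` given `R = 1`, is `g`: the observed law is
differentiable in quadratic mean at `0` with score `g`, and the second moment of the outcome
stays bounded near `0`. -/
structure IsRegularSubmodel (M : Set (Population 𝒳 𝒮)) (obs : FullData 𝒳 𝒮 → O)
    (P : Population 𝒳 𝒮) (path : ℝ → Population 𝒳 𝒮) (g : O → ℝ) : Prop where
  path_zero : path 0 = P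
  mem_model : ∀ᶠ t in 𝓝 (0 : ℝ), path t ∈ M
  memLp_score : MemLp g 2 (obsLaw obs P)
  dqm : Tendsto (fun t => dqmRemainder (obsLaw obs (path t)) (obsLaw obs P) g t)
    (𝓝[≠] 0) (𝓝 0)
  moment : ∃ B : ℝ≥0, ∀ᶠ t in 𝓝 (0 : ℝ), ∫⁻ w, ‖Y w‖ₑ ^ 2 ∂(path t).labelled ≤ B

/-- The tangent set: all scores of regular parametric submodels, as elements of `L²`. -/
def tangentSet (M : Set (Population 𝒳 𝒮)) (obs : FullData 𝒳 𝒮 → O) (P : Population 𝒳 𝒮) :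
    Set (Lp ℝ 2 (obsLaw obs P)) :=
  {h | ∃ path : ℝ → Population 𝒳 𝒮, IsRegularSubmodel M obs P path h}

/-- `ψ` is the efficient influence function at `P` for the parameter `θ` in the model `M` from
i.i.d. labelled observations of `obs`: the parameter is pathwise differentiable with gradient `ψ`,
and `ψ` lies in the tangent space, the closed linear span of the tangent set. -/
structure IsEfficientInfluenceFunction (M : Set (Population 𝒳 𝒮)) (obs : FullData 𝒳 𝒮 → O)
    (θ : Population 𝒳 𝒮 → ℝ) (P : Population 𝒳 𝒮) (ψ : O → ℝ) : Prop where
  memLp : MemLp ψ 2 (obsLaw obs P)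
  gradient : ∀ (path : ℝ → Population 𝒳 𝒮) (g : O → ℝ), IsRegularSubmodel M obs P path g →
    HasDerivAt (fun t => θ (path t)) (∫ w, ψ w * g w ∂(obsLaw obs P)) 0
  mem_tangentSpace :
    memLp.toLp ψ ∈ (Submodule.span ℝ (tangentSet M obs P)).topologicalClosure

/-- The efficiency lower bound: the supremum of the Cramér-Rao bounds `θ̇² / E[g²]` over all regular
parametric submodels (with `0 / 0 = 0` and `a / 0 = ∞` for `a > 0`). -/
def efficiencyBound (M : Set (Population 𝒳 𝒮)) (obs : FullData 𝒳 𝒮 → O)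
    (θ : Population 𝒳 𝒮 → ℝ) (P : Population 𝒳 𝒮) : ℝ≥0∞ :=
  ⨆ (path : ℝ → Population 𝒳 𝒮) (g : O → ℝ) (d : ℝ)
    (_ : IsRegularSubmodel M obs P path g) (_ : HasDerivAt (fun t => θ (path t)) d 0),
    ENNReal.ofReal (d ^ 2) / ∫⁻ w, ‖g w‖ₑ ^ 2 ∂(obsLaw obs P)

end Efficiency

/-! ### The influence functions and the gain -/

namespace Population

variable {𝒳 𝒮 : Type*} [MeasurableSpace 𝒳] [MeasurableSpace 𝒮]

/-- The numerical value of the treatment. -/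
def ind (t : Bool) : ℝ := if t then 1 else 0

/-- The influence function without surrogates. -/
def psiI (ρ : ℝ) (P : Population 𝒳 𝒮) : 𝒳 × Bool × ℝ → ℝ := fun (x, t, y) =>
  ind t * P.lam ρ x / P.e ρ x * (y - P.mu true x)
    - (1 - ind t) * P.lam ρ x / (1 - P.e ρ x) * (y - P.mu false x)

/-- The influence function with surrogates on the labelled data only; it ignores them. -/
def psiII (ρ : ℝ) (P : Population 𝒳 𝒮) : 𝒳 × Bool × 𝒮 × ℝ → ℝ := fun (x, t, _, y) =>
  P.psiI ρ (x, t, y)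

/-- The influence function when the unconditional law of `(X, T, S)` is known. -/
def psiTilde (ρ : ℝ) (P : Population 𝒳 𝒮) : 𝒳 × Bool × 𝒮 × ℝ → ℝ := fun (x, t, s, y) =>
  ind t * P.lam ρ x / P.e ρ x * (y - P.muTilde true x s)
    - (1 - ind t) * P.lam ρ x / (1 - P.e ρ x) * (y - P.muTilde false x s)

/-- The integrand of the efficiency gain. -/
def gain (ρ : ℝ) (P : Population 𝒳 𝒮) (x : 𝒳) : ℝ :=
  P.lam ρ x ^ 2 / P.e ρ x * P.condVar ρ true x
    + P.lam ρ x ^ 2 / (1 - P.e ρ x) * P.condVar ρ false x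

section Settings

variable [StandardBorelSpace 𝒳] [StandardBorelSpace 𝒮]

/-- Setting I (no surrogates): `(X, T, Y)` is observed given `R = 1`, and the unconditional law of
`(X, T)` is known. -/
def boundI (ρ ε C : ℝ) (P : Population 𝒳 𝒮) : ℝ≥0∞ :=
  efficiencyBound (model ρ ε C XT P) XTY (ate ρ) P

/-- Setting II (surrogates on labelled data only): `(X, T, S, Y)` is observed given `R = 1`, and the
unconditional law of `(X, T)` is known. -/
def boundII (ρ ε C : ℝ) (P : Population 𝒳 𝒮) : ℝ≥0∞ :=
  efficiencyBound (model ρ ε C XT P) XTSY (ate ρ) P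

/-- Surrogates on all data: `(X, T, S, Y)` is observed given `R = 1`, and the unconditional law of
`(X, T, S)` is known. -/
def boundTilde (ρ ε C : ℝ) (P : Population 𝒳 𝒮) : ℝ≥0∞ :=
  efficiencyBound (model ρ ε C XTS P) XTSY (ate ρ) P

end Settings

end Population

end

/-! The assumptions are first turned into identities between laws. For 0 < q < 1, conditional
independence of R and a variable means that the labelled and unlabelled laws share a conditional
kernel (`condIndepFun_label_iff`). A density ratio in X alone therefore survives the passage from X
to (X, T), then to S(t), then to Y(t): the unconditional law of (X, T, S, Y) is the labelled one
weighted by λ(X) (`map_XTSY_law`). With unconfoundedness and overlap, signed inverse probability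
weights w(X, T) (`ipw`) give δ = E[wY] (`ate_eq`).

The three settings are treated at once by an `ObservationScheme`, in which a vector K that
determines (X, T) has a known law. Let m(K) be the labelled conditional mean of Y given K at the
true population P. In the model neither e nor E[w m(K)] changes, so δ(P') - δ(P) = E'[λ'(X) w (Y -
m(K)) | R = 1], where the outer mean and λ' belong to P' (`ate_sub_ate`). The weight λ' varies with
P', yet no derivative of it is needed: at P the residual Y - m(K) is orthogonal to all bounded
functions of K, so the same integrand has mean zero under the true labelled law. It is enough that
λ' tends to λ in L¹, which holds because the unconditional law of X is fixed and the labelled laws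
converge in Hellinger distance. Thus λ w (Y - m(K)) is a gradient (`hasDerivAt_of_dqm`,
`hasDerivAt_ate`).

This gradient has conditional mean zero given K. Every bounded function h of the observation with
that property is a score: tilt the conditional law of (S, Y) given (X, T) by 1 + t h and rebuild
both subpopulations from it with conditionally independent arms (`exists_perturbation`,
`exists_isRegularSubmodel`). Bounded functions are dense in the square-integrable ones with
conditional mean zero, so the gradient is a limit of scores. It is then the efficient influence
function, and by Cauchy–Schwarz its second moment is the bound (`efficiencyBound_eq`). Here m is μ
in settings I and II and μ̃ in setting III.

For the gain, ψ_I - ψ̃ = λ w (μ̃ - μ) is orthogonal to ψ̃. Using up one factor λ and one factor |w|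
in its second moment moves the integral to the potential surrogates under the unconditional law,
where conditional variances appear (`integral_gain`). -/

open FullData

/-! ### Integrals over the fibers of a binary variable -/

namespace MeasureTheory

variable {Ω : Type*} [MeasurableSpace Ω]

theorem Measure.restrict_fiber_add (μ : Measure Ω) {R : Ω → Bool} (hR : Measurable R) :
    μ.restrict (R ⁻¹' {true}) + μ.restrict (R ⁻¹' {false}) = μ := by
  have : R ⁻¹' {false} = (R ⁻¹' {true})ᶜ := by ext w; simp
  rw [this, Measure.restrict_add_restrict_compl (hR (measurableSet_singleton _))]

theorem lintegral_eq_add_fiber (μ : Measure Ω) {R : Ω → Bool} (hR : Measurable R)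
    (F : Ω → ℝ≥0∞) :
    ∫⁻ w, F w ∂μ = ∫⁻ w in R ⁻¹' {true}, F w ∂μ + ∫⁻ w in R ⁻¹' {false}, F w ∂μ := by
  rw [← lintegral_add_measure, Measure.restrict_fiber_add μ hR]

theorem lintegral_eq_sum_fiber (μ : Measure Ω) {R : Ω → Bool} (hR : Measurable R)
    (F : Ω → ℝ≥0∞) : ∫⁻ w, F w ∂μ = ∑ r : Bool, ∫⁻ w in R ⁻¹' {r}, F w ∂μ := by
  rw [lintegral_eq_add_fiber μ hR, Fintype.sum_bool]

theorem setLIntegral_fiber_congr (μ : Measure Ω) {R : Ω → Bool} (hR : Measurable R)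
    (r : Bool) (F : Bool → Ω → ℝ≥0∞) :
    ∫⁻ w in R ⁻¹' {r}, F (R w) w ∂μ = ∫⁻ w in R ⁻¹' {r}, F r w ∂μ := by
  refine setLIntegral_congr_fun (hR (measurableSet_singleton _)) fun w hw => ?_
  simp only [Set.mem_preimage, Set.mem_singleton_iff] at hw
  simp only [hw]

theorem Measure.withDensity_compProd {α β : Type*} [MeasurableSpace α] [MeasurableSpace β]
    (μ : Measure α) [SFinite μ] {l : α → ℝ≥0∞} (hl : Measurable l)
    (η : Kernel α β) [IsSFiniteKernel η] :
    (μ.withDensity l) ⊗ₘ η = (μ ⊗ₘ η).withDensity (fun p => l p.1) := by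
  refine Measure.ext_of_lintegral _ fun F hF => ?_
  rw [Measure.lintegral_compProd hF, lintegral_withDensity_eq_lintegral_mul _ hl
      hF.lintegral_kernel_prod_right', lintegral_withDensity_eq_lintegral_mul _ (by fun_prop) hF,
    Measure.lintegral_compProd (by fun_prop)]
  refine lintegral_congr fun a => ?_
  simp only [Pi.mul_apply]
  rw [lintegral_const_mul _ (by fun_prop)]

end MeasureTheory

/-! ### Conditional independence of a binary label as a common kernel -/

namespace ProbabilityTheory

variable {Ω β γ : Type*} [MeasurableSpace Ω] [StandardBorelSpace Ω]
  [MeasurableSpace β] [StandardBorelSpace β] [Nonempty β] [MeasurableSpace γ]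

/-- A `Bool`-valued variable `R` is conditionally independent of `f` given `k` iff the conditional
distribution of `f` given `k` can be chosen to be the same on both fibers of `R`. -/
theorem condIndepFun_bool_iff {J : Measure Ω} [IsFiniteMeasure J] {R : Ω → Bool} {f : Ω → β}
    {k : Ω → γ} (hR : Measurable R) (hf : Measurable f) (hk : Measurable k) :
    CondIndepFun (MeasurableSpace.comap k inferInstance) hk.comap_le R f J ↔
      ∃ η : Kernel γ β, IsMarkovKernel η ∧ ∀ r : Bool,
        (J.restrict (R ⁻¹' {r})).map (fun w => (k w, f w))
          = (J.restrict (R ⁻¹' {r})).map k ⊗ₘ η := by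
  rw [condIndepFun_iff_condDistrib_prod_ae_eq_prodMkRight hf hR hk,
    condDistrib_ae_eq_iff_measure_eq_compProd _ hf.aemeasurable]
  have hkf : Measurable fun w => (k w, f w) := hk.prodMk hf
  have hkR : Measurable fun w => (k w, R w) := hk.prodMk hR
  have hkRf : Measurable fun w => ((k w, R w), f w) := hkR.prodMk hf
  constructor
  · intro h
    refine ⟨condDistrib f k J, inferInstance, fun r => ?_⟩
    refine Measure.ext_of_lintegral _ fun F hF => ?_
    rw [lintegral_map hF hkf, Measure.lintegral_compProd hF,
      lintegral_map hF.lintegral_kernel_prod_right' hk]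
    -- Test functions supported on `R = r` isolate one fiber of the joint identity.
    have key := congrArg (fun m => ∫⁻ p, ({r} : Set Bool).indicator 1 p.1.2 * F (p.1.1, p.2) ∂m) h
    have hm : Measurable fun p : (γ × Bool) × β =>
        ({r} : Set Bool).indicator (1 : Bool → ℝ≥0∞) p.1.2 * F (p.1.1, p.2) := by
      refine Measurable.mul ?_ (by fun_prop)
      exact (measurable_of_countable (({r} : Set Bool).indicator (1 : Bool → ℝ≥0∞))).comp
        (measurable_snd.comp measurable_fst)
    rw [lintegral_map hm hkRf, Measure.lintegral_compProd hm,
      lintegral_map hm.lintegral_kernel_prod_right' hkR] at key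
    have e1 : ∀ G : Ω → ℝ≥0∞, ∫⁻ w in R ⁻¹' {r}, G w ∂J
        = ∫⁻ w, ({r} : Set Bool).indicator 1 (R w) * G w ∂J := by
      intro G
      rw [← lintegral_indicator (hR (measurableSet_singleton _))]
      refine lintegral_congr fun w => ?_
      by_cases hw : R w = r <;> simp [hw]
    rw [e1, e1, key]
    refine lintegral_congr fun w => ?_
    simp only [Kernel.prodMkRight_apply]
    rw [lintegral_const_mul _ (by fun_prop)]
  · rintro ⟨η, hη, h⟩
    -- Adding the two fibers shows that `η` is a version of the conditional distribution under `J`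
    -- itself.
    have hsum : J.map (fun w => (k w, f w)) = J.map k ⊗ₘ η := by
      conv_lhs => rw [← Measure.restrict_fiber_add J hR]
      conv_rhs => rw [← Measure.restrict_fiber_add J hR]
      rw [Measure.map_add _ _ (by fun_prop), Measure.map_add _ _ hk, h, h,
        ← Measure.compProd_add_left]
    have hae := condDistrib_ae_eq_of_measure_eq_compProd k hf.aemeasurable hsum
    have hprod : (J.map (fun w => (k w, R w))) ⊗ₘ (condDistrib f k J).prodMkRight Bool
        = (J.map (fun w => (k w, R w))) ⊗ₘ η.prodMkRight Bool := by
      refine Measure.compProd_congr ?_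
      have h2 : ∀ᵐ w ∂J, condDistrib f k J (k w) = η (k w) := ae_of_ae_map hk.aemeasurable hae
      have : J.map k = (J.map (fun w => (k w, R w))).map Prod.fst := by
        rw [Measure.map_map measurable_fst (by fun_prop)]; rfl
      rw [this] at hae
      filter_upwards [ae_of_ae_map measurable_fst.aemeasurable hae] with p hp
      simp [Kernel.prodMkRight_apply, hp]
    rw [hprod]
    refine Measure.ext_of_lintegral _ fun F hF => ?_
    rw [lintegral_map hF hkRf, Measure.lintegral_compProd hF,
      lintegral_map hF.lintegral_kernel_prod_right' hkR,
      lintegral_eq_sum_fiber _ hR, lintegral_eq_sum_fiber _ hR]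
    refine Finset.sum_congr rfl fun r _ => ?_
    have key := congrArg (fun m => ∫⁻ p, F ((p.1, r), p.2) ∂m) (h r)
    rw [lintegral_map (by fun_prop) hkf, Measure.lintegral_compProd (by fun_prop),
      lintegral_map (f := fun a => ∫⁻ b, F ((a, r), b) ∂η a)
        (Measurable.lintegral_kernel_prod_right' (f := fun p : γ × β => F ((p.1, r), p.2))
          (by fun_prop)) hk] at key
    rw [setLIntegral_fiber_congr J hR r fun b w => F ((k w, b), f w), key]
    exact (setLIntegral_fiber_congr J hR r fun b w => ∫⁻ y, F ((k w, b), y) ∂η (k w)).symm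

/-- Conditional independence of the label and another variable, under a mixture of a law `μ₁` with
label `true` and a law `μ₀` with label `false`. -/
theorem condIndepFun_label_iff {μ₁ μ₀ : Measure Ω} [IsFiniteMeasure μ₁] [IsFiniteMeasure μ₀]
    {a b : ℝ≥0∞} (ha : a ≠ 0) (hb : b ≠ 0) (ha' : a ≠ ∞) (hb' : b ≠ ∞)
    {J : Measure (Ω × Bool)} [IsFiniteMeasure J]
    (hJ : J = a • μ₁.map (fun w => (w, true)) + b • μ₀.map (fun w => (w, false)))
    {f : Ω → β} {k : Ω → γ} (hf : Measurable f) (hk : Measurable k) :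
    CondIndepFun (MeasurableSpace.comap (fun v : Ω × Bool => k v.1) inferInstance)
        (hk.comp measurable_fst).comap_le (fun v => v.2) (fun v => f v.1) J ↔
      ∃ η : Kernel γ β, IsMarkovKernel η ∧ μ₁.map (fun w => (k w, f w)) = μ₁.map k ⊗ₘ η ∧
        μ₀.map (fun w => (k w, f w)) = μ₀.map k ⊗ₘ η := by
  have htrue : J.restrict (Prod.snd ⁻¹' {true}) = a • μ₁.map (fun w => (w, true)) := by
    ext s hs
    rw [Measure.restrict_apply hs, hJ, Measure.add_apply, Measure.smul_apply, Measure.smul_apply,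
      Measure.smul_apply,
      Measure.map_apply (by fun_prop) (hs.inter (measurable_snd (measurableSet_singleton _))),
      Measure.map_apply (by fun_prop) (hs.inter (measurable_snd (measurableSet_singleton _))),
      Measure.map_apply (by fun_prop) hs]
    simp [Set.preimage_preimage]
  have hfalse : J.restrict (Prod.snd ⁻¹' {false}) = b • μ₀.map (fun w => (w, false)) := by
    ext s hs
    rw [Measure.restrict_apply hs, hJ, Measure.add_apply, Measure.smul_apply, Measure.smul_apply,
      Measure.smul_apply,
      Measure.map_apply (by fun_prop) (hs.inter (measurable_snd (measurableSet_singleton _))),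
      Measure.map_apply (by fun_prop) (hs.inter (measurable_snd (measurableSet_singleton _))),
      Measure.map_apply (by fun_prop) hs]
    simp [Set.preimage_preimage]
  have hmap : ∀ (c : ℝ≥0∞) (μ : Measure Ω) [IsFiniteMeasure μ] (r : Bool) (η : Kernel γ β)
      [IsMarkovKernel η], c ≠ 0 → c ≠ ∞ →
      ((c • μ.map (fun w => (w, r))).map (fun v : Ω × Bool => (k v.1, f v.1))
        = (c • μ.map (fun w => (w, r))).map (fun v : Ω × Bool => k v.1) ⊗ₘ η ↔
      μ.map (fun w => (k w, f w)) = μ.map k ⊗ₘ η) := by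
    intro c μ _ r η _ hc hc'
    rw [Measure.map_smul, Measure.map_smul, Measure.map_map (by fun_prop) (by fun_prop),
      Measure.map_map (by fun_prop) (by fun_prop), Measure.compProd_smul_left]
    refine ⟨fun h => ?_, fun h => congrArg (c • ·) h⟩
    have := congrArg (c⁻¹ • ·) h
    simpa [smul_smul, ENNReal.inv_mul_cancel hc hc', Function.comp_def] using this
  rw [condIndepFun_bool_iff (R := fun v : Ω × Bool => v.2) measurable_snd
    (f := fun v : Ω × Bool => f v.1) (hf.comp measurable_fst)
    (k := fun v : Ω × Bool => k v.1) (hk.comp measurable_fst)]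
  refine exists_congr fun η => and_congr_right fun hη => ?_
  rw [Bool.forall_bool]
  change (J.restrict (Prod.snd ⁻¹' {false})).map _ = (J.restrict (Prod.snd ⁻¹' {false})).map _ ⊗ₘ _
    ∧ (J.restrict (Prod.snd ⁻¹' {true})).map _ = (J.restrict (Prod.snd ⁻¹' {true})).map _ ⊗ₘ _ ↔ _
  rw [htrue, hfalse, hmap a μ₁ true η ha ha', hmap b μ₀ false η hb hb', and_comm]

end ProbabilityTheory

/-! ### Transport of laws and densities along a map -/

namespace MeasureTheory

variable {Ω α β : Type*} [MeasurableSpace Ω] [MeasurableSpace α] [MeasurableSpace β]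

theorem setLIntegral_fiber_eq (μ : Measure Ω) {R : Ω → Bool} (hR : Measurable R) (r : Bool)
    (G : Ω → ℝ≥0∞) :
    ∫⁻ w in R ⁻¹' {r}, G w ∂μ = ∫⁻ w, ({r} : Set Bool).indicator 1 (R w) * G w ∂μ := by
  rw [← lintegral_indicator (hR (measurableSet_singleton _))]
  refine lintegral_congr fun w => ?_
  by_cases hw : R w = r <;> simp [hw]

theorem measurable_indicator_bool (r : Bool) :
    Measurable (({r} : Set Bool).indicator (1 : Bool → ℝ≥0∞)) := measurable_of_countable _

theorem Measure.map_eq_map_iff {μ ν : Measure Ω} {φ : Ω → α} (hφ : Measurable φ) :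
    μ.map φ = ν.map φ ↔
      ∀ G : α → ℝ≥0∞, Measurable G → ∫⁻ w, G (φ w) ∂μ = ∫⁻ w, G (φ w) ∂ν := by
  refine ⟨fun h G hG => ?_, fun h => Measure.ext_of_lintegral _ fun G hG => ?_⟩
  · rw [← lintegral_map hG hφ, h, lintegral_map hG hφ]
  · rw [lintegral_map hG hφ, lintegral_map hG hφ, h G hG]

theorem Measure.map_withDensity_comp {μ : Measure Ω} {φ : Ω → α} (hφ : Measurable φ)
    {l : α → ℝ≥0∞} (hl : Measurable l) :
    (μ.withDensity fun w => l (φ w)).map φ = (μ.map φ).withDensity l := by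
  refine Measure.ext_of_lintegral _ fun G hG => ?_
  rw [lintegral_map hG hφ, lintegral_withDensity_eq_lintegral_mul (f := fun w => l (φ w)) _
    (hl.comp hφ) (g := fun w => G (φ w)) (hG.comp hφ),
    lintegral_withDensity_eq_lintegral_mul _ hl hG, lintegral_map (hl.mul hG) hφ]
  rfl

theorem Measure.map_smul_add {μ₁ μ₀ : Measure Ω} (a b : ℝ≥0) {φ : Ω → α} (hφ : Measurable φ) :
    (a • μ₁ + b • μ₀).map φ = a • μ₁.map φ + b • μ₀.map φ := by
  rw [Measure.map_add _ _ hφ, Measure.map_smul, Measure.map_smul]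

theorem Measure.smul_add_compProd {μ₁ μ₀ : Measure α} [SFinite μ₁] [SFinite μ₀] (a b : ℝ≥0)
    (η : Kernel α β) [IsSFiniteKernel η] :
    (a • μ₁ + b • μ₀) ⊗ₘ η = a • (μ₁ ⊗ₘ η) + b • (μ₀ ⊗ₘ η) := by
  rw [Measure.compProd_add_left]
  simp only [ENNReal.smul_def, Measure.compProd_smul_left]

/-- A density ratio that depends on `k` only is inherited by `(k, f)` when the conditional law of
`f` given `k` is common to both components. -/
theorem Measure.map_prodMk_eq_of_common_kernel {μ₁ μ₀ : Measure Ω} [IsFiniteMeasure μ₁]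
    [IsFiniteMeasure μ₀] (a b : ℝ≥0) {k : Ω → α} {f : Ω → β} (hk : Measurable k)
    (hf : Measurable f) {η : Kernel α β} [IsMarkovKernel η]
    (h₁ : μ₁.map (fun w => (k w, f w)) = μ₁.map k ⊗ₘ η)
    (h₀ : μ₀.map (fun w => (k w, f w)) = μ₀.map k ⊗ₘ η)
    {l : α → ℝ≥0∞} (hl : Measurable l)
    (h : (a • μ₁ + b • μ₀).map k = (μ₁.withDensity fun w => l (k w)).map k) :
    (a • μ₁ + b • μ₀).map (fun w => (k w, f w))
      = (μ₁.withDensity fun w => l (k w)).map (fun w => (k w, f w)) := by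
  have e := Measure.map_withDensity_comp (μ := μ₁) (hk.prodMk hf) (l := fun p => l p.1)
    (hl.comp measurable_fst)
  simp only at e
  rw [Measure.map_smul_add _ _ (hk.prodMk hf), h₁, h₀, ← Measure.smul_add_compProd,
    ← Measure.map_smul_add _ _ hk, h, Measure.map_withDensity_comp hk hl,
    Measure.withDensity_compProd _ hl, e, h₁]

end MeasureTheory

namespace FullData
variable {𝒳 𝒮 : Type*} [MeasurableSpace 𝒳] [MeasurableSpace 𝒮]

theorem measurable_Ypot (t : Bool) : Measurable (Ypot t : FullData 𝒳 𝒮 → ℝ) :=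
  (measurable_pi_apply t).comp (measurable_snd.comp (measurable_snd.comp measurable_snd))

theorem measurable_eval_T {β : Type*} [MeasurableSpace β] {f : Bool → FullData 𝒳 𝒮 → β}
    (hf : ∀ t, Measurable (f t)) : Measurable fun w => f (T w) w := by
  have : Measurable fun p : Bool × FullData 𝒳 𝒮 => f p.1 p.2 :=
    measurable_from_prod_countable_right hf
  exact this.comp (measurable_T.prodMk measurable_id)

theorem measurable_S : Measurable (S : FullData 𝒳 𝒮 → 𝒮) := measurable_eval_T measurable_Spot

theorem measurable_Y : Measurable (Y : FullData 𝒳 𝒮 → ℝ) := measurable_eval_T measurable_Ypot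

theorem measurable_XT : Measurable (XT : FullData 𝒳 𝒮 → 𝒳 × Bool) :=
  measurable_X.prodMk measurable_T

theorem measurable_XTS : Measurable (XTS : FullData 𝒳 𝒮 → 𝒳 × Bool × 𝒮) :=
  measurable_X.prodMk (measurable_T.prodMk measurable_S)

theorem measurable_XTSY : Measurable (XTSY : FullData 𝒳 𝒮 → 𝒳 × Bool × 𝒮 × ℝ) :=
  measurable_X.prodMk (measurable_T.prodMk (measurable_S.prodMk measurable_Y))

end FullData

attribute [fun_prop] FullData.measurable_X FullData.measurable_T FullData.measurable_Spot
  FullData.measurable_Ypot FullData.measurable_S FullData.measurable_Y FullData.measurable_XT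
  FullData.measurable_XTS FullData.measurable_XTSY

/-! ### Independence of R as a kernel shared by both subpopulations -/

namespace Population

variable {𝒳 𝒮 : Type*} [MeasurableSpace 𝒳] [MeasurableSpace 𝒮]

theorem isProbabilityMeasure_law {ρ : ℝ} (hρ₀ : 0 ≤ ρ) (hρ₁ : ρ < 1) (P : Population 𝒳 𝒮) :
    IsProbabilityMeasure (P.law ρ) := by
  constructor
  simp only [law, Measure.add_apply, Measure.smul_apply, measure_univ, ENNReal.smul_def,
    smul_eq_mul, mul_one, ← ENNReal.coe_add]
  rw [← Real.toNNReal_add hρ₀ (by linarith)]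
  simp

variable [StandardBorelSpace 𝒳] [StandardBorelSpace 𝒮]
  {α β : Type*} [MeasurableSpace α] [MeasurableSpace β] [StandardBorelSpace β] [Nonempty β]

/-- Under the joint law, the label is conditionally independent of `f` given `k` iff both
conditional laws have a common conditional distribution of `f` given `k`. -/
theorem condIndepFun_joint_iff {q : ℝ} (hq₀ : 0 < q) (hq₁ : q < 1) (P : Population 𝒳 𝒮)
    {k : FullData 𝒳 𝒮 → α} {f : FullData 𝒳 𝒮 → β} (hk : Measurable k) (hf : Measurable f) :
    CondIndepFun (MeasurableSpace.comap (fun v : FullData 𝒳 𝒮 × Bool => k v.1) inferInstance)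
        (hk.comp measurable_fst).comap_le (fun v => v.2) (fun v => f v.1) (P.joint q) ↔
      ∃ η : Kernel α β, IsMarkovKernel η ∧
        P.labelled.map (fun w => (k w, f w)) = P.labelled.map k ⊗ₘ η ∧
        (P.unl : Measure (FullData 𝒳 𝒮)).map (fun w => (k w, f w))
          = (P.unl : Measure (FullData 𝒳 𝒮)).map k ⊗ₘ η := by
  refine condIndepFun_label_iff (J := P.joint q) (a := q.toNNReal) (b := (1 - q).toNNReal) ?_ ?_
    ENNReal.coe_ne_top ENNReal.coe_ne_top rfl hf hk
  · simpa using hq₀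
  · simpa using hq₁

/-- The version of `condIndepFun_joint_iff` given `T = t`. -/
theorem condIndepFun_cond_joint_iff {q : ℝ} (hq₀ : 0 < q) (hq₁ : q < 1) (P : Population 𝒳 𝒮)
    (t : Bool) {k : FullData 𝒳 𝒮 → α} {f : FullData 𝒳 𝒮 → β} (hk : Measurable k)
    (hf : Measurable f) :
    CondIndepFun (MeasurableSpace.comap (fun v : FullData 𝒳 𝒮 × Bool => k v.1) inferInstance)
        (hk.comp measurable_fst).comap_le (fun v => v.2) (fun v => f v.1)
        ((P.joint q)[|{v | T v.1 = t}]) ↔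
      ∃ η : Kernel α β, IsMarkovKernel η ∧
        (P.labelled.restrict (T ⁻¹' {t})).map (fun w => (k w, f w))
          = (P.labelled.restrict (T ⁻¹' {t})).map k ⊗ₘ η ∧
        ((P.unl : Measure (FullData 𝒳 𝒮)).restrict (T ⁻¹' {t})).map (fun w => (k w, f w))
          = ((P.unl : Measure (FullData 𝒳 𝒮)).restrict (T ⁻¹' {t})).map k ⊗ₘ η := by
  have hT : MeasurableSet ((T : FullData 𝒳 𝒮 → Bool) ⁻¹' {t}) :=
    measurable_T (measurableSet_singleton _)
  have hs : MeasurableSet {v : FullData 𝒳 𝒮 × Bool | T v.1 = t} := measurable_fst hT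
  have hq : ((q.toNNReal : ℝ≥0) : ℝ≥0∞) ≠ 0 := by simpa using hq₀
  have hq' : (((1 - q).toNNReal : ℝ≥0) : ℝ≥0∞) ≠ 0 := by simpa using hq₁
  have hres : (P.joint q).restrict {v | T v.1 = t}
      = (q.toNNReal : ℝ≥0∞) • (P.labelled.restrict (T ⁻¹' {t})).map (fun w => (w, true))
        + ((1 - q).toNNReal : ℝ≥0∞) •
          ((P.unl : Measure (FullData 𝒳 𝒮)).restrict (T ⁻¹' {t})).map (fun w => (w, false)) := by
    ext u hu
    rw [Measure.restrict_apply hu]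
    simp only [joint, Measure.add_apply, Measure.smul_apply, ENNReal.smul_def]
    rw [Measure.map_apply (by fun_prop) (hu.inter hs), Measure.map_apply (by fun_prop)
      (hu.inter hs), Measure.map_apply (by fun_prop) hu, Measure.map_apply (by fun_prop) hu,
      Measure.restrict_apply (measurable_prodMk_right hu),
      Measure.restrict_apply (measurable_prodMk_right hu)]
    rfl
  -- If `T = t` is null, conditioning gives the zero measure and both restricted laws vanish, so
  -- either side holds with an arbitrary kernel.
  by_cases h0 : P.joint q {v | T v.1 = t} = 0
  · have hr := hres
    rw [Measure.restrict_eq_zero.2 h0] at hr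
    have hu : ∀ (i : Bool) (μ : Measure (FullData 𝒳 𝒮)) (c : ℝ≥0∞), c ≠ 0 →
        (c • μ.map (fun w => (w, i))) Set.univ = 0 → μ = 0 := by
      intro i μ c hc h
      rw [Measure.smul_apply, Measure.map_apply (by fun_prop) MeasurableSet.univ] at h
      simpa [hc] using h
    have hsum := congrArg (fun m => m Set.univ) hr.symm
    simp only [Measure.add_apply, Measure.coe_zero, Pi.zero_apply, add_eq_zero] at hsum
    have h1 := hu _ _ _ hq hsum.1
    have h2 := hu _ _ _ hq' hsum.2
    rw [h1, h2]
    have hc : (P.joint q)[|{v | T v.1 = t}] = 0 := ProbabilityTheory.cond_eq_zero.2 (Or.inr h0)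
    have hη : IsMarkovKernel (Kernel.const α (Measure.dirac (Classical.arbitrary β))) :=
      inferInstance
    refine ⟨fun _ => ⟨Kernel.const α (Measure.dirac (Classical.arbitrary β)), hη, by simp, by simp⟩,
      fun _ => ?_⟩
    refine (condIndepFun_bool_iff (R := fun v : FullData 𝒳 𝒮 × Bool => v.2) measurable_snd
      (f := fun v : FullData 𝒳 𝒮 × Bool => f v.1) (hf.comp measurable_fst)
      (k := fun v : FullData 𝒳 𝒮 × Bool => k v.1) (hk.comp measurable_fst)).2 ⟨_, hη, fun r => ?_⟩
    simp [hc]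
  · have hi : (P.joint q {v | T v.1 = t})⁻¹ ≠ 0 :=
      ENNReal.inv_ne_zero.2 (measure_ne_top _ _)
    have hi' : (P.joint q {v | T v.1 = t})⁻¹ ≠ ∞ := ENNReal.inv_ne_top.2 h0
    refine condIndepFun_label_iff (a := (P.joint q {v | T v.1 = t})⁻¹ * q.toNNReal)
      (b := (P.joint q {v | T v.1 = t})⁻¹ * (1 - q).toNNReal) (mul_ne_zero hi hq)
      (mul_ne_zero hi hq') (ENNReal.mul_ne_top hi' ENNReal.coe_ne_top)
      (ENNReal.mul_ne_top hi' ENNReal.coe_ne_top) ?_ hf hk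
    rw [ProbabilityTheory.cond, hres, smul_add, smul_smul, smul_smul]

end Population

/-! ### Identification of the unconditional law from the labelled law -/

namespace Population

variable {𝒳 𝒮 : Type*} [MeasurableSpace 𝒳] [MeasurableSpace 𝒮]

/-- The density ratio, truncated at `C`. -/
noncomputable def lamClip (ρ C : ℝ) (P : Population 𝒳 𝒮) (x : 𝒳) : ℝ := min (P.lam ρ x) C

/-- The law of the labelled data, reweighted by the truncated density ratio. -/
noncomputable def reweighted (ρ C : ℝ) (P : Population 𝒳 𝒮) : Measure (FullData 𝒳 𝒮) :=
  P.labelled.withDensity fun w => ENNReal.ofReal (P.lamClip ρ C (X w))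

@[fun_prop]
theorem measurable_lam (ρ : ℝ) (P : Population 𝒳 𝒮) : Measurable (P.lam ρ) :=
  (Measure.measurable_rnDeriv _ _).ennreal_toReal

@[fun_prop]
theorem measurable_lamClip (ρ C : ℝ) (P : Population 𝒳 𝒮) : Measurable (P.lamClip ρ C) :=
  (P.measurable_lam ρ).min measurable_const

@[fun_prop]
theorem measurable_e (ρ : ℝ) (P : Population 𝒳 𝒮) : Measurable (P.e ρ) :=
  (Kernel.measurable_coe _ (measurableSet_singleton _)).ennreal_toReal

theorem lam_nonneg (ρ : ℝ) (P : Population 𝒳 𝒮) (x : 𝒳) : 0 ≤ P.lam ρ x := ENNReal.toReal_nonneg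

theorem lamClip_le (ρ C : ℝ) (P : Population 𝒳 𝒮) (x : 𝒳) : P.lamClip ρ C x ≤ C :=
  min_le_right _ _

theorem lamClip_nonneg (ρ : ℝ) {C : ℝ} (hC : 0 ≤ C) (P : Population 𝒳 𝒮) (x : 𝒳) :
    0 ≤ P.lamClip ρ C x := le_min (P.lam_nonneg ρ x) hC

variable [StandardBorelSpace 𝒳] [StandardBorelSpace 𝒮] {ρ ε C : ℝ} {P : Population 𝒳 𝒮}

namespace Admissible

theorem C_nonneg (hP : P.Admissible ρ ε C) (hρ₀ : 0 ≤ ρ) (hρ₁ : ρ < 1) : 0 ≤ C := by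
  have := P.isProbabilityMeasure_law hρ₀ hρ₁
  obtain ⟨w, hw⟩ := hP.lam_le.exists
  exact (P.lam_nonneg ρ _).trans hw

theorem withDensity_lam (hP : P.Admissible ρ ε C) :
    (P.labelled.map X).withDensity (fun x => ENNReal.ofReal (P.lam ρ x)) = (P.law ρ).map X := by
  conv_rhs => rw [← Measure.withDensity_rnDeriv_eq _ _ hP.absolutelyContinuous]
  refine withDensity_congr_ae ?_
  filter_upwards [Measure.rnDeriv_lt_top ((P.law ρ).map X) (P.labelled.map X)] with x hx
  exact ENNReal.ofReal_toReal hx.ne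

/-- The law of X has density λ with respect to its labelled law, so an unconditional null set can
carry labelled mass only where λ = 0. Overlap and the bound on λ are assumed under the unconditional
law only, and reach the labelled data in this way. -/
theorem ae_of_law (hP : P.Admissible ρ ε C) {p : 𝒳 → Prop} (hp : MeasurableSet {x | p x})
    (h : ∀ᵐ w ∂(P.law ρ), p (X w)) : ∀ᵐ w ∂P.labelled, P.lam ρ (X w) ≠ 0 → p (X w) := by
  have h' : ∀ᵐ x ∂(P.law ρ).map X, p x := (ae_map_iff measurable_X.aemeasurable hp).2 h
  rw [← hP.withDensity_lam, ae_withDensity_iff (by fun_prop)] at h'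
  filter_upwards [ae_of_ae_map measurable_X.aemeasurable h'] with w hw hne
  refine hw ?_
  simpa using lt_of_le_of_ne (P.lam_nonneg ρ _) hne.symm

theorem lam_le_labelled (hP : P.Admissible ρ ε C) (hρ₀ : 0 ≤ ρ) (hρ₁ : ρ < 1) :
    ∀ᵐ w ∂P.labelled, P.lam ρ (X w) ≤ C := by
  filter_upwards [hP.ae_of_law (measurableSet_le (P.measurable_lam ρ) measurable_const) hP.lam_le]
    with w hw
  by_cases h : P.lam ρ (X w) = 0
  · rw [h]; exact hP.C_nonneg hρ₀ hρ₁
  · exact hw h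

/-- Truncation costs nothing on admissible populations. It replaces an almost sure bound by a
pointwise one, valid for all populations on a path simultaneously. -/
theorem lamClip_ae_eq (hP : P.Admissible ρ ε C) (hρ₀ : 0 ≤ ρ) (hρ₁ : ρ < 1) :
    ∀ᵐ w ∂P.labelled, P.lamClip ρ C (X w) = P.lam ρ (X w) := by
  filter_upwards [hP.lam_le_labelled hρ₀ hρ₁] with w hw using min_eq_left hw

theorem reweighted_eq (hP : P.Admissible ρ ε C) (hρ₀ : 0 ≤ ρ) (hρ₁ : ρ < 1) :
    P.reweighted ρ C = P.labelled.withDensity fun w => ENNReal.ofReal (P.lam ρ (X w)) := by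
  refine withDensity_congr_ae ?_
  filter_upwards [hP.lamClip_ae_eq hρ₀ hρ₁] with w hw
  rw [hw]

theorem map_X_law (hP : P.Admissible ρ ε C) (hρ₀ : 0 ≤ ρ) (hρ₁ : ρ < 1) :
    (P.law ρ).map X = (P.reweighted ρ C).map X := by
  rw [hP.reweighted_eq hρ₀ hρ₁, ← hP.withDensity_lam]
  exact (Measure.map_withDensity_comp measurable_X (by fun_prop)).symm

/-- First link of the chain: by R ⊥ T | X the treatment kernel is shared, so the density ratio of X
is also that of (X, T). -/
theorem map_XT_law (hP : P.Admissible ρ ε C) (hρ₀ : 0 ≤ ρ) (hρ₁ : ρ < 1) :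
    (P.law ρ).map XT = (P.reweighted ρ C).map XT := by
  -- The kernel condition is the same for every q in (0, 1), so any value serves; the actual `ρ` may
  -- be zero.
  obtain ⟨η, _, h₁, h₀⟩ := (condIndepFun_joint_iff (q := 1 / 2) (by norm_num) (by norm_num) P
    measurable_X measurable_T).1 (hP.treatment_mar (1 / 2) (by norm_num) (by norm_num))
  exact Measure.map_prodMk_eq_of_common_kernel ρ.toNNReal (1 - ρ).toNNReal measurable_X
    measurable_T h₁ h₀ (l := fun x => ENNReal.ofReal (P.lamClip ρ C x)) (by fun_prop)
    (hP.map_X_law hρ₀ hρ₁)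

theorem map_TX_Spot_law [Nonempty 𝒮] (hP : P.Admissible ρ ε C) (hρ₀ : 0 ≤ ρ) (hρ₁ : ρ < 1)
    (t : Bool) :
    (P.law ρ).map (fun w => ((T w, X w), Spot t w))
      = (P.reweighted ρ C).map (fun w => ((T w, X w), Spot t w)) := by
  have hTX : Measurable fun w : FullData 𝒳 𝒮 => (T w, X w) := by fun_prop
  obtain ⟨η, _, h₁, h₀⟩ := (condIndepFun_joint_iff (q := 1 / 2) (by norm_num) (by norm_num) P
    hTX (measurable_Spot t)).1 (hP.surrogate_mar (1 / 2) (by norm_num) (by norm_num) t)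
  refine Measure.map_prodMk_eq_of_common_kernel ρ.toNNReal (1 - ρ).toNNReal hTX
    (measurable_Spot t) h₁ h₀ (l := fun x => ENNReal.ofReal (P.lamClip ρ C x.2)) (by fun_prop) ?_
  rw [Measure.map_eq_map_iff hTX]
  intro G hG
  exact (Measure.map_eq_map_iff measurable_XT).1 (hP.map_XT_law hρ₀ hρ₁) (fun p => G (p.2, p.1))
    (by fun_prop)

/-- Last link of the chain. The independence of R and Y(t) is assumed only given T = t, hence the
restriction to a fiber; there S(t) and Y(t) are the observed S and Y. -/
theorem map_fiber_law [Nonempty 𝒮] (hP : P.Admissible ρ ε C) (hρ₀ : 0 ≤ ρ) (hρ₁ : ρ < 1)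
    (t : Bool) :
    ((P.law ρ).restrict (T ⁻¹' {t})).map (fun w => ((X w, Spot t w), Ypot t w))
      = ((P.reweighted ρ C).restrict (T ⁻¹' {t})).map (fun w => ((X w, Spot t w), Ypot t w)) := by
  have hT : MeasurableSet ((T : FullData 𝒳 𝒮 → Bool) ⁻¹' {t}) :=
    measurable_T (measurableSet_singleton _)
  have hXS : Measurable fun w : FullData 𝒳 𝒮 => (X w, Spot t w) := by fun_prop
  obtain ⟨η, _, h₁, h₀⟩ := (condIndepFun_cond_joint_iff (q := 1 / 2) (by norm_num) (by norm_num) P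
    t hXS (measurable_Ypot t)).1 (hP.missing_at_random (1 / 2) (by norm_num) (by norm_num) t)
  have e₁ : (P.law ρ).restrict (T ⁻¹' {t}) = ρ.toNNReal • P.labelled.restrict (T ⁻¹' {t})
      + (1 - ρ).toNNReal • (P.unl : Measure (FullData 𝒳 𝒮)).restrict (T ⁻¹' {t}) := by
    rw [law, Measure.restrict_add, Measure.restrict_smul, Measure.restrict_smul]
  have e₂ : (P.reweighted ρ C).restrict (T ⁻¹' {t})
      = (P.labelled.restrict (T ⁻¹' {t})).withDensity
        fun w => ENNReal.ofReal (P.lamClip ρ C (X w, Spot t w).1) := by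
    rw [reweighted, restrict_withDensity hT]
  have key : ((P.law ρ).restrict (T ⁻¹' {t})).map (fun w => (X w, Spot t w))
      = ((P.reweighted ρ C).restrict (T ⁻¹' {t})).map (fun w => (X w, Spot t w)) := by
    rw [Measure.map_eq_map_iff hXS]
    intro G hG
    rw [setLIntegral_fiber_eq _ measurable_T, setLIntegral_fiber_eq _ measurable_T]
    exact (Measure.map_eq_map_iff (by fun_prop)).1 (hP.map_TX_Spot_law hρ₀ hρ₁ t)
      (fun p => ({t} : Set Bool).indicator 1 p.1.1 * G (p.1.2, p.2))
      (((measurable_indicator_bool t).comp (by fun_prop)).mul (by fun_prop))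
  rw [e₁, e₂] at key ⊢
  exact Measure.map_prodMk_eq_of_common_kernel _ _ hXS (measurable_Ypot t) h₁ h₀
    (l := fun p => ENNReal.ofReal (P.lamClip ρ C p.1)) (by fun_prop) key

/-- The unconditional law of `(X, T, S, Y)` is the labelled one, reweighted by the density ratio
of the covariates. -/
theorem map_XTSY_law [Nonempty 𝒮] (hP : P.Admissible ρ ε C) (hρ₀ : 0 ≤ ρ) (hρ₁ : ρ < 1) :
    (P.law ρ).map XTSY = (P.reweighted ρ C).map XTSY := by
  rw [Measure.map_eq_map_iff measurable_XTSY]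
  intro G hG
  rw [lintegral_eq_sum_fiber _ measurable_T, lintegral_eq_sum_fiber _ measurable_T]
  refine Finset.sum_congr rfl fun t _ => ?_
  have e : ∀ μ : Measure (FullData 𝒳 𝒮), ∫⁻ w in T ⁻¹' {t}, G (XTSY w) ∂μ
      = ∫⁻ w in T ⁻¹' {t}, G (X w, t, Spot t w, Ypot t w) ∂μ := fun μ =>
    setLIntegral_fiber_congr μ measurable_T t fun b w => G (X w, b, Spot b w, Ypot b w)
  rw [e, e]
  exact (Measure.map_eq_map_iff (by fun_prop)).1 (hP.map_fiber_law hρ₀ hρ₁ t)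
    (fun p => G (p.1.1, t, p.1.2, p.2)) (by fun_prop)

/-- Inverse probability weighting recovers the law of the potential variables. -/
theorem map_potential_law [Nonempty 𝒮] (hP : P.Admissible ρ ε C) (hε : 0 < ε) (t : Bool) :
    (P.law ρ).map (fun w => (X w, Ypot t w, Spot t w))
      = (((P.law ρ).restrict (T ⁻¹' {t})).withDensity
          fun w => (condDistrib T X (P.law ρ) (X w) {t})⁻¹).map
        (fun w => (X w, Ypot t w, Spot t w)) := by
  have hYS : Measurable fun w : FullData 𝒳 𝒮 => (Ypot t w, Spot t w) := by fun_prop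
  obtain ⟨η, _, h⟩ := (condIndepFun_bool_iff measurable_T hYS measurable_X).1
    (hP.unconfounded t).symm
  have hp : Measurable fun x => condDistrib T X (P.law ρ) x {t} :=
    Kernel.measurable_coe _ (measurableSet_singleton _)
  have hp' : Measurable fun x => (condDistrib T X (P.law ρ) x {t})⁻¹ := hp.inv
  have h1 : (P.law ρ).map (fun w => (X w, Ypot t w, Spot t w)) = (P.law ρ).map X ⊗ₘ η := by
    conv_lhs => rw [← Measure.restrict_fiber_add (P.law ρ) measurable_T]
    conv_rhs => rw [← Measure.restrict_fiber_add (P.law ρ) measurable_T]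
    rw [Measure.map_add _ _ (by fun_prop), Measure.map_add _ _ measurable_X, h, h,
      ← Measure.compProd_add_left]
  have h2 : ((P.law ρ).restrict (T ⁻¹' {t})).map X
      = ((P.law ρ).map X).withDensity fun x => condDistrib T X (P.law ρ) x {t} := by
    ext s hs
    rw [Measure.map_apply measurable_X hs, Measure.restrict_apply (measurable_X hs),
      withDensity_apply _ hs, ← setLIntegral_preimage_condDistrib measurable_X
        measurable_T.aemeasurable (measurableSet_singleton t) hs,
      setLIntegral_map hs hp measurable_X]
  -- Overlap keeps both e and 1 - e at least `ε`, so the weight of either arm can be inverted.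
  have hpos : ∀ᵐ x ∂(P.law ρ).map X, condDistrib T X (P.law ρ) x {t} ≠ 0 := by
    refine (ae_map_iff measurable_X.aemeasurable
      (p := fun x => condDistrib T X (P.law ρ) x {t} ≠ 0)
      (hp (measurableSet_singleton 0).compl)).2 ?_
    filter_upwards [hP.overlap] with w hw h0
    have hsum : (condDistrib T X (P.law ρ) (X w)).real {true}
        + (condDistrib T X (P.law ρ) (X w)).real {false} = 1 := by
      have := probReal_compl_eq_one_sub (μ := condDistrib T X (P.law ρ) (X w))
        (measurableSet_singleton true)
      have hc : ({true} : Set Bool)ᶜ = {false} := by ext b; simp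
      rw [hc] at this; linarith
    have h0' : (condDistrib T X (P.law ρ) (X w)).real {t} = 0 := by
      simp [measureReal_def, h0]
    simp only [e] at hw
    cases t <;> linarith [hw.1, hw.2]
  have e := Measure.map_withDensity_comp (μ := (P.law ρ).restrict (T ⁻¹' {t}))
    (φ := fun w => (X w, Ypot t w, Spot t w)) (by fun_prop)
    (l := fun p => (condDistrib T X (P.law ρ) p.1 {t})⁻¹) (hp.comp measurable_fst).inv
  simp only at e
  rw [e, h1, h, ← Measure.withDensity_compProd _ hp', h2,
    ← withDensity_mul _ hp hp']
  congr 1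
  conv_lhs => rw [← withDensity_one (μ := (P.law ρ).map X)]
  refine withDensity_congr_ae ?_
  filter_upwards [hpos] with x hx
  simp [ENNReal.mul_inv_cancel hx (measure_ne_top _ _)]

end Admissible

end Population

/-! ### Cauchy–Schwarz and weak convergence in L² -/

namespace MeasureTheory

section CauchySchwarz

variable {O : Type*} [MeasurableSpace O] {μ : Measure O} {f g : O → ℝ}

theorem MemLp.integrable_mul_two (hf : MemLp f 2 μ) (hg : MemLp g 2 μ) :
    Integrable (fun w => f w * g w) μ := hf.integrable_mul hg

/-- The quadratic polynomial ∫ (|f| s + |g|)² in s is nonnegative, so its discriminant is not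
positive. -/
theorem sq_integral_abs_mul_le (hf : MemLp f 2 μ) (hg : MemLp g 2 μ) :
    (∫ w, |f w * g w| ∂μ) ^ 2 ≤ (∫ w, f w ^ 2 ∂μ) * ∫ w, g w ^ 2 ∂μ := by
  have hfg := (hf.integrable_mul_two hg).abs
  have key : ∀ s : ℝ, 0 ≤ (∫ w, f w ^ 2 ∂μ) * (s * s) + (2 * ∫ w, |f w * g w| ∂μ) * s
      + ∫ w, g w ^ 2 ∂μ := by
    intro s
    have : (∫ w, f w ^ 2 ∂μ) * (s * s) + (2 * ∫ w, |f w * g w| ∂μ) * s + ∫ w, g w ^ 2 ∂μ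
        = ∫ w, (f w ^ 2 * (s * s) + (2 * |f w * g w|) * s + g w ^ 2) ∂μ := by
      have h1 : Integrable (fun w => f w ^ 2 * (s * s)) μ := hf.integrable_sq.mul_const _
      have h2 : Integrable (fun w => 2 * |f w * g w| * s) μ := (hfg.const_mul 2).mul_const _
      have h12 : Integrable (fun w => f w ^ 2 * (s * s) + 2 * |f w * g w| * s) μ := h1.add h2
      rw [integral_add h12 hg.integrable_sq, integral_add h1 h2, integral_mul_const,
        integral_mul_const, integral_const_mul]
    rw [this]
    refine integral_nonneg fun w => ?_
    have e : f w ^ 2 * (s * s) + (2 * |f w * g w|) * s + g w ^ 2 = (|f w| * s + |g w|) ^ 2 := by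
      rw [abs_mul, ← sq_abs (f w), ← sq_abs (g w)]; ring
    simp only [Pi.zero_apply, e]
    positivity
  have := discrim_le_zero key
  rw [discrim] at this
  nlinarith

theorem integral_abs_mul_le_sqrt (hf : MemLp f 2 μ) (hg : MemLp g 2 μ) :
    ∫ w, |f w * g w| ∂μ ≤ √(∫ w, f w ^ 2 ∂μ) * √(∫ w, g w ^ 2 ∂μ) := by
  rw [← Real.sqrt_mul (integral_nonneg fun w => sq_nonneg _)]
  exact Real.le_sqrt_of_sq_le (sq_integral_abs_mul_le hf hg)

theorem abs_integral_mul_le_sqrt (hf : MemLp f 2 μ) (hg : MemLp g 2 μ) :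
    |∫ w, f w * g w ∂μ| ≤ √(∫ w, f w ^ 2 ∂μ) * √(∫ w, g w ^ 2 ∂μ) :=
  abs_integral_le_integral_abs.trans (integral_abs_mul_le_sqrt hf hg)

/-- A family that is bounded in `L²` and converges to `0` in `L¹` converges to `0` weakly in `L²`,
in the strong sense that absolute values are allowed. -/
theorem tendsto_integral_abs_mul_of_bounded {ι : Type*} {l : Filter ι} {u : ι → O → ℝ} {B : ℝ}
    (hu : ∀ᶠ t in l, MemLp (u t) 2 μ ∧ ∫ w, u t w ^ 2 ∂μ ≤ B ∧ Integrable (u t) μ)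
    (hu0 : Tendsto (fun t => ∫ w, |u t w| ∂μ) l (𝓝 0)) (hg : MemLp g 2 μ) :
    Tendsto (fun t => ∫ w, |u t w * g w| ∂μ) l (𝓝 0) := by
  wlog hgm : StronglyMeasurable g generalizing g
  · have h := this (hg.ae_eq hg.1.ae_eq_mk) hg.1.stronglyMeasurable_mk
    refine h.congr fun t => integral_congr_ae ?_
    filter_upwards [hg.1.ae_eq_mk] with w hw
    rw [hw]
  have hset : ∀ n : ℕ, MeasurableSet {w | (n : ℝ) < |g w|} := fun n =>
    measurableSet_lt measurable_const hgm.measurable.norm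
  have htail : Tendsto (fun n : ℕ => ∫ w, ({w | (n : ℝ) < |g w|}.indicator g w) ^ 2 ∂μ) atTop
      (𝓝 0) := by
    have := tendsto_integral_of_dominated_convergence (μ := μ)
      (F := fun (n : ℕ) w => ({w | (n : ℝ) < |g w|}.indicator g w) ^ 2) (f := fun _ => (0 : ℝ))
      (fun w => g w ^ 2)
      (fun n => ((hgm.indicator (hset n)).pow 2).aestronglyMeasurable) hg.integrable_sq
      (fun n => Eventually.of_forall fun w => by
        by_cases hw : w ∈ {w | (n : ℝ) < |g w|}
        · simp [Set.indicator_of_mem hw]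
        · simp [Set.indicator_of_notMem hw, sq_nonneg])
      (Eventually.of_forall fun w => by
        refine tendsto_const_nhds.congr' ?_
        obtain ⟨N, hN⟩ := exists_nat_ge |g w|
        filter_upwards [eventually_ge_atTop N] with n hn
        have : w ∉ {w | (n : ℝ) < |g w|} := by
          simp only [Set.mem_ofPred_eq, not_lt]
          exact hN.trans (by exact_mod_cast hn)
        simp [Set.indicator_of_notMem this])
    simpa using this
  have htail' : Tendsto (fun n : ℕ => √B * √(∫ w, ({w | (n : ℝ) < |g w|}.indicator g w) ^ 2 ∂μ))
      atTop (𝓝 0) := by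
    have := (htail.sqrt).const_mul (√B)
    simpa using this
  -- Split g at height n. The tail of g is small in L² and is paired with the L² bound on u; the
  -- rest is bounded by n and is paired with the L¹ convergence of u.
  rw [Metric.tendsto_nhds]
  intro η hη
  obtain ⟨n, hn⟩ := (htail'.eventually (gt_mem_nhds (half_pos hη))).exists
  have hM : Tendsto (fun t => (n : ℝ) * ∫ w, |u t w| ∂μ) l (𝓝 0) := by simpa using hu0.const_mul _
  filter_upwards [hu, hM.eventually (gt_mem_nhds (half_pos hη))] with t ⟨h2, hB, h1⟩ ht
  have hgi : MemLp ({w | (n : ℝ) < |g w|}.indicator g) 2 μ := hg.indicator (hset n)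
  have hle : ∫ w, |u t w * g w| ∂μ ≤ ∫ w, ((n : ℝ) * |u t w|
      + |u t w * {w | (n : ℝ) < |g w|}.indicator g w|) ∂μ := by
    refine integral_mono (h2.integrable_mul_two hg).abs
      ((h1.abs.const_mul _).add (h2.integrable_mul_two hgi).abs) fun w => ?_
    by_cases hw : w ∈ {w | (n : ℝ) < |g w|}
    · simp only [Set.indicator_of_mem hw]
      have : 0 ≤ (n : ℝ) * |u t w| := by positivity
      linarith
    · simp only [Set.indicator_of_notMem hw, mul_zero, abs_zero, add_zero, abs_mul]
      simp only [Set.mem_ofPred_eq, not_lt] at hw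
      rw [mul_comm]
      exact mul_le_mul_of_nonneg_right hw (abs_nonneg _)
  rw [integral_add (h1.abs.const_mul _) (h2.integrable_mul_two hgi).abs,
    integral_const_mul] at hle
  have h3 := integral_abs_mul_le_sqrt h2 hgi
  have h4 : √(∫ w, u t w ^ 2 ∂μ) * √(∫ w, ({w | (n : ℝ) < |g w|}.indicator g w) ^ 2 ∂μ)
      ≤ √B * √(∫ w, ({w | (n : ℝ) < |g w|}.indicator g w) ^ 2 ∂μ) :=
    mul_le_mul_of_nonneg_right (Real.sqrt_le_sqrt hB) (Real.sqrt_nonneg _)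
  rw [Real.dist_eq, sub_zero, abs_of_nonneg (integral_nonneg fun w => abs_nonneg _)]
  linarith

end CauchySchwarz

/-! ### Root densities and differentiability in quadratic mean -/

section RootDensity

variable {O : Type*} [MeasurableSpace O]

/-- The root of the density of `Q` with respect to `ν`. -/
noncomputable def rootDensity (Q ν : Measure O) (w : O) : ℝ := √(Q.rnDeriv ν w).toReal

variable {Q ν : Measure O} [IsFiniteMeasure Q] [IsFiniteMeasure ν]

theorem rootDensity_nonneg (Q ν : Measure O) (w : O) : 0 ≤ rootDensity Q ν w := Real.sqrt_nonneg _

theorem measurable_rootDensity (Q ν : Measure O) : Measurable (rootDensity Q ν) :=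
  (Measure.measurable_rnDeriv _ _).ennreal_toReal.sqrt

theorem sq_rootDensity (Q ν : Measure O) (w : O) :
    rootDensity Q ν w ^ 2 = (Q.rnDeriv ν w).toReal := Real.sq_sqrt ENNReal.toReal_nonneg

theorem integral_mul_sq_rootDensity (h : Q ≪ ν) (f : O → ℝ) :
    ∫ w, f w * rootDensity Q ν w ^ 2 ∂ν = ∫ w, f w ∂Q := by
  rw [← integral_rnDeriv_smul h]
  exact integral_congr_ae (Eventually.of_forall fun w => by
    simp only [sq_rootDensity, smul_eq_mul, mul_comm])

theorem integrable_mul_sq_rootDensity_iff (h : Q ≪ ν) {f : O → ℝ} :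
    Integrable (fun w => f w * rootDensity Q ν w ^ 2) ν ↔ Integrable f Q := by
  rw [← integrable_rnDeriv_smul_iff h]
  simp only [sq_rootDensity, smul_eq_mul, mul_comm]

/-- Multiplication by the root density carries L²(Q) isometrically into L²(ν). Functions on
different laws can thus be compared in one space. -/
theorem memLp_mul_rootDensity_iff (h : Q ≪ ν) {f : O → ℝ} (hf : Measurable f) :
    MemLp (fun w => f w * rootDensity Q ν w) 2 ν ↔ MemLp f 2 Q := by
  have hm : Measurable fun w => f w * rootDensity Q ν w := hf.mul (measurable_rootDensity Q ν)
  rw [memLp_two_iff_integrable_sq hm.aestronglyMeasurable,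
    memLp_two_iff_integrable_sq hf.aestronglyMeasurable, ← integrable_mul_sq_rootDensity_iff h]
  simp only [mul_pow]

theorem integral_sq_mul_rootDensity (h : Q ≪ ν) (f : O → ℝ) :
    ∫ w, (f w * rootDensity Q ν w) ^ 2 ∂ν = ∫ w, f w ^ 2 ∂Q := by
  rw [← integral_mul_sq_rootDensity h]
  simp only [mul_pow]

theorem memLp_rootDensity (h : Q ≪ ν) : MemLp (rootDensity Q ν) 2 ν := by
  have := (memLp_mul_rootDensity_iff (Q := Q) h (f := fun _ => 1) measurable_const).2
    (memLp_const 1)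
  simpa using this

end RootDensity

end MeasureTheory

section DQM

variable {O : Type*} [MeasurableSpace O]

theorem absolutelyContinuous_add_left (Q Q₀ : Measure O) : Q ≪ Q + Q₀ :=
  Measure.absolutelyContinuous_of_le (Measure.le_add_right le_rfl)

theorem absolutelyContinuous_add_right (Q Q₀ : Measure O) : Q₀ ≪ Q + Q₀ :=
  Measure.absolutelyContinuous_of_le (Measure.le_add_left le_rfl)

/-- The score enters only multiplied by the root density of `Q₀`, which vanishes wherever `Q₀`-null
sets could matter. -/
theorem dqmRemainder_congr (Q Q₀ : Measure O) [IsFiniteMeasure Q] [IsFiniteMeasure Q₀]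
    {g g' : O → ℝ} (h : g =ᵐ[Q₀] g') (t : ℝ) :
    dqmRemainder Q Q₀ g t = dqmRemainder Q Q₀ g' t := by
  refine lintegral_congr_ae ?_
  rw [← Measure.withDensity_rnDeriv_eq _ _ (absolutelyContinuous_add_right Q Q₀)] at h
  have h' := (ae_withDensity_iff (Measure.measurable_rnDeriv _ _)).1 h
  filter_upwards [h'] with w hw
  by_cases h0 : Q₀.rnDeriv (Q + Q₀) w = 0
  · simp [h0]
  · rw [hw h0]

end DQM

section Remainder

variable {O : Type*} [MeasurableSpace O] (Q Q₀ : Measure O)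

/-- The remainder function of differentiability in quadratic mean. -/
noncomputable def dqmDefect (g : O → ℝ) (t : ℝ) (w : O) : ℝ :=
  (rootDensity Q (Q + Q₀) w - rootDensity Q₀ (Q + Q₀) w) / t
    - g w / 2 * rootDensity Q₀ (Q + Q₀) w

/-- The root of the likelihood ratio of the part of `Q` that is dominated by `Q₀`. -/
noncomputable def rootRatio (w : O) : ℝ :=
  rootDensity Q (Q + Q₀) w / rootDensity Q₀ (Q + Q₀) w

/-- The squared Hellinger distance. -/
noncomputable def hellingerSq : ℝ :=
  ∫ w, (rootDensity Q (Q + Q₀) w - rootDensity Q₀ (Q + Q₀) w) ^ 2 ∂(Q + Q₀)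

theorem measurable_rootRatio : Measurable (rootRatio Q Q₀) :=
  (measurable_rootDensity _ _).div (measurable_rootDensity _ _)

variable {Q Q₀} {g f : O → ℝ} {t : ℝ}

theorem memLp_dqmDefect (hg : Measurable g) (h : dqmRemainder Q Q₀ g t ≠ ∞) :
    MemLp (dqmDefect Q Q₀ g t) 2 (Q + Q₀) := by
  have hm : Measurable (dqmDefect Q Q₀ g t) :=
    (((measurable_rootDensity _ _).sub (measurable_rootDensity _ _)).div_const _).sub
      ((hg.div_const _).mul (measurable_rootDensity _ _))
  rw [memLp_two_iff_integrable_sq hm.aestronglyMeasurable]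
  refine ⟨(hm.pow_const 2).aestronglyMeasurable, ?_⟩
  rw [hasFiniteIntegral_iff_ofReal (Eventually.of_forall fun w => sq_nonneg _)]
  exact lt_of_le_of_ne le_top h

theorem integral_sq_dqmDefect (hg : Measurable g) :
    ∫ w, dqmDefect Q Q₀ g t w ^ 2 ∂(Q + Q₀) = (dqmRemainder Q Q₀ g t).toReal := by
  have hm : Measurable (dqmDefect Q Q₀ g t) :=
    (((measurable_rootDensity _ _).sub (measurable_rootDensity _ _)).div_const _).sub
      ((hg.div_const _).mul (measurable_rootDensity _ _))
  rw [integral_eq_lintegral_of_nonneg_ae (Eventually.of_forall fun w => sq_nonneg _)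
    (hm.pow_const 2).aestronglyMeasurable]
  rfl

variable [IsFiniteMeasure Q] [IsFiniteMeasure Q₀]

theorem memLp_rootDensity_left : MemLp (rootDensity Q (Q + Q₀)) 2 (Q + Q₀) :=
  memLp_rootDensity (absolutelyContinuous_add_left Q Q₀)

theorem memLp_rootDensity_right : MemLp (rootDensity Q₀ (Q + Q₀)) 2 (Q + Q₀) :=
  memLp_rootDensity (absolutelyContinuous_add_right Q Q₀)

theorem memLp_mul_left (hf : Measurable f) (h : MemLp f 2 Q) :
    MemLp (fun w => f w * rootDensity Q (Q + Q₀) w) 2 (Q + Q₀) :=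
  (memLp_mul_rootDensity_iff (absolutelyContinuous_add_left Q Q₀) hf).2 h

theorem memLp_mul_right (hf : Measurable f) (h : MemLp f 2 Q₀) :
    MemLp (fun w => f w * rootDensity Q₀ (Q + Q₀) w) 2 (Q + Q₀) :=
  (memLp_mul_rootDensity_iff (absolutelyContinuous_add_right Q Q₀) hf).2 h

theorem integral_sq_mul_left (f : O → ℝ) :
    ∫ w, (f w * rootDensity Q (Q + Q₀) w) ^ 2 ∂(Q + Q₀) = ∫ w, f w ^ 2 ∂Q :=
  integral_sq_mul_rootDensity (absolutelyContinuous_add_left Q Q₀) f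

theorem integral_sq_mul_right (f : O → ℝ) :
    ∫ w, (f w * rootDensity Q₀ (Q + Q₀) w) ^ 2 ∂(Q + Q₀) = ∫ w, f w ^ 2 ∂Q₀ :=
  integral_sq_mul_rootDensity (absolutelyContinuous_add_right Q Q₀) f

/-- With q, q₀ the densities, multiplying by √q₀ turns `rootRatio - 1` into √q - √q₀ where q₀ > 0.
Where q₀ = 0 the quotient is zero by convention and the factor √q₀ removes it. -/
theorem memLp_rootRatio_sub_one_mul (hf : Measurable f) (hQ : MemLp f 2 Q) (hQ₀ : MemLp f 2 Q₀) :
    MemLp (fun w => (rootRatio Q Q₀ w - 1) * f w) 2 Q₀ := by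
  have hm : Measurable fun w => (rootRatio Q Q₀ w - 1) * f w :=
    ((measurable_rootRatio Q Q₀).sub_const 1).mul hf
  rw [← memLp_mul_rootDensity_iff (absolutelyContinuous_add_right Q Q₀) hm]
  have hd := (memLp_mul_left (Q₀ := Q₀) hf hQ).sub (memLp_mul_right (Q := Q) hf hQ₀)
  refine MemLp.of_le hd (hm.mul (measurable_rootDensity _ _)).aestronglyMeasurable
    (Eventually.of_forall fun w => ?_)
  simp only [Pi.sub_apply, rootRatio]
  by_cases h0 : rootDensity Q₀ (Q + Q₀) w = 0
  · simp only [h0, mul_zero, norm_zero]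
    positivity
  · refine le_of_eq (congrArg _ ?_); field_simp

/-- Since root densities are nonnegative, (√q - √q₀)² ≤ q + q₀. -/
theorem integral_sq_rootRatio_sub_one_mul_le (hf : Measurable f) (hQ : MemLp f 2 Q)
    (hQ₀ : MemLp f 2 Q₀) :
    ∫ w, ((rootRatio Q Q₀ w - 1) * f w) ^ 2 ∂Q₀ ≤ ∫ w, f w ^ 2 ∂Q + ∫ w, f w ^ 2 ∂Q₀ := by
  have hL := memLp_mul_left (Q₀ := Q₀) hf hQ
  have hR := memLp_mul_right (Q := Q) hf hQ₀
  have h1 := (memLp_mul_right (Q := Q) (((measurable_rootRatio Q Q₀).sub_const 1).mul hf)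
    (memLp_rootRatio_sub_one_mul hf hQ hQ₀))
  rw [← integral_sq_mul_left (Q₀ := Q₀) f, ← integral_sq_mul_right (Q := Q) f,
    ← integral_sq_mul_right (Q := Q) (fun w => (rootRatio Q Q₀ w - 1) * f w),
    ← integral_add hL.integrable_sq hR.integrable_sq]
  refine integral_mono h1.integrable_sq (hL.integrable_sq.add hR.integrable_sq) fun w => ?_
  have hp := rootDensity_nonneg Q₀ (Q + Q₀) w
  have hq := rootDensity_nonneg Q (Q + Q₀) w
  simp only [rootRatio]
  by_cases h0 : rootDensity Q₀ (Q + Q₀) w = 0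
  · simp [h0]; positivity
  · have e : (rootDensity Q (Q + Q₀) w / rootDensity Q₀ (Q + Q₀) w - 1) * f w
        * rootDensity Q₀ (Q + Q₀) w
        = f w * (rootDensity Q (Q + Q₀) w - rootDensity Q₀ (Q + Q₀) w) := by field_simp
    rw [e]
    nlinarith [mul_nonneg (sq_nonneg (f w)) (mul_nonneg hp hq)]

theorem memLp_root_sub : MemLp
    (fun w => rootDensity Q (Q + Q₀) w - rootDensity Q₀ (Q + Q₀) w) 2 (Q + Q₀) :=
  memLp_rootDensity_left.sub memLp_rootDensity_right

theorem integral_abs_rootRatio_sub_one_mul_le (hf : Measurable f) (hQ₀ : MemLp f 2 Q₀) :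
    ∫ w, |(rootRatio Q Q₀ w - 1) * f w| ∂Q₀ ≤ √(∫ w, f w ^ 2 ∂Q₀) * √(hellingerSq Q Q₀) := by
  have hR := memLp_mul_right (Q := Q) hf hQ₀
  have hD : MemLp (fun w => rootDensity Q (Q + Q₀) w - rootDensity Q₀ (Q + Q₀) w) 2 (Q + Q₀) :=
    memLp_root_sub
  have h := integral_abs_mul_le_sqrt hR hD
  rw [integral_sq_mul_right] at h
  refine le_trans (le_of_eq ?_) h
  rw [← integral_mul_sq_rootDensity (absolutelyContinuous_add_right Q Q₀)]
  refine integral_congr_ae (Eventually.of_forall fun w => ?_)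
  simp only [rootRatio]
  by_cases h0 : rootDensity Q₀ (Q + Q₀) w = 0
  · simp [h0]
  · have hp := lt_of_le_of_ne (rootDensity_nonneg Q₀ (Q + Q₀) w) (Ne.symm h0)
    rw [← abs_of_pos (pow_pos hp 2), ← abs_mul]
    congr 1
    field_simp

theorem integral_sq_root_add_mul_le (hf : Measurable f) (hQ : MemLp f 2 Q) (hQ₀ : MemLp f 2 Q₀) :
    ∫ w, (f w * (rootDensity Q (Q + Q₀) w + rootDensity Q₀ (Q + Q₀) w)) ^ 2 ∂(Q + Q₀)
      ≤ 2 * (∫ w, f w ^ 2 ∂Q + ∫ w, f w ^ 2 ∂Q₀) := by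
  have hL := memLp_mul_left (Q₀ := Q₀) hf hQ
  have hR := memLp_mul_right (Q := Q) hf hQ₀
  rw [← integral_sq_mul_left (Q₀ := Q₀) f, ← integral_sq_mul_right (Q := Q) f,
    ← integral_add hL.integrable_sq hR.integrable_sq, ← integral_const_mul]
  have hs : MemLp (fun w => f w * (rootDensity Q (Q + Q₀) w + rootDensity Q₀ (Q + Q₀) w)) 2
      (Q + Q₀) := by
    simpa only [mul_add] using! hL.add hR
  refine integral_mono hs.integrable_sq ((hL.integrable_sq.add hR.integrable_sq).const_mul 2)
    fun w => ?_
  nlinarith [sq_nonneg (f w * rootDensity Q (Q + Q₀) w - f w * rootDensity Q₀ (Q + Q₀) w)]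

/-- The exact expansion behind the derivative. Factor q - q₀ = (√q + √q₀)(√q - √q₀) and write (√q -
√q₀)/t as defect plus (g/2) √q₀. The product (√q + √q₀) √q₀ / 2 equals q₀ plus (√q/√q₀ - 1) q₀ / 2
where q₀ > 0, which gives the main term and the middle correction. -/
theorem integral_sub_integral_eq (ht : t ≠ 0) (hf : Measurable f) (hQ : MemLp f 2 Q)
    (hQ₀ : MemLp f 2 Q₀) (hg : Measurable g) (hgQ : MemLp g 2 Q₀)
    (hrem : dqmRemainder Q Q₀ g t ≠ ∞) :
    (∫ w, f w ∂Q - ∫ w, f w ∂Q₀) / t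
      = ∫ w, f w * (rootDensity Q (Q + Q₀) w + rootDensity Q₀ (Q + Q₀) w)
          * dqmDefect Q Q₀ g t w ∂(Q + Q₀)
        + (∫ w, (rootRatio Q Q₀ w - 1) * f w * g w ∂Q₀) / 2 + ∫ w, f w * g w ∂Q₀ := by
  have hL := memLp_mul_left (Q₀ := Q₀) hf hQ
  have hR := memLp_mul_right (Q := Q) hf hQ₀
  have hs : MemLp (fun w => f w * (rootDensity Q (Q + Q₀) w + rootDensity Q₀ (Q + Q₀) w)) 2
      (Q + Q₀) := by
    simpa only [mul_add] using! hL.add hR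
  have i1 := hs.integrable_mul_two (memLp_dqmDefect hg hrem)
  have i2 := (memLp_rootRatio_sub_one_mul hf hQ hQ₀).integrable_mul_two hgQ
  have i3 := hQ₀.integrable_mul_two hgQ
  have jQ := (hQ.integrable one_le_two)
  have jQ₀ := (hQ₀.integrable one_le_two)
  have aL := absolutelyContinuous_add_left Q Q₀
  have aR := absolutelyContinuous_add_right Q Q₀
  rw [← integral_mul_sq_rootDensity aL f, ← integral_mul_sq_rootDensity aR f,
    ← integral_mul_sq_rootDensity aR (fun w => (rootRatio Q Q₀ w - 1) * f w * g w),
    ← integral_mul_sq_rootDensity aR (fun w => f w * g w), ← integral_sub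
      ((integrable_mul_sq_rootDensity_iff aL).2 jQ) ((integrable_mul_sq_rootDensity_iff aR).2 jQ₀),
    ← integral_div, ← integral_div]
  have i2' := ((integrable_mul_sq_rootDensity_iff aR).2 i2).div_const 2
  have i3' := (integrable_mul_sq_rootDensity_iff aR).2 i3
  have i12 : Integrable (fun w => f w * (rootDensity Q (Q + Q₀) w + rootDensity Q₀ (Q + Q₀) w)
      * dqmDefect Q Q₀ g t w
      + (rootRatio Q Q₀ w - 1) * f w * g w * rootDensity Q₀ (Q + Q₀) w ^ 2 / 2) (Q + Q₀) :=
    i1.add i2'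
  rw [← integral_add i1 i2', ← integral_add i12 i3']
  refine integral_congr_ae (Eventually.of_forall fun w => ?_)
  simp only [dqmDefect, rootRatio]
  by_cases h0 : rootDensity Q₀ (Q + Q₀) w = 0
  · simp [h0]; field_simp
  · field_simp
    ring

/-- √q - √q₀ is t times the sum of the defect and (g/2) √q₀; the square of the sum is at most twice
the sum of squares. -/
theorem hellingerSq_le (ht : t ≠ 0) (hg : Measurable g) (hgQ : MemLp g 2 Q₀)
    (hrem : dqmRemainder Q Q₀ g t ≠ ∞) :
    hellingerSq Q Q₀ ≤ t ^ 2 * (2 * (dqmRemainder Q Q₀ g t).toReal + ∫ w, g w ^ 2 ∂Q₀) := by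
  have hD := memLp_dqmDefect hg hrem
  have hR := memLp_mul_right (Q := Q) hg hgQ
  rw [← integral_sq_dqmDefect hg, ← integral_sq_mul_right (Q := Q) g, ← integral_const_mul,
    ← integral_add (hD.integrable_sq.const_mul 2) hR.integrable_sq, ← integral_const_mul]
  refine integral_mono (memLp_root_sub (Q := Q) (Q₀ := Q₀)).integrable_sq
    (((hD.integrable_sq.const_mul 2).add hR.integrable_sq).const_mul _) fun w => ?_
  have e : rootDensity Q (Q + Q₀) w - rootDensity Q₀ (Q + Q₀) w
      = t * (dqmDefect Q Q₀ g t w + g w / 2 * rootDensity Q₀ (Q + Q₀) w) := by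
    simp only [dqmDefect]; field_simp; ring
  rw [e, mul_pow]
  refine mul_le_mul_of_nonneg_left ?_ (sq_nonneg t)
  nlinarith [sq_nonneg (dqmDefect Q Q₀ g t w - g w / 2 * rootDensity Q₀ (Q + Q₀) w),
    sq_nonneg (g w * rootDensity Q₀ (Q + Q₀) w)]

/-- Integrals of bounded functions differ by at most a multiple of the Hellinger distance. -/
theorem abs_integral_sub_integral_le {M : ℝ} (hM : 0 ≤ M) (hf : Measurable f)
    (hfM : ∀ w, |f w| ≤ M) :
    |∫ w, f w ∂Q - ∫ w, f w ∂Q₀|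
      ≤ M * √(2 * (Q.real Set.univ + Q₀.real Set.univ)) * √(hellingerSq Q Q₀) := by
  have hQ : MemLp f 2 Q := MemLp.of_bound hf.aestronglyMeasurable M (Eventually.of_forall hfM)
  have hQ₀ : MemLp f 2 Q₀ := MemLp.of_bound hf.aestronglyMeasurable M (Eventually.of_forall hfM)
  have hL := memLp_mul_left (Q₀ := Q₀) hf hQ
  have hR := memLp_mul_right (Q := Q) hf hQ₀
  have hs : MemLp (fun w => f w * (rootDensity Q (Q + Q₀) w + rootDensity Q₀ (Q + Q₀) w)) 2
      (Q + Q₀) := by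
    simpa only [mul_add] using! hL.add hR
  have h := abs_integral_mul_le_sqrt hs (memLp_root_sub (Q := Q) (Q₀ := Q₀))
  have e : ∫ w, f w ∂Q - ∫ w, f w ∂Q₀
      = ∫ w, f w * (rootDensity Q (Q + Q₀) w + rootDensity Q₀ (Q + Q₀) w)
        * (rootDensity Q (Q + Q₀) w - rootDensity Q₀ (Q + Q₀) w) ∂(Q + Q₀) := by
    have aL := absolutelyContinuous_add_left Q Q₀
    have aR := absolutelyContinuous_add_right Q Q₀
    rw [← integral_mul_sq_rootDensity aL f, ← integral_mul_sq_rootDensity aR f, ← integral_sub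
      ((integrable_mul_sq_rootDensity_iff aL).2 (hQ.integrable one_le_two))
      ((integrable_mul_sq_rootDensity_iff aR).2 (hQ₀.integrable one_le_two))]
    exact integral_congr_ae (Eventually.of_forall fun w => by ring)
  rw [e]
  refine h.trans (mul_le_mul_of_nonneg_right ?_ (Real.sqrt_nonneg _))
  have hb : ∀ μ : Measure O, IsFiniteMeasure μ → ∫ w, f w ^ 2 ∂μ ≤ M ^ 2 * μ.real Set.univ := by
    intro μ _
    have : ∫ w, f w ^ 2 ∂μ ≤ ∫ _, M ^ 2 ∂μ := by
      refine integral_mono_of_nonneg (Eventually.of_forall fun w => sq_nonneg _)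
        (integrable_const _) (Eventually.of_forall fun w => ?_)
      exact sq_le_sq' (abs_le.1 (hfM w)).1 (abs_le.1 (hfM w)).2
    rwa [integral_const, smul_eq_mul, mul_comm] at this
  have : M * √(2 * (Q.real Set.univ + Q₀.real Set.univ))
      = √(M ^ 2 * (2 * (Q.real Set.univ + Q₀.real Set.univ))) := by
    rw [Real.sqrt_mul (sq_nonneg M), Real.sqrt_sq hM]
  rw [this]
  refine Real.sqrt_le_sqrt ((integral_sq_root_add_mul_le hf hQ hQ₀).trans ?_)
  nlinarith [hb Q inferInstance, hb Q₀ inferInstance]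

end Remainder

/-! ### Derivatives of reweighted means along a path -/

section Gradient

variable {O : Type*} [MeasurableSpace O] {𝒳 : Type*} [MeasurableSpace 𝒳]

theorem tendsto_hellingerSq {Q : ℝ → Measure O} [∀ t, IsFiniteMeasure (Q t)] {g : O → ℝ}
    (hg : Measurable g) (hg2 : MemLp g 2 (Q 0))
    (hdqm : Tendsto (fun t => dqmRemainder (Q t) (Q 0) g t) (𝓝[≠] 0) (𝓝 0)) :
    Tendsto (fun t => hellingerSq (Q t) (Q 0)) (𝓝[≠] 0) (𝓝 0) := by
  have hfin : ∀ᶠ t in 𝓝[≠] (0 : ℝ), dqmRemainder (Q t) (Q 0) g t ≠ ∞ :=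
    hdqm.eventually_ne ENNReal.zero_ne_top
  have hr : Tendsto (fun t => (dqmRemainder (Q t) (Q 0) g t).toReal) (𝓝[≠] 0) (𝓝 0) := by
    simpa [Function.comp_def] using (ENNReal.tendsto_toReal ENNReal.zero_ne_top).comp hdqm
  have ht : Tendsto (fun t : ℝ => t) (𝓝[≠] 0) (𝓝 0) := tendsto_nhdsWithin_of_tendsto_nhds tendsto_id
  have hup : Tendsto (fun t => t ^ 2 * (2 * (dqmRemainder (Q t) (Q 0) g t).toReal
      + ∫ w, g w ^ 2 ∂(Q 0))) (𝓝[≠] 0) (𝓝 0) := by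
    simpa using (ht.pow 2).mul ((hr.const_mul 2).add_const (∫ w, g w ^ 2 ∂(Q 0)))
  refine tendsto_of_tendsto_of_tendsto_of_le_of_le' tendsto_const_nhds hup
    (Eventually.of_forall fun t => integral_nonneg fun w => sq_nonneg _) ?_
  filter_upwards [hfin, self_mem_nhdsWithin] with t h1 h2
  exact hellingerSq_le h2 hg hg2 h1

theorem integral_map_withDensity {μ : Measure O} {x : O → 𝒳} (hx : Measurable x) {l : O → ℝ}
    (hl : Measurable l) (hl0 : ∀ w, 0 ≤ l w) {φ : 𝒳 → ℝ} (hφ : Measurable φ) :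
    ∫ y, φ y ∂(μ.withDensity fun w => ENNReal.ofReal (l w)).map x = ∫ w, l w * φ (x w) ∂μ := by
  rw [integral_map hx.aemeasurable hφ.aestronglyMeasurable,
    integral_withDensity_eq_integral_toReal_smul hl.ennreal_ofReal (by simp)]
  simp [ENNReal.toReal_ofReal (hl0 _)]

/-- Reweightings with values in `[0, C]` of nearby laws, under which the law of `x` is the same,
are close in `L¹`. -/
theorem integral_abs_weight_sub_le {Q Q₀ : Measure O} [IsProbabilityMeasure Q]
    [IsProbabilityMeasure Q₀] {x : O → 𝒳} (hx : Measurable x) {l l₀ : 𝒳 → ℝ} (hl : Measurable l)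
    (hl₀ : Measurable l₀) {C : ℝ} (h0 : ∀ y, 0 ≤ l y) (h0' : ∀ y, 0 ≤ l₀ y) (hC : ∀ y, l y ≤ C)
    (hC' : ∀ y, l₀ y ≤ C) (hC0 : 0 ≤ C)
    (hlaw : (Q.withDensity fun w => ENNReal.ofReal (l (x w))).map x
      = (Q₀.withDensity fun w => ENNReal.ofReal (l₀ (x w))).map x) :
    ∫ w, |l (x w) - l₀ (x w)| ∂Q₀ ≤ C * 2 * √(hellingerSq Q Q₀) := by
  -- `φ` is the sign of l - l₀, so the L¹ distance is ∫ (l - l₀) φ under Q₀. By `hlaw` the l₀ term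
  -- equals ∫ l φ under Q. What remains compares Q and Q₀ on one bounded function.
  set φ : 𝒳 → ℝ := fun y => if l₀ y ≤ l y then 1 else -1 with hφd
  have hφ : Measurable φ := Measurable.ite (measurableSet_le hl₀ hl) measurable_const
    measurable_const
  have hφ1 : ∀ y, |φ y| = 1 := fun y => by simp only [hφd]; split_ifs <;> simp
  have e := congrArg (fun m => ∫ y, φ y ∂m) hlaw
  rw [integral_map_withDensity hx (l := fun w => l (x w)) (hl.comp hx) (fun w => h0 _) hφ,
    integral_map_withDensity hx (l := fun w => l₀ (x w)) (hl₀.comp hx) (fun w => h0' _) hφ] at e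
  have hb : ∀ w, |l (x w) * φ (x w)| ≤ C := fun w => by
    rw [abs_mul, hφ1, mul_one, abs_of_nonneg (h0 _)]; exact hC _
  have hb' : ∀ w, |l₀ (x w) * φ (x w)| ≤ C := fun w => by
    rw [abs_mul, hφ1, mul_one, abs_of_nonneg (h0' _)]; exact hC' _
  have hm : Measurable fun w => l (x w) * φ (x w) := (hl.comp hx).mul (hφ.comp hx)
  have hm' : Measurable fun w => l₀ (x w) * φ (x w) := (hl₀.comp hx).mul (hφ.comp hx)
  have i : Integrable (fun w => l (x w) * φ (x w)) Q₀ :=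
    Integrable.of_bound hm.aestronglyMeasurable C (Eventually.of_forall hb)
  have i' : Integrable (fun w => l₀ (x w) * φ (x w)) Q₀ :=
    Integrable.of_bound hm'.aestronglyMeasurable C (Eventually.of_forall hb')
  have h := abs_integral_sub_integral_le (Q := Q) (Q₀ := Q₀) hC0 hm hb
  have e2 : ∫ w, |l (x w) - l₀ (x w)| ∂Q₀
      = ∫ w, l (x w) * φ (x w) ∂Q₀ - ∫ w, l₀ (x w) * φ (x w) ∂Q₀ := by
    rw [← integral_sub i i']
    refine integral_congr_ae (Eventually.of_forall fun w => ?_)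
    simp only [hφd]
    split_ifs with hle
    · rw [abs_of_nonneg (by linarith)]; ring
    · rw [abs_of_neg (by linarith)]; ring
  have e3 : √(2 * (Q.real Set.univ + Q₀.real Set.univ)) = 2 := by
    rw [probReal_univ, probReal_univ, show (2 * (1 + 1) : ℝ) = 2 ^ 2 by norm_num,
      Real.sqrt_sq (by norm_num)]
  rw [e3, e, abs_sub_comm] at h
  rw [e2]
  exact (le_abs_self _).trans h

/-- Differentiation of a reweighted mean along a path that is differentiable in quadratic mean,
when the law of `x` under the reweighted law is constant along the path. -/
theorem hasDerivAt_of_dqm {Q : ℝ → Measure O} [∀ t, IsProbabilityMeasure (Q t)] {x : O → 𝒳}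
    (hx : Measurable x) {lam : ℝ → 𝒳 → ℝ} (hlam : ∀ t, Measurable (lam t)) {C : ℝ} (hC0 : 0 ≤ C)
    (h0 : ∀ t y, 0 ≤ lam t y) (hC : ∀ t y, lam t y ≤ C) {g h : O → ℝ} (hg2 : MemLp g 2 (Q 0))
    (hdqm : Tendsto (fun t => dqmRemainder (Q t) (Q 0) g t) (𝓝[≠] 0) (𝓝 0))
    (hh : Measurable h) (hh2 : MemLp h 2 (Q 0)) {θ : ℝ → ℝ} {B : ℝ}
    (hlaw : ∀ᶠ t in 𝓝 (0 : ℝ), ((Q t).withDensity fun w => ENNReal.ofReal (lam t (x w))).map x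
      = ((Q 0).withDensity fun w => ENNReal.ofReal (lam 0 (x w))).map x)
    (hB : ∀ᶠ t in 𝓝 (0 : ℝ), MemLp (fun w => lam t (x w) * h w) 2 (Q t) ∧
      ∫ w, (lam t (x w) * h w) ^ 2 ∂(Q t) ≤ B)
    (hθ : ∀ᶠ t in 𝓝 (0 : ℝ), θ t - θ 0 = ∫ w, lam t (x w) * h w ∂(Q t))
    (hzero : ∀ᶠ t in 𝓝 (0 : ℝ), ∫ w, lam t (x w) * h w ∂(Q 0) = 0) :
    HasDerivAt θ (∫ w, lam 0 (x w) * h w * g w ∂(Q 0)) 0 := by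
  wlog hg : Measurable g generalizing g
  · have hae := hg2.1.ae_eq_mk
    have := this (hg2.ae_eq hae)
      (hdqm.congr fun t => dqmRemainder_congr (Q t) (Q 0) hae t)
      hg2.1.stronglyMeasurable_mk.measurable
    have e : ∫ w, lam 0 (x w) * h w * g w ∂(Q 0)
        = ∫ w, lam 0 (x w) * h w * hg2.1.mk g w ∂(Q 0) := by
      refine integral_congr_ae ?_
      filter_upwards [hae] with w hw
      rw [hw]
    rw [e]
    exact this
  have hfin : ∀ᶠ t in 𝓝[≠] (0 : ℝ), dqmRemainder (Q t) (Q 0) g t ≠ ∞ :=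
    hdqm.eventually_ne ENNReal.zero_ne_top
  have hr : Tendsto (fun t => (dqmRemainder (Q t) (Q 0) g t).toReal) (𝓝[≠] 0) (𝓝 0) := by
    simpa [Function.comp_def] using (ENNReal.tendsto_toReal ENNReal.zero_ne_top).comp hdqm
  have hH := tendsto_hellingerSq hg hg2 hdqm
  have hHs : Tendsto (fun t => √(hellingerSq (Q t) (Q 0))) (𝓝[≠] 0) (𝓝 0) := by
    simpa using hH.sqrt
  have hlaw' := hlaw.filter_mono (nhdsWithin_le_nhds (s := {0}ᶜ))
  have hB' := hB.filter_mono (nhdsWithin_le_nhds (s := {0}ᶜ))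
  have hθ' := hθ.filter_mono (nhdsWithin_le_nhds (s := {0}ᶜ))
  have hzero' := hzero.filter_mono (nhdsWithin_le_nhds (s := {0}ᶜ))
  have hlx : ∀ t, Measurable fun w => lam t (x w) := fun t => (hlam t).comp hx
  have habs : ∀ t s y, |lam t y - lam s y| ≤ C := fun t s y =>
    abs_sub_le_of_nonneg_of_le (h0 _ _) (hC _ _) (h0 _ _) (hC _ _)
  -- the weights converge in `L¹`
  have hu1 : Tendsto (fun t => ∫ w, |lam t (x w) - lam 0 (x w)| ∂(Q 0)) (𝓝[≠] 0) (𝓝 0) := by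
    have hup : Tendsto (fun t => C * 2 * √(hellingerSq (Q t) (Q 0))) (𝓝[≠] 0) (𝓝 0) := by
      simpa using hHs.const_mul (C * 2)
    refine tendsto_of_tendsto_of_tendsto_of_le_of_le' tendsto_const_nhds hup
      (Eventually.of_forall fun t => integral_nonneg fun w => abs_nonneg _) ?_
    filter_upwards [hlaw'] with t ht
    exact integral_abs_weight_sub_le hx (hlam t) (hlam 0) (h0 t) (h0 0) (hC t) (hC 0) hC0 ht
  have hlp1 : ∀ t, MemLp (fun w => lam t (x w) - lam 0 (x w)) 2 (Q 0) := fun t =>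
    MemLp.of_bound ((hlx t).sub (hlx 0)).aestronglyMeasurable C
      (Eventually.of_forall fun w => habs _ _ _)
  have hb1 : ∀ t w, (lam t (x w) - lam 0 (x w)) ^ 2 ≤ C ^ 2 := fun t w =>
    sq_le_sq' (abs_le.1 (habs _ _ _)).1 (abs_le.1 (habs _ _ _)).2
  -- The product of `h` and `g` is only integrable, so the factors are attached one at a time, each
  -- by weak convergence of an L²-bounded family.
  have hu2 : Tendsto (fun t => ∫ w, |(lam t (x w) - lam 0 (x w)) * h w| ∂(Q 0)) (𝓝[≠] 0)
      (𝓝 0) := by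
    refine tendsto_integral_abs_mul_of_bounded (B := C ^ 2) (Eventually.of_forall fun t => ?_) hu1
      hh2
    refine ⟨hlp1 t, ?_, (hlp1 t).integrable one_le_two⟩
    have : ∫ w, (lam t (x w) - lam 0 (x w)) ^ 2 ∂(Q 0) ≤ ∫ _, C ^ 2 ∂(Q 0) :=
      integral_mono (hlp1 t).integrable_sq (integrable_const _) (hb1 t)
    simpa using this
  have hlp2 : ∀ t, MemLp (fun w => (lam t (x w) - lam 0 (x w)) * h w) 2 (Q 0) := fun t => by
    refine MemLp.of_le (hh2.const_mul C) (((hlx t).sub (hlx 0)).mul hh).aestronglyMeasurable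
      (Eventually.of_forall fun w => ?_)
    rw [norm_mul, norm_mul, Real.norm_eq_abs C, abs_of_nonneg hC0]
    exact mul_le_mul_of_nonneg_right (habs _ _ _) (norm_nonneg _)
  have hu3 : Tendsto (fun t => ∫ w, |(lam t (x w) - lam 0 (x w)) * h w * g w| ∂(Q 0)) (𝓝[≠] 0)
      (𝓝 0) := by
    refine tendsto_integral_abs_mul_of_bounded (B := C ^ 2 * ∫ w, h w ^ 2 ∂(Q 0))
      (Eventually.of_forall fun t => ?_) hu2 hg2
    refine ⟨hlp2 t, ?_, (hlp2 t).integrable one_le_two⟩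
    rw [← integral_const_mul]
    refine integral_mono (hlp2 t).integrable_sq (hh2.integrable_sq.const_mul _) fun w => ?_
    simp only [mul_pow]
    exact mul_le_mul_of_nonneg_right (hb1 t w) (sq_nonneg _)
  -- the weighted integrand
  have hfm : ∀ t, Measurable fun w => lam t (x w) * h w := fun t => (hlx t).mul hh
  have hf0 : ∀ t, MemLp (fun w => lam t (x w) * h w) 2 (Q 0) := fun t => by
    refine MemLp.of_le (hh2.const_mul C) (hfm t).aestronglyMeasurable
      (Eventually.of_forall fun w => ?_)
    rw [norm_mul, norm_mul, Real.norm_eq_abs C, abs_of_nonneg hC0, Real.norm_eq_abs (lam t (x w)),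
      abs_of_nonneg (h0 _ _)]
    exact mul_le_mul_of_nonneg_right (hC _ _) (norm_nonneg _)
  have hf0b : ∀ t, ∫ w, (lam t (x w) * h w) ^ 2 ∂(Q 0) ≤ C ^ 2 * ∫ w, h w ^ 2 ∂(Q 0) := fun t => by
    rw [← integral_const_mul]
    refine integral_mono (hf0 t).integrable_sq (hh2.integrable_sq.const_mul _) fun w => ?_
    simp only [mul_pow]
    exact mul_le_mul_of_nonneg_right (pow_le_pow_left₀ (h0 _ _) (hC _ _) 2) (sq_nonneg _)
  set D : ℝ := B + C ^ 2 * ∫ w, h w ^ 2 ∂(Q 0) with hD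
  have hu4 : Tendsto (fun t => ∫ w, |(rootRatio (Q t) (Q 0) w - 1) * (lam t (x w) * h w)| ∂(Q 0))
      (𝓝[≠] 0) (𝓝 0) := by
    have hup : Tendsto (fun t => √(C ^ 2 * ∫ w, h w ^ 2 ∂(Q 0)) * √(hellingerSq (Q t) (Q 0)))
        (𝓝[≠] 0) (𝓝 0) := by
      simpa using hHs.const_mul (√(C ^ 2 * ∫ w, h w ^ 2 ∂(Q 0)))
    refine tendsto_of_tendsto_of_tendsto_of_le_of_le tendsto_const_nhds hup
      (fun t => integral_nonneg fun w => abs_nonneg _) fun t => ?_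
    refine (integral_abs_rootRatio_sub_one_mul_le (Q := Q t) (hfm t) (hf0 t)).trans ?_
    exact mul_le_mul_of_nonneg_right (Real.sqrt_le_sqrt (hf0b t)) (Real.sqrt_nonneg _)
  have hu5 : Tendsto
      (fun t => ∫ w, |(rootRatio (Q t) (Q 0) w - 1) * (lam t (x w) * h w) * g w| ∂(Q 0))
      (𝓝[≠] 0) (𝓝 0) := by
    refine tendsto_integral_abs_mul_of_bounded (B := D) ?_ hu4 hg2
    -- The bound `B` on second moments under the moving law `Q t` is needed here: it keeps the
    -- correction term bounded in L².
    filter_upwards [hB'] with t ht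
    have hm := memLp_rootRatio_sub_one_mul (hfm t) ht.1 (hf0 t)
    refine ⟨hm, ?_, hm.integrable one_le_two⟩
    refine (integral_sq_rootRatio_sub_one_mul_le (hfm t) ht.1 (hf0 t)).trans ?_
    exact add_le_add ht.2 (hf0b t)
  have habs_lim : ∀ {F : ℝ → O → ℝ}, Tendsto (fun t => ∫ w, |F t w| ∂(Q 0)) (𝓝[≠] 0) (𝓝 0) →
      Tendsto (fun t => ∫ w, F t w ∂(Q 0)) (𝓝[≠] 0) (𝓝 0) := fun hF =>
    squeeze_zero_norm (fun t => norm_integral_le_integral_norm _) hF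
  have hc : Tendsto (fun t => ∫ w, lam t (x w) * h w * g w ∂(Q 0)) (𝓝[≠] 0)
      (𝓝 (∫ w, lam 0 (x w) * h w * g w ∂(Q 0))) := by
    have := (habs_lim hu3).add_const (∫ w, lam 0 (x w) * h w * g w ∂(Q 0))
    rw [zero_add] at this
    refine this.congr fun t => ?_
    rw [← integral_add ((hlp2 t).integrable_mul_two hg2) ((hf0 0).integrable_mul_two hg2)]
    exact integral_congr_ae (Eventually.of_forall fun w => by ring)
  have ha : Tendsto (fun t => ∫ w, lam t (x w) * h w *
      (rootDensity (Q t) (Q t + Q 0) w + rootDensity (Q 0) (Q t + Q 0) w)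
      * dqmDefect (Q t) (Q 0) g t w ∂(Q t + Q 0)) (𝓝[≠] 0) (𝓝 0) := by
    have hup : Tendsto (fun t => √(2 * D) * √((dqmRemainder (Q t) (Q 0) g t).toReal))
        (𝓝[≠] 0) (𝓝 0) := by
      simpa using hr.sqrt.const_mul (√(2 * D))
    refine squeeze_zero_norm' ?_ hup
    filter_upwards [hB', hfin] with t ht hft
    have hs : MemLp (fun w => lam t (x w) * h w *
        (rootDensity (Q t) (Q t + Q 0) w + rootDensity (Q 0) (Q t + Q 0) w)) 2 (Q t + Q 0) := by
      simpa only [mul_add] using! (memLp_mul_left (Q₀ := Q 0) (hfm t) ht.1).add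
        (memLp_mul_right (Q := Q t) (hfm t) (hf0 t))
    refine (abs_integral_mul_le_sqrt hs (memLp_dqmDefect hg hft)).trans ?_
    rw [integral_sq_dqmDefect hg]
    refine mul_le_mul_of_nonneg_right (Real.sqrt_le_sqrt ?_) (Real.sqrt_nonneg _)
    refine (integral_sq_root_add_mul_le (hfm t) ht.1 (hf0 t)).trans ?_
    linarith [ht.2, hf0b t]
  rw [hasDerivAt_iff_tendsto_slope]
  have hlim := (ha.add ((habs_lim hu5).div_const 2)).add hc
  simp only [zero_div, zero_add] at hlim
  refine hlim.congr' ?_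
  filter_upwards [hθ', hzero', hB', hfin, self_mem_nhdsWithin] with t h1 h2 h3 h4 h5
  -- By `hzero` the integral under `Q 0` can be subtracted for free, so the slope of θ is a
  -- difference of two laws on the same integrand.
  have e := integral_sub_integral_eq h5 (hfm t) h3.1 (hf0 t) hg hg2 h4
  rw [slope_def_field, sub_zero, h1, ← e, h2, sub_zero]

end Gradient

/-! ### Linear tilts are differentiable in quadratic mean -/

section LinearPath

variable {O : Type*} [MeasurableSpace O]

/-- With s = √(1 + u) the left side is (s - 1)²/2, while u² = (s - 1)²(s + 1)² and s + 1 ≥ 1. -/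
theorem abs_sqrt_one_add_sub_le {u : ℝ} (hu : -1 ≤ u) : |√(1 + u) - 1 - u / 2| ≤ u ^ 2 / 2 := by
  set s := √(1 + u) with hs
  have hs0 : 0 ≤ s := Real.sqrt_nonneg _
  have hu' : u = s ^ 2 - 1 := by rw [hs, Real.sq_sqrt (by linarith)]; ring
  rw [hu', show s - 1 - (s ^ 2 - 1) / 2 = -((s - 1) ^ 2 / 2) by ring, abs_neg,
    abs_of_nonneg (by positivity)]
  have : (s ^ 2 - 1) ^ 2 = (s - 1) ^ 2 * (s + 1) ^ 2 := by ring
  nlinarith [mul_nonneg (sq_nonneg (s - 1)) hs0, mul_nonneg (sq_nonneg (s - 1)) (sq_nonneg s)]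

/-- With f = 1 + t h, the measure Q + Q₀ has density f + 1 with respect to Q₀. The root densities
are therefore √f and 1 times the common factor √(1/(f + 1)) ≤ 1, and the remainder reduces to the
expansion of √(1 + t h). -/
theorem dqmRemainder_withDensity_le {Q₀ : Measure O} [IsFiniteMeasure Q₀] {h : O → ℝ}
    (hm : Measurable h) {M : ℝ} (hM : ∀ w, |h w| ≤ M) {t : ℝ} (ht : t ≠ 0) (htM : |t| * M ≤ 1 / 2)
    {Q : Measure O} [IsFiniteMeasure Q]
    (hQ : Q = Q₀.withDensity fun w => ENNReal.ofReal (1 + t * h w)) :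
    dqmRemainder Q Q₀ h t ≤ ENNReal.ofReal ((|t| * M ^ 2) ^ 2) * (Q + Q₀) Set.univ := by
  set f : O → ℝ := fun w => 1 + t * h w with hf
  have hfm : Measurable f := (hm.const_mul t).const_add 1
  have hth : ∀ w, |t * h w| ≤ 1 / 2 := fun w => by
    rw [abs_mul]
    exact (mul_le_mul_of_nonneg_left (hM w) (abs_nonneg t)).trans htM
  have hf2 : ∀ w, 1 / 2 ≤ f w := fun w => by have := (abs_le.1 (hth w)).1; simp only [hf]; linarith
  have hν : Q + Q₀ = Q₀.withDensity fun w => ENNReal.ofReal (f w + 1) := by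
    rw [hQ]
    refine Measure.ext_of_lintegral _ fun G hG => ?_
    rw [lintegral_add_measure, lintegral_withDensity_eq_lintegral_mul _ (by fun_prop) hG,
      lintegral_withDensity_eq_lintegral_mul _ (by fun_prop) hG, ← lintegral_add_right _ hG]
    refine lintegral_congr fun w => ?_
    simp only [Pi.mul_apply]
    rw [ENNReal.ofReal_add (by linarith [hf2 w]) zero_le_one, ENNReal.ofReal_one, add_mul, one_mul]
  have hdens : ∀ a : O → ℝ, Measurable a →
      (Q₀.withDensity fun w => ENNReal.ofReal (a w)).rnDeriv (Q + Q₀)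
        =ᵐ[Q + Q₀] fun w => ENNReal.ofReal (a w / (f w + 1)) := by
    intro a ha
    have : (Q₀.withDensity fun w => ENNReal.ofReal (a w))
        = (Q + Q₀).withDensity fun w => ENNReal.ofReal (a w / (f w + 1)) := by
      rw [hν, ← withDensity_mul _ (by fun_prop) (by fun_prop)]
      refine withDensity_congr_ae (Eventually.of_forall fun w => ?_)
      simp only [Pi.mul_apply]
      have : 0 < f w + 1 := by linarith [hf2 w]
      rw [← ENNReal.ofReal_mul this.le]
      congr 1; field_simp
    rw [this]
    exact Measure.rnDeriv_withDensity _ (by fun_prop)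
  have h1 := hdens f hfm
  have h2 := hdens (fun _ => 1) measurable_const
  simp only [ENNReal.ofReal_one] at h2
  rw [show (Q₀.withDensity fun _ => (1 : ℝ≥0∞)) = Q₀ from withDensity_one] at h2
  rw [← show Q = Q₀.withDensity fun w => ENNReal.ofReal (f w) from hQ] at h1
  rw [← lintegral_const]
  refine lintegral_mono_ae ?_
  filter_upwards [h1, h2] with w h1w h2w
  have hpos : 0 < f w + 1 := by linarith [hf2 w]
  have hfpos : 0 ≤ f w := by linarith [hf2 w]
  rw [h1w, h2w, ENNReal.toReal_ofReal (by positivity), ENNReal.toReal_ofReal (by positivity)]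
  refine ENNReal.ofReal_le_ofReal ?_
  rw [← sq_abs]
  refine pow_le_pow_left₀ (abs_nonneg _) ?_ 2
  have e : (√(f w / (f w + 1)) - √(1 / (f w + 1))) / t - h w / 2 * √(1 / (f w + 1))
      = (√(1 + t * h w) - 1 - t * h w / 2) / t * √(1 / (f w + 1)) := by
    rw [show f w / (f w + 1) = f w * (1 / (f w + 1)) by ring, Real.sqrt_mul hfpos,
      show √(f w) = √(1 + t * h w) from rfl]
    field_simp
  rw [e, abs_mul, abs_div, abs_of_nonneg (Real.sqrt_nonneg _)]
  have hs : √(1 / (f w + 1)) ≤ 1 := by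
    refine Real.sqrt_le_iff.2 ⟨zero_le_one, ?_⟩
    rw [one_pow, div_le_one hpos]; linarith
  have hu := abs_sqrt_one_add_sub_le (u := t * h w) (by linarith [(abs_le.1 (hth w)).1])
  have htp : 0 < |t| := abs_pos.2 ht
  have hb : |√(1 + t * h w) - 1 - t * h w / 2| / |t| ≤ |t| * M ^ 2 := by
    rw [div_le_iff₀ htp]
    refine hu.trans ?_
    have h3 : (t * h w) ^ 2 ≤ (|t| * M) ^ 2 := by
      rw [← sq_abs, abs_mul]
      exact pow_le_pow_left₀ (by positivity) (mul_le_mul_of_nonneg_left (hM w) htp.le) 2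
    nlinarith [sq_nonneg (t * h w)]
  calc _ ≤ |t| * M ^ 2 * 1 := mul_le_mul hb hs (Real.sqrt_nonneg _) (by positivity)
    _ = _ := mul_one _

theorem tendsto_dqmRemainder_withDensity {Q₀ : Measure O} [IsProbabilityMeasure Q₀] {h : O → ℝ}
    (hm : Measurable h) {M : ℝ} (hM : ∀ w, |h w| ≤ M) {Q : ℝ → Measure O}
    [∀ t, IsProbabilityMeasure (Q t)]
    (hQ : ∀ᶠ t in 𝓝 (0 : ℝ), Q t = Q₀.withDensity fun w => ENNReal.ofReal (1 + t * h w)) :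
    Tendsto (fun t => dqmRemainder (Q t) Q₀ h t) (𝓝[≠] 0) (𝓝 0) := by
  have habs : Tendsto (fun t : ℝ => |t|) (𝓝 0) (𝓝 0) := by
    simpa using (continuous_abs.tendsto (0 : ℝ))
  have hup : Tendsto (fun t : ℝ => ENNReal.ofReal ((|t| * M ^ 2) ^ 2) * 2) (𝓝[≠] 0) (𝓝 0) := by
    have h1 : Tendsto (fun t : ℝ => ENNReal.ofReal ((|t| * M ^ 2) ^ 2)) (𝓝[≠] 0) (𝓝 0) := by
      have := ENNReal.tendsto_ofReal ((habs.mul_const (M ^ 2)).pow 2)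
      simp only [zero_mul, ne_eq, OfNat.ofNat_ne_zero, not_false_eq_true, zero_pow,
        ENNReal.ofReal_zero] at this
      exact this.mono_left nhdsWithin_le_nhds
    simpa using ENNReal.Tendsto.mul_const h1 (Or.inr (by norm_num : (2 : ℝ≥0∞) ≠ ∞))
  have hsmall : ∀ᶠ t : ℝ in 𝓝 0, |t| * M < 1 / 2 := by
    have : Tendsto (fun t : ℝ => |t| * M) (𝓝 0) (𝓝 0) := by simpa using habs.mul_const M
    exact this.eventually (gt_mem_nhds (by norm_num))
  refine tendsto_of_tendsto_of_tendsto_of_le_of_le' tendsto_const_nhds hup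
    (Eventually.of_forall fun _ => zero_le) ?_
  filter_upwards [hQ.filter_mono nhdsWithin_le_nhds, hsmall.filter_mono nhdsWithin_le_nhds,
    self_mem_nhdsWithin] with t h1 h2 h3
  refine (dqmRemainder_withDensity_le hm hM h3 h2.le h1).trans (le_of_eq ?_)
  rw [Measure.add_apply, measure_univ, measure_univ, one_add_one_eq_two]

end LinearPath

/-! ### Full-data laws with prescribed kernels and independent arms -/

namespace Population

variable {𝒳 𝒮 : Type*} [MeasurableSpace 𝒳] [MeasurableSpace 𝒮]

/-- Assembles the pairs `(S(false), Y(false))` and `(S(true), Y(true))`. -/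
def assemble (p : (𝒮 × ℝ) × (𝒮 × ℝ)) : (Bool → 𝒮) × (Bool → ℝ) :=
  (fun b => (if b then p.2 else p.1).1, fun b => (if b then p.2 else p.1).2)

theorem measurable_assemble : Measurable (assemble : (𝒮 × ℝ) × (𝒮 × ℝ) → _) := by
  refine Measurable.prodMk (measurable_pi_iff.2 fun b => ?_) (measurable_pi_iff.2 fun b => ?_) <;>
  · cases b <;> simp <;> fun_prop

/-- The conditional law of `(S(b), Y(b))` given the covariates. -/
noncomputable def armKernel (κ : Kernel (𝒳 × Bool) (𝒮 × ℝ)) (b : Bool) : Kernel 𝒳 (𝒮 × ℝ) :=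
  κ.comap (fun x => (x, b)) measurable_prodMk_right

instance (κ : Kernel (𝒳 × Bool) (𝒮 × ℝ)) [IsMarkovKernel κ] (b : Bool) :
    IsMarkovKernel (armKernel κ b) := by unfold armKernel; infer_instance

/-- The conditional law of everything but the covariates, with independent treatment and arms. -/
noncomputable def fullKernel (τ : Kernel 𝒳 Bool) (κ : Kernel (𝒳 × Bool) (𝒮 × ℝ)) :
    Kernel 𝒳 (Bool × (Bool → 𝒮) × (Bool → ℝ)) :=
  τ ×ₖ ((armKernel κ false ×ₖ armKernel κ true).map assemble)

instance (τ : Kernel 𝒳 Bool) [IsMarkovKernel τ] (κ : Kernel (𝒳 × Bool) (𝒮 × ℝ))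
    [IsMarkovKernel κ] : IsMarkovKernel (fullKernel τ κ) := by
  have := Kernel.IsMarkovKernel.map (armKernel κ false ×ₖ armKernel κ true)
    (measurable_assemble (𝒮 := 𝒮))
  unfold fullKernel; infer_instance

section FullLaw

variable (μ : Measure 𝒳) [IsFiniteMeasure μ] (τ : Kernel 𝒳 Bool) [IsMarkovKernel τ]
  (κ : Kernel (𝒳 × Bool) (𝒮 × ℝ)) [IsMarkovKernel κ]

/-- The law of the full data with covariate law `μ` and conditional law `fullKernel τ κ`. -/
noncomputable def fullLaw : Measure (FullData 𝒳 𝒮) := μ ⊗ₘ fullKernel τ κ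

instance : IsFiniteMeasure (fullLaw μ τ κ) := by
  unfold fullLaw; infer_instance

instance [IsProbabilityMeasure μ] : IsProbabilityMeasure (fullLaw μ τ κ) := by
  unfold fullLaw; infer_instance

/-- Each assumption involves X, T and a single arm. The other arm integrates out, and the chosen arm
follows its kernel whatever the value of T. -/
theorem lintegral_fullLaw_arm (t : Bool) {G : 𝒳 → Bool → 𝒮 × ℝ → ℝ≥0∞}
    (hG : Measurable fun p : 𝒳 × Bool × 𝒮 × ℝ => G p.1 p.2.1 p.2.2) :
    ∫⁻ w, G (X w) (T w) (Spot t w, Ypot t w) ∂(fullLaw μ τ κ)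
      = ∫⁻ x, ∫⁻ b, ∫⁻ p, G x b p ∂(κ (x, t)) ∂(τ x) ∂μ := by
  have hm : Measurable fun w : FullData 𝒳 𝒮 => G (X w) (T w) (Spot t w, Ypot t w) :=
    hG.comp (g := fun p : 𝒳 × Bool × 𝒮 × ℝ => G p.1 p.2.1 p.2.2)
      (f := fun w : FullData 𝒳 𝒮 => (X w, T w, Spot t w, Ypot t w)) (by fun_prop)
  have hx : ∀ x, Measurable fun p : Bool × (Bool → 𝒮) × (Bool → ℝ) =>
      G x p.1 (p.2.1 t, p.2.2 t) := fun x =>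
    hG.comp (g := fun p : 𝒳 × Bool × 𝒮 × ℝ => G p.1 p.2.1 p.2.2)
      (f := fun p : Bool × (Bool → 𝒮) × (Bool → ℝ) => (x, p.1, p.2.1 t, p.2.2 t)) (by fun_prop)
  have hxb : ∀ x b, Measurable fun p : 𝒮 × ℝ => G x b p := fun x b =>
    hG.comp (g := fun p : 𝒳 × Bool × 𝒮 × ℝ => G p.1 p.2.1 p.2.2)
      (f := fun p : 𝒮 × ℝ => (x, b, p)) (by fun_prop)
  have := Kernel.IsMarkovKernel.map (armKernel κ false ×ₖ armKernel κ true)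
    (measurable_assemble (𝒮 := 𝒮))
  rw [fullLaw, Measure.lintegral_compProd hm]
  refine lintegral_congr fun x => ?_
  change ∫⁻ p, G x p.1 (p.2.1 t, p.2.2 t) ∂(fullKernel τ κ x) = _
  rw [fullKernel, Kernel.lintegral_prod _ _ _ (hx x)]
  refine lintegral_congr fun b => ?_
  rw [Kernel.lintegral_map _ measurable_assemble _ (by have := hx x; fun_prop)]
  cases t
  · have h1 : Measurable fun p : (𝒮 × ℝ) × (𝒮 × ℝ) => G x b p.1 := (hxb x b).comp measurable_fst
    change ∫⁻ p, G x b p.1 ∂((armKernel κ false ×ₖ armKernel κ true) x) = _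
    rw [Kernel.lintegral_prod _ _ _ h1]
    simp [armKernel]
  · have h1 : Measurable fun p : (𝒮 × ℝ) × (𝒮 × ℝ) => G x b p.2 := (hxb x b).comp measurable_snd
    change ∫⁻ p, G x b p.2 ∂((armKernel κ false ×ₖ armKernel κ true) x) = _
    rw [Kernel.lintegral_prod _ _ _ h1]
    simp [armKernel]

theorem lintegral_fullLaw_XT {G : 𝒳 → Bool → ℝ≥0∞}
    (hG : Measurable fun p : 𝒳 × Bool => G p.1 p.2) :
    ∫⁻ w, G (X w) (T w) ∂(fullLaw μ τ κ) = ∫⁻ x, ∫⁻ b, G x b ∂(τ x) ∂μ := by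
  have := lintegral_fullLaw_arm μ τ κ true (G := fun x b _ => G x b)
    (hG.comp (measurable_fst.prodMk (measurable_fst.comp measurable_snd)))
  simpa using this

theorem map_X_fullLaw : (fullLaw μ τ κ).map X = μ := by
  refine Measure.ext_of_lintegral _ fun G hG => ?_
  rw [lintegral_map hG measurable_X, lintegral_fullLaw_XT μ τ κ (G := fun x _ => G x)
    (hG.comp measurable_fst)]
  simp only [lintegral_const, measure_univ, mul_one]

theorem map_XT_fullLaw : (fullLaw μ τ κ).map XT = μ ⊗ₘ τ := by
  refine Measure.ext_of_lintegral _ fun G hG => ?_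
  rw [lintegral_map hG measurable_XT, Measure.lintegral_compProd hG]
  exact lintegral_fullLaw_XT μ τ κ (G := fun x b => G (x, b)) hG

/-- On `T = t` only arm t is observed, so the coupling of the arms leaves no trace in the observed
law. -/
theorem map_XTSY_fullLaw : (fullLaw μ τ κ).map XTSY
    = ((μ ⊗ₘ τ) ⊗ₘ κ).map fun p : (𝒳 × Bool) × 𝒮 × ℝ => (p.1.1, p.1.2, p.2) := by
  refine Measure.ext_of_lintegral _ fun G hG => ?_
  rw [lintegral_map hG measurable_XTSY, lintegral_map hG (by fun_prop),
    Measure.lintegral_compProd (by fun_prop), Measure.lintegral_compProd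
      (Measurable.lintegral_kernel_prod_right' (f := fun p : (𝒳 × Bool) × 𝒮 × ℝ =>
        G (p.1.1, p.1.2, p.2)) (by fun_prop)), lintegral_eq_sum_fiber _ measurable_T]
  have h1 : ∀ t : Bool, ∫⁻ w in T ⁻¹' {t}, G (XTSY w) ∂(fullLaw μ τ κ)
      = ∫⁻ x, ∫⁻ b, ({t} : Set Bool).indicator 1 b * ∫⁻ p, G (x, t, p) ∂κ (x, t) ∂τ x ∂μ := by
    intro t
    have e : ∫⁻ w in T ⁻¹' {t}, G (XTSY w) ∂(fullLaw μ τ κ)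
        = ∫⁻ w in T ⁻¹' {t}, G (X w, t, Spot t w, Ypot t w) ∂(fullLaw μ τ κ) :=
      setLIntegral_fiber_congr _ measurable_T t fun b w => G (X w, b, Spot b w, Ypot b w)
    rw [e, setLIntegral_fiber_eq _ measurable_T]
    rw [lintegral_fullLaw_arm μ τ κ t
      (G := fun x b p => ({t} : Set Bool).indicator 1 b * G (x, t, p))
      (((measurable_indicator_bool t).comp (by fun_prop)).mul (by fun_prop))]
    refine lintegral_congr fun x => lintegral_congr fun b => ?_
    rw [lintegral_const_mul _ (by fun_prop)]
  have hm : ∀ t : Bool, Measurable fun x : 𝒳 =>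
      ∫⁻ b, ({t} : Set Bool).indicator 1 b * ∫⁻ p, G (x, t, p) ∂κ (x, t) ∂τ x := by
    intro t
    refine Measurable.lintegral_kernel_prod_right' (κ := τ) (f := fun q : 𝒳 × Bool =>
      ({t} : Set Bool).indicator 1 q.2 * ∫⁻ p, G (q.1, t, p) ∂κ (q.1, t)) ?_
    refine ((measurable_indicator_bool t).comp (by fun_prop)).mul ?_
    exact (Measurable.lintegral_kernel_prod_right' (κ := κ) (f := fun q : (𝒳 × Bool) × 𝒮 × ℝ =>
      G (q.1.1, t, q.2)) (by fun_prop)).comp (g := fun q : 𝒳 × Bool =>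
      ∫⁻ p, G (q.1, t, p) ∂κ q) (f := fun q : 𝒳 × Bool => (q.1, t)) (by fun_prop)
  simp only [h1, Fintype.sum_bool]
  rw [← lintegral_add_left (hm true)]
  refine lintegral_congr fun x => ?_
  rw [← lintegral_add_left (measurable_of_countable _)]
  refine lintegral_congr fun b => ?_
  cases b <;> simp

theorem map_fiber_fullLaw (r t : Bool) :
    ((fullLaw μ τ κ).restrict (T ⁻¹' {r})).map (fun w => (X w, Ypot t w, Spot t w))
      = ((fullLaw μ τ κ).restrict (T ⁻¹' {r})).map X ⊗ₘ (armKernel κ t).map Prod.swap := by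
  have := Kernel.IsMarkovKernel.map (armKernel κ t) (measurable_swap (α := 𝒮) (β := ℝ))
  refine Measure.ext_of_lintegral _ fun G hG => ?_
  rw [lintegral_map hG (by fun_prop), Measure.lintegral_compProd hG,
    lintegral_map hG.lintegral_kernel_prod_right' measurable_X,
    setLIntegral_fiber_eq _ measurable_T, setLIntegral_fiber_eq _ measurable_T,
    lintegral_fullLaw_arm μ τ κ t
      (G := fun x b p => ({r} : Set Bool).indicator 1 b * G (x, p.2, p.1))
      (((measurable_indicator_bool r).comp (by fun_prop)).mul (by fun_prop)),
    lintegral_fullLaw_XT μ τ κ (G := fun x b => ({r} : Set Bool).indicator 1 b *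
      ∫⁻ p, G (x, p) ∂((armKernel κ t).map Prod.swap x))
      (((measurable_indicator_bool r).comp (by fun_prop)).mul
        (hG.lintegral_kernel_prod_right'.comp measurable_fst))]
  refine lintegral_congr fun x => lintegral_congr fun b => ?_
  rw [lintegral_const_mul _ (by fun_prop),
    Kernel.lintegral_map _ measurable_swap _ (by fun_prop)]
  rfl

theorem map_TX_Spot_fullLaw (t : Bool) :
    (fullLaw μ τ κ).map (fun w => ((T w, X w), Spot t w))
      = (fullLaw μ τ κ).map (fun w => (T w, X w)) ⊗ₘ
        ((armKernel κ t).fst.comap Prod.snd measurable_snd) := by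
  refine Measure.ext_of_lintegral _ fun G hG => ?_
  rw [lintegral_map hG (by fun_prop), Measure.lintegral_compProd hG,
    lintegral_map hG.lintegral_kernel_prod_right' (by fun_prop),
    lintegral_fullLaw_arm μ τ κ t (G := fun x b p => G ((b, x), p.1)) (by fun_prop),
    lintegral_fullLaw_XT μ τ κ (G := fun x b => ∫⁻ p, G ((b, x), p)
      ∂(((armKernel κ t).fst.comap Prod.snd measurable_snd) (b, x)))
      ((Measurable.lintegral_kernel_prod_right'
        (κ := (armKernel κ t).fst.comap Prod.snd measurable_snd) hG).comp
        (measurable_swap (α := 𝒳) (β := Bool)))]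
  refine lintegral_congr fun x => lintegral_congr fun b => ?_
  rw [Kernel.comap_apply, Kernel.lintegral_fst _ _ (by fun_prop)]
  simp [armKernel]

/-- Disintegrating the arm kernel along S(t) gives a kernel from (x, s) that depends neither on the
covariate law nor on the fiber of T. This is what missingness at random asks for. -/
theorem map_XS_Ypot_fullLaw [StandardBorelSpace 𝒳] [StandardBorelSpace 𝒮] (r t : Bool) :
    ((fullLaw μ τ κ).restrict (T ⁻¹' {r})).map (fun w => ((X w, Spot t w), Ypot t w))
      = ((fullLaw μ τ κ).restrict (T ⁻¹' {r})).map (fun w => (X w, Spot t w)) ⊗ₘ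
        (armKernel κ t).condKernel := by
  refine Measure.ext_of_lintegral _ fun G hG => ?_
  rw [lintegral_map hG (by fun_prop), Measure.lintegral_compProd hG,
    lintegral_map hG.lintegral_kernel_prod_right' (by fun_prop),
    setLIntegral_fiber_eq _ measurable_T, setLIntegral_fiber_eq _ measurable_T,
    lintegral_fullLaw_arm μ τ κ t
      (G := fun x b p => ({r} : Set Bool).indicator 1 b * G ((x, p.1), p.2))
      (((measurable_indicator_bool r).comp (by fun_prop)).mul (by fun_prop)),
    lintegral_fullLaw_arm μ τ κ t (G := fun x b p => ({r} : Set Bool).indicator 1 b *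
      ∫⁻ y, G ((x, p.1), y) ∂((armKernel κ t).condKernel (x, p.1)))
      (((measurable_indicator_bool r).comp (by fun_prop)).mul
        (hG.lintegral_kernel_prod_right'.comp
          (f := fun q : 𝒳 × Bool × 𝒮 × ℝ => (q.1, q.2.2.1)) (by fun_prop)))]
  refine lintegral_congr fun x => lintegral_congr fun b => ?_
  have hin : Measurable fun s : 𝒮 => ∫⁻ y, G ((x, s), y) ∂((armKernel κ t).condKernel (x, s)) :=
    hG.lintegral_kernel_prod_right'.comp measurable_prodMk_left
  have hin' : Measurable fun p : 𝒮 × ℝ =>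
      ∫⁻ y, G ((x, p.1), y) ∂((armKernel κ t).condKernel (x, p.1)) := hin.comp measurable_fst
  rw [lintegral_const_mul _ (by fun_prop), lintegral_const_mul _ hin']
  congr 1
  have e : ∀ F : 𝒮 × ℝ → ℝ≥0∞, ∫⁻ p, F p ∂κ (x, t) = ∫⁻ p, F p ∂(armKernel κ t x) := fun F => rfl
  rw [e, e, ← Kernel.lintegral_fst _ _ hin]
  conv_lhs => rw [← Kernel.disintegrate (armKernel κ t) (armKernel κ t).condKernel]
  rw [Kernel.lintegral_compProd _ _ _ (by fun_prop)]

end FullLaw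

end Population

/-! ### Perturbed populations inside the model -/

namespace Population

variable {𝒳 𝒮 : Type*} [MeasurableSpace 𝒳] [MeasurableSpace 𝒮]

/-- The population with the given covariate laws and common kernels of the treatment and of the
two arms. -/
noncomputable def ofKernels (μ₁ μ₀ : Measure 𝒳) [IsProbabilityMeasure μ₁]
    [IsProbabilityMeasure μ₀] (τ : Kernel 𝒳 Bool) [IsMarkovKernel τ]
    (κ : Kernel (𝒳 × Bool) (𝒮 × ℝ)) [IsMarkovKernel κ] : Population 𝒳 𝒮 where
  lab := ⟨fullLaw μ₁ τ κ, inferInstance⟩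
  unl := ⟨fullLaw μ₀ τ κ, inferInstance⟩

section OfKernels

variable (μ₁ μ₀ : Measure 𝒳) [IsProbabilityMeasure μ₁] [IsProbabilityMeasure μ₀]
  (τ : Kernel 𝒳 Bool) [IsMarkovKernel τ] (κ : Kernel (𝒳 × Bool) (𝒮 × ℝ)) [IsMarkovKernel κ]

theorem labelled_ofKernels : (ofKernels μ₁ μ₀ τ κ).labelled = fullLaw μ₁ τ κ := rfl

theorem law_ofKernels (ρ : ℝ) : (ofKernels μ₁ μ₀ τ κ).law ρ
    = fullLaw (ρ.toNNReal • μ₁ + (1 - ρ).toNNReal • μ₀) τ κ := by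
  rw [fullLaw, Measure.smul_add_compProd]; rfl

end OfKernels

/-- The equality holds at every point, not just almost surely, because `condDistrib` is built from
the joint law of (X, T) alone. -/
theorem e_congr {ρ : ℝ} {P P' : Population 𝒳 𝒮} (h : (P'.law ρ).map XT = (P.law ρ).map XT) :
    P'.e ρ = P.e ρ := by
  have : condDistrib T X (P'.law ρ) = condDistrib T X (P.law ρ) := by
    rw [condDistrib, condDistrib]
    have h' : (P'.law ρ).map (fun w => (X w, T w)) = (P.law ρ).map (fun w => (X w, T w)) := h
    simp only [h']
  funext x
  rw [e, e, this]

theorem lam_congr {ρ : ℝ} {P P' : Population 𝒳 𝒮} (h : (P'.law ρ).map X = (P.law ρ).map X)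
    (h' : P'.labelled.map X = P.labelled.map X) : P'.lam ρ = P.lam ρ := by
  funext x
  rw [lam, lam, h, h']

theorem map_X_of_map_XT {μ ν : Measure (FullData 𝒳 𝒮)} (h : μ.map XT = ν.map XT) :
    μ.map X = ν.map X := by
  have e : ∀ m : Measure (FullData 𝒳 𝒮), m.map X = (m.map XT).map Prod.fst := fun m => by
    rw [Measure.map_map measurable_fst measurable_XT]; rfl
  rw [e, e, h]

/-- The conditional law of `(S, Y)` given `(X, T)` on the labelled data. -/
noncomputable def obsKernel [StandardBorelSpace 𝒮] [Nonempty 𝒮] (P : Population 𝒳 𝒮) :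
    Kernel (𝒳 × Bool) (𝒮 × ℝ) :=
  condDistrib (fun w => (S w, Y w)) XT P.labelled

instance [StandardBorelSpace 𝒮] [Nonempty 𝒮] (P : Population 𝒳 𝒮) : IsMarkovKernel P.obsKernel := by
  unfold obsKernel; infer_instance

theorem map_XTSY_labelled [StandardBorelSpace 𝒮] [Nonempty 𝒮] (P : Population 𝒳 𝒮) :
    P.labelled.map XTSY = ((P.labelled.map X ⊗ₘ condDistrib T X P.labelled) ⊗ₘ P.obsKernel).map
      fun p : (𝒳 × Bool) × 𝒮 × ℝ => (p.1.1, p.1.2, p.2) := by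
  have hSY : Measurable fun w : FullData 𝒳 𝒮 => (S w, Y w) := by fun_prop
  rw [compProd_map_condDistrib measurable_T.aemeasurable]
  change _ = ((P.labelled.map XT) ⊗ₘ P.obsKernel).map _
  rw [obsKernel, compProd_map_condDistrib hSY.aemeasurable,
    Measure.map_map (by fun_prop) (by fun_prop)]
  rfl

variable [StandardBorelSpace 𝒳] [StandardBorelSpace 𝒮] {ρ ε C : ℝ} {P : Population 𝒳 𝒮}

/-- Weighting by a function of X leaves the treatment kernel unchanged, so the labelled kernel also
serves for the unconditional law. -/
theorem map_XT_law_eq_compProd (hP : P.Admissible ρ ε C) (hρ₀ : 0 ≤ ρ) (hρ₁ : ρ < 1) :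
    (P.law ρ).map X ⊗ₘ condDistrib T X P.labelled = (P.law ρ).map XT := by
  have e := Measure.map_withDensity_comp (μ := P.labelled) measurable_XT
    (l := fun p => ENNReal.ofReal (P.lamClip ρ C p.1)) (by fun_prop)
  have e' := Measure.map_withDensity_comp (μ := P.labelled) measurable_X
    (l := fun x => ENNReal.ofReal (P.lamClip ρ C x)) (by fun_prop)
  rw [hP.map_XT_law hρ₀ hρ₁, hP.map_X_law hρ₀ hρ₁, reweighted, e',
    Measure.withDensity_compProd _ (by fun_prop),
    compProd_map_condDistrib measurable_T.aemeasurable]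
  exact e.symm

/-- Replacing the law of the arms given covariates and treatment keeps all assumptions, as long as
the outcome keeps its second moment. -/
theorem Admissible.ofKernels [Nonempty 𝒮] (hP : P.Admissible ρ ε C) (hρ₀ : 0 ≤ ρ) (hρ₁ : ρ < 1)
    [IsProbabilityMeasure (P.labelled.map X)]
    [IsProbabilityMeasure ((P.unl : Measure (FullData 𝒳 𝒮)).map X)]
    (κ : Kernel (𝒳 × Bool) (𝒮 × ℝ)) [IsMarkovKernel κ]
    (hY : MemLp Y 2 (fullLaw (P.labelled.map X) (condDistrib T X P.labelled) κ)) :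
    (Population.ofKernels (P.labelled.map X) ((P.unl : Measure (FullData 𝒳 𝒮)).map X)
      (condDistrib T X P.labelled) κ).Admissible ρ ε C ∧
    ((Population.ofKernels (P.labelled.map X) ((P.unl : Measure (FullData 𝒳 𝒮)).map X)
      (condDistrib T X P.labelled) κ).law ρ).map XT = (P.law ρ).map XT := by
  set τ := condDistrib T X P.labelled with hτ
  set μ₀ := (P.unl : Measure (FullData 𝒳 𝒮)).map X with hμ₀
  set P' := Population.ofKernels (P.labelled.map X) μ₀ τ κ with hP'
  have hlaw : P'.law ρ = fullLaw ((P.law ρ).map X) τ κ := by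
    rw [hP', law_ofKernels, law, Measure.map_smul_add _ _ measurable_X]
  have hlab : P'.labelled = fullLaw (P.labelled.map X) τ κ := rfl
  have hunl : (P'.unl : Measure (FullData 𝒳 𝒮)) = fullLaw μ₀ τ κ := rfl
  have hXT : (P'.law ρ).map XT = (P.law ρ).map XT := by
    rw [hlaw, map_XT_fullLaw, map_XT_law_eq_compProd hP hρ₀ hρ₁]
  have hX : (P'.law ρ).map X = (P.law ρ).map X := map_X_of_map_XT hXT
  have hlabX : P'.labelled.map X = P.labelled.map X := by rw [hlab, map_X_fullLaw]
  have he : P'.e ρ = P.e ρ := e_congr hXT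
  have hl : P'.lam ρ = P.lam ρ := lam_congr hX hlabX
  -- Overlap and the bound on λ concern X alone, and the law of X is unchanged.
  have hae : ∀ {p : 𝒳 → Prop}, MeasurableSet {x | p x} → (∀ᵐ w ∂(P.law ρ), p (X w)) →
      ∀ᵐ w ∂(P'.law ρ), p (X w) := by
    intro p hp h
    have := (ae_map_iff measurable_X.aemeasurable hp).2 h
    rw [← hX] at this
    exact ae_of_ae_map measurable_X.aemeasurable this
  refine ⟨⟨fun t => ?_, fun q hq₀ hq₁ t => ?_, fun q hq₀ hq₁ t => ?_, fun q hq₀ hq₁ => ?_, ?_, ?_,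
    ?_, hY⟩, hXT⟩
  · have hYS : Measurable fun w : FullData 𝒳 𝒮 => (Ypot t w, Spot t w) := by fun_prop
    refine CondIndepFun.symm ((condIndepFun_bool_iff measurable_T hYS measurable_X).2
      ⟨(armKernel κ t).map Prod.swap, Kernel.IsMarkovKernel.map _ measurable_swap, fun r => ?_⟩)
    rw [hlaw]
    exact map_fiber_fullLaw _ τ κ r t
  · have hXS : Measurable fun w : FullData 𝒳 𝒮 => (X w, Spot t w) := by fun_prop
    refine (condIndepFun_cond_joint_iff hq₀ hq₁ P' t hXS (measurable_Ypot t)).2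
      ⟨(armKernel κ t).condKernel, inferInstance, ?_, ?_⟩
    · rw [hlab]; exact map_XS_Ypot_fullLaw _ τ κ t t
    · rw [hunl]; exact map_XS_Ypot_fullLaw _ τ κ t t
  · have hTX : Measurable fun w : FullData 𝒳 𝒮 => (T w, X w) := by fun_prop
    refine (condIndepFun_joint_iff hq₀ hq₁ P' hTX (measurable_Spot t)).2
      ⟨(armKernel κ t).fst.comap Prod.snd measurable_snd, inferInstance, ?_, ?_⟩
    · rw [hlab]; exact map_TX_Spot_fullLaw _ τ κ t
    · rw [hunl]; exact map_TX_Spot_fullLaw _ τ κ t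
  · refine (condIndepFun_joint_iff hq₀ hq₁ P' measurable_X measurable_T).2
      ⟨τ, inferInstance, ?_, ?_⟩
    · rw [hlab, map_X_fullLaw]; exact map_XT_fullLaw _ τ κ
    · rw [hunl, map_X_fullLaw]; exact map_XT_fullLaw _ τ κ
  · rw [he]
    refine hae (p := fun x => ε ≤ P.e ρ x ∧ P.e ρ x ≤ 1 - ε) ?_ hP.overlap
    exact (measurableSet_le measurable_const (P.measurable_e ρ)).inter
      (measurableSet_le (P.measurable_e ρ) measurable_const)
  · rw [hX, hlabX]; exact hP.absolutelyContinuous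
  · rw [hl]
    exact hae (p := fun x => P.lam ρ x ≤ C)
      (measurableSet_le (P.measurable_lam ρ) measurable_const) hP.lam_le

/-- Tilt the kernel of (S, Y) given (X, T) by 1 + t h and keep the laws of X in both subpopulations
and the treatment kernel. Conditional mean zero keeps the tilted kernel normalized; |t| M ≤ 1/2
keeps the factor between 1/2 and 3/2. -/
theorem exists_perturbation [Nonempty 𝒮] (hP : P.Admissible ρ ε C) (hρ₀ : 0 ≤ ρ) (hρ₁ : ρ < 1)
    {h : 𝒳 × Bool × 𝒮 × ℝ → ℝ} (hm : Measurable h) {M : ℝ} (hM : ∀ o, |h o| ≤ M)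
    (hz : P.labelled[fun w => h (XTSY w) | MeasurableSpace.comap XT inferInstance]
      =ᵐ[P.labelled] 0) {t : ℝ} (ht : |t| * M ≤ 1 / 2) :
    ∃ P' : Population 𝒳 𝒮, P'.Admissible ρ ε C ∧
      (P'.law ρ).map XT = (P.law ρ).map XT ∧ P'.labelled.map X = P.labelled.map X ∧
      P'.labelled.map XTSY
        = (P.labelled.map XTSY).withDensity (fun o => ENNReal.ofReal (1 + t * h o)) := by
  have hX₁ : IsProbabilityMeasure (P.labelled.map X) :=
    Measure.isProbabilityMeasure_map measurable_X.aemeasurable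
  have hX₀ : IsProbabilityMeasure ((P.unl : Measure (FullData 𝒳 𝒮)).map X) :=
    Measure.isProbabilityMeasure_map measurable_X.aemeasurable
  have hSY : Measurable fun w : FullData 𝒳 𝒮 => (S w, Y w) := by fun_prop
  set H : (𝒳 × Bool) × 𝒮 × ℝ → ℝ := fun p => h (p.1.1, p.1.2, p.2) with hH
  have hHm : Measurable H := by fun_prop
  set m : 𝒳 × Bool → ℝ := fun a => ∫ p, H (a, p) ∂(P.obsKernel a) with hmd
  have hmm : Measurable m := (hHm.stronglyMeasurable.integral_kernel_prod_right').measurable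
  have hm0 : ∀ᵐ a ∂P.labelled.map XT, m a = 0 := by
    refine (ae_map_iff measurable_XT.aemeasurable (p := fun a => m a = 0)
      (hmm (measurableSet_singleton 0))).2 ?_
    have hi : Integrable (fun w => H (XT w, (S w, Y w))) P.labelled :=
      Integrable.of_bound (hHm.comp (by fun_prop)).aestronglyMeasurable M
        (Eventually.of_forall fun w => hM _)
    have := condExp_prod_ae_eq_integral_condDistrib measurable_XT hSY.aemeasurable
      hHm.stronglyMeasurable hi
    filter_upwards [this, hz] with w h1 h2
    exact h1.symm.trans h2
  -- The conditional mean `m` vanishes only almost everywhere, but a Markov kernel must have mass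
  -- one at every point. The tilt is therefore switched off where `m` is not zero.
  set H' : 𝒳 × Bool → 𝒮 × ℝ → ℝ := fun a p => if m a = 0 then H (a, p) else 0 with hH'
  have hH'm : Measurable (Function.uncurry H') :=
    Measurable.ite ((hmm.comp measurable_fst) (measurableSet_singleton 0)) hHm measurable_const
  have hH'M : ∀ a p, |t * H' a p| ≤ 1 / 2 := fun a p => by
    rw [abs_mul]
    have : |H' a p| ≤ M := by
      simp only [hH']
      split_ifs
      · exact hM _
      · simpa using (abs_nonneg _).trans (hM (a.1, a.2, p))
    exact (mul_le_mul_of_nonneg_left this (abs_nonneg t)).trans ht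
  have hpos : ∀ a p, 0 ≤ 1 + t * H' a p := fun a p => by
    have := (abs_le.1 (hH'M a p)).1; linarith
  set f : 𝒳 × Bool → 𝒮 × ℝ → ℝ≥0∞ := fun a p => ENNReal.ofReal (1 + t * H' a p) with hf
  have hfm : Measurable (Function.uncurry f) := ((hH'm.const_mul t).const_add 1).ennreal_ofReal
  set κ := Kernel.withDensity P.obsKernel f with hκ
  have hκm : IsMarkovKernel κ := by
    refine ⟨fun a => ⟨?_⟩⟩
    have hHa : Measurable (H' a) := hH'm.comp measurable_prodMk_left
    have hia : Integrable (fun p => t * H' a p) (P.obsKernel a) :=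
      Integrable.of_bound (hHa.const_mul t).aestronglyMeasurable (1 / 2)
        (Eventually.of_forall (hH'M a))
    have : ∫ p, H' a p ∂(P.obsKernel a) = 0 := by
      by_cases ha : m a = 0
      · simp only [hH', ha, if_true]; exact ha
      · simp [hH', ha]
    have hi1 : Integrable (fun p => 1 + t * H' a p) (P.obsKernel a) := (integrable_const 1).add hia
    have e : ∫ p, (1 + t * H' a p) ∂(P.obsKernel a) = 1 := by
      rw [integral_add (integrable_const 1) hia, integral_const_mul, this]; simp
    rw [hκ, Kernel.withDensity_apply' _ hfm, setLIntegral_univ,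
      ← ofReal_integral_eq_lintegral_ofReal hi1 (Eventually.of_forall (hpos a)), e,
      ENNReal.ofReal_one]
  set τ := condDistrib T X P.labelled with hτ
  have hXTlab : P.labelled.map X ⊗ₘ τ = P.labelled.map XT :=
    compProd_map_condDistrib measurable_T.aemeasurable
  have hobs : (fullLaw (P.labelled.map X) τ κ).map XTSY
      = (P.labelled.map XTSY).withDensity (fun o => ENNReal.ofReal (1 + t * h o)) := by
    rw [map_XTSY_fullLaw, map_XTSY_labelled, hXTlab]
    have e := Measure.map_withDensity_comp (μ := P.labelled.map XT ⊗ₘ P.obsKernel)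
      (φ := fun p : (𝒳 × Bool) × 𝒮 × ℝ => (p.1.1, p.1.2, p.2)) (by fun_prop)
      (l := fun o => ENNReal.ofReal (1 + t * h o)) (by fun_prop)
    rw [← e]
    congr 1
    refine Measure.ext_of_lintegral _ fun G hG => ?_
    rw [Measure.lintegral_compProd hG, lintegral_withDensity_eq_lintegral_mul _ (by fun_prop) hG,
      Measure.lintegral_compProd (by fun_prop)]
    refine lintegral_congr_ae ?_
    filter_upwards [hm0] with a ha
    rw [hκ, Kernel.lintegral_withDensity _ hfm _ (by fun_prop)]
    refine lintegral_congr fun p => ?_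
    simp only [hf, hH', ha, if_true, Pi.mul_apply]
    rfl
  have hYo : ∀ μ : Measure (FullData 𝒳 𝒮), MemLp Y 2 μ
      ↔ MemLp (fun o : 𝒳 × Bool × 𝒮 × ℝ => o.2.2.2) 2 (μ.map XTSY) := fun μ =>
    (memLp_map_measure_iff (g := fun o : 𝒳 × Bool × 𝒮 × ℝ => o.2.2.2)
      (by fun_prop : Measurable fun o : 𝒳 × Bool × 𝒮 × ℝ => o.2.2.2).aestronglyMeasurable
      measurable_XTSY.aemeasurable).symm
  have hY : MemLp Y 2 (fullLaw (P.labelled.map X) τ κ) := by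
    rw [hYo, hobs]
    have hle : (P.labelled.map XTSY).withDensity (fun o => ENNReal.ofReal (1 + t * h o))
        ≤ (2 : ℝ≥0∞) • P.labelled.map XTSY := by
      rw [← withDensity_const]
      refine withDensity_mono (Eventually.of_forall fun o => ?_)
      have h1 : |t * h o| ≤ 1 / 2 := by
        rw [abs_mul]; exact (mul_le_mul_of_nonneg_left (hM o) (abs_nonneg t)).trans ht
      rw [show (2 : ℝ≥0∞) = ENNReal.ofReal 2 by simp]
      exact ENNReal.ofReal_le_ofReal (by linarith [(abs_le.1 h1).2])
    exact (((hYo _).1 hP.memLp_Y).smul_measure (by norm_num)).mono_measure hle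
  refine ⟨Population.ofKernels (P.labelled.map X) ((P.unl : Measure (FullData 𝒳 𝒮)).map X) τ κ,
    (hP.ofKernels hρ₀ hρ₁ κ hY).1, (hP.ofKernels hρ₀ hρ₁ κ hY).2, ?_, hobs⟩
  rw [labelled_ofKernels, map_X_fullLaw]

end Population

/-! ### Cramér–Rao bounds and the second moment of a gradient -/

section SquareIntegrals

variable {O : Type*} [MeasurableSpace O] {μ : Measure O} {f g : O → ℝ}

theorem memLp_two_iff_lintegral :
    MemLp f 2 μ ↔ AEStronglyMeasurable f μ ∧ ∫⁻ w, ‖f w‖ₑ ^ 2 ∂μ < ∞ := by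
  rw [MemLp, eLpNorm_lt_top_iff_lintegral_rpow_enorm_lt_top (by norm_num) (by norm_num)]
  simp

theorem MeasureTheory.MemLp.ofReal_integral_sq (hf : MemLp f 2 μ) :
    ENNReal.ofReal (∫ w, f w ^ 2 ∂μ) = ∫⁻ w, ‖f w‖ₑ ^ 2 ∂μ := by
  rw [ofReal_integral_eq_lintegral_ofReal hf.integrable_sq (ae_of_all _ fun w => sq_nonneg _)]
  refine lintegral_congr fun w => ?_
  rw [← Real.enorm_eq_ofReal (sq_nonneg _), enorm_pow]

theorem sq_integral_mul_le (hf : MemLp f 2 μ) (hg : MemLp g 2 μ) :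
    (∫ w, f w * g w ∂μ) ^ 2 ≤ (∫ w, f w ^ 2 ∂μ) * ∫ w, g w ^ 2 ∂μ := by
  have h := abs_integral_mul_le_sqrt hf hg
  have hf0 : 0 ≤ ∫ w, f w ^ 2 ∂μ := integral_nonneg fun w => sq_nonneg _
  have hg0 : 0 ≤ ∫ w, g w ^ 2 ∂μ := integral_nonneg fun w => sq_nonneg _
  calc (∫ w, f w * g w ∂μ) ^ 2 = |∫ w, f w * g w ∂μ| ^ 2 := (sq_abs _).symm
    _ ≤ (√(∫ w, f w ^ 2 ∂μ) * √(∫ w, g w ^ 2 ∂μ)) ^ 2 := by gcongr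
    _ = _ := by rw [mul_pow, Real.sq_sqrt hf0, Real.sq_sqrt hg0]

theorem real_inner_Lp_eq (u v : Lp ℝ 2 μ) : inner ℝ u v = ∫ w, u w * v w ∂μ := by
  rw [L2.inner_def]
  refine integral_congr_ae (ae_of_all _ fun w => ?_)
  simp [mul_comm]

end SquareIntegrals

section EfficiencyBound

variable {𝒳 𝒮 O : Type*} [MeasurableSpace 𝒳] [MeasurableSpace 𝒮] [MeasurableSpace O]
  {M : Set (Population 𝒳 𝒮)} {obs : FullData 𝒳 𝒮 → O} {P : Population 𝒳 𝒮}
  {path : ℝ → Population 𝒳 𝒮} {g g' ψ : O → ℝ} {θ : Population 𝒳 𝒮 → ℝ}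

theorem IsRegularSubmodel.congr (h : IsRegularSubmodel M obs P path g)
    (hg : g =ᵐ[obsLaw obs P] g') : IsRegularSubmodel M obs P path g' where
  path_zero := h.path_zero
  mem_model := h.mem_model
  memLp_score := (memLp_congr_ae hg).1 h.memLp_score
  dqm := h.dqm.congr fun t => dqmRemainder_congr _ _ hg t
  moment := h.moment

theorem IsRegularSubmodel.toLp_mem_tangentSet (h : IsRegularSubmodel M obs P path g) :
    h.memLp_score.toLp g ∈ tangentSet M obs P :=
  ⟨path, h.congr h.memLp_score.coeFn_toLp.symm⟩

/-- The Cramér-Rao bounds do not exceed the second moment of a gradient, and they approach it when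
the gradient is a limit of scores. -/
theorem IsEfficientInfluenceFunction.efficiencyBound_eq
    (h : IsEfficientInfluenceFunction M obs θ P ψ)
    (hcl : h.memLp.toLp ψ ∈ closure (tangentSet M obs P)) :
    efficiencyBound M obs θ P = ENNReal.ofReal (∫ w, ψ w ^ 2 ∂(obsLaw obs P)) := by
  refine le_antisymm ?_ ?_
  · refine iSup_le fun path => iSup_le fun g => iSup_le fun d => iSup_le fun hr =>
      iSup_le fun hd => ?_
    rw [hd.unique (h.gradient path g hr), ← hr.memLp_score.ofReal_integral_sq]
    refine ENNReal.div_le_of_le_mul ?_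
    rw [← ENNReal.ofReal_mul (integral_nonneg fun w => sq_nonneg _)]
    exact ENNReal.ofReal_le_ofReal (sq_integral_mul_le h.memLp hr.memLp_score)
  · set Ψ := h.memLp.toLp ψ with hΨ
    have hnorm : ∫ w, ψ w ^ 2 ∂(obsLaw obs P) = ‖Ψ‖ ^ 2 := by
      rw [← real_inner_self_eq_norm_sq, real_inner_Lp_eq]
      refine integral_congr_ae ?_
      filter_upwards [h.memLp.coeFn_toLp] with w hw
      rw [hw, sq]
    rw [hnorm]
    rcases eq_or_ne Ψ 0 with h0 | h0
    · simp [h0]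
    -- Along scores `u n` tending to Ψ ≠ 0, the ratios ⟨Ψ, u n⟩² / ‖u n‖² tend to ‖Ψ‖². The scores
    -- are taken from the tangent set itself since linear combinations need not be scores.
    obtain ⟨u, hu, hlim⟩ := mem_closure_iff_seq_limit.1 hcl
    have hF : Tendsto (fun n => ENNReal.ofReal ((inner ℝ Ψ (u n)) ^ 2 / ‖u n‖ ^ 2)) atTop
        (𝓝 (ENNReal.ofReal ((inner ℝ Ψ Ψ) ^ 2 / ‖Ψ‖ ^ 2))) := by
      refine (ENNReal.continuous_ofReal.tendsto _).comp ?_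
      exact ((tendsto_const_nhds.inner hlim).pow 2).div (hlim.norm.pow 2)
        (pow_ne_zero 2 (norm_ne_zero_iff.2 h0))
    have hval : (inner ℝ Ψ Ψ) ^ 2 / ‖Ψ‖ ^ 2 = ‖Ψ‖ ^ 2 := by
      have := norm_ne_zero_iff.2 h0
      rw [real_inner_self_eq_norm_sq]
      field_simp
    rw [hval] at hF
    refine le_of_tendsto' hF fun n => ?_
    obtain ⟨path, hr⟩ := hu n
    have hd := h.gradient path _ hr
    have hd' : inner ℝ Ψ (u n) = ∫ w, ψ w * u n w ∂(obsLaw obs P) := by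
      rw [real_inner_Lp_eq]
      refine integral_congr_ae ?_
      filter_upwards [h.memLp.coeFn_toLp] with w hw
      rw [hw]
    have hn : ‖u n‖ ^ 2 = ∫ w, u n w ^ 2 ∂(obsLaw obs P) := by
      rw [← real_inner_self_eq_norm_sq, real_inner_Lp_eq]
      simp only [sq]
    calc ENNReal.ofReal ((inner ℝ Ψ (u n)) ^ 2 / ‖u n‖ ^ 2)
        ≤ ENNReal.ofReal ((∫ w, ψ w * u n w ∂(obsLaw obs P)) ^ 2) /
          ∫⁻ w, ‖u n w‖ₑ ^ 2 ∂(obsLaw obs P) := by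
          rw [← hd', ← hr.memLp_score.ofReal_integral_sq, ← hn]
          exact ENNReal.ofReal_div_le (by positivity)
      _ ≤ _ := by
          refine le_iSup_of_le path ?_
          refine le_iSup_of_le (u n) ?_
          refine le_iSup_of_le (∫ w, ψ w * u n w ∂(obsLaw obs P)) ?_
          exact le_iSup_of_le hr (le_iSup_of_le hd le_rfl)

end EfficiencyBound

/-! ### Inverse probability weighting and the treatment effect -/

namespace Population

variable {𝒳 𝒮 : Type*} [MeasurableSpace 𝒳] [MeasurableSpace 𝒮]

open Classical in
/-- The signed inverse probability weight of a treatment, set to zero where overlap fails. -/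
noncomputable def ipw (ρ ε : ℝ) (P : Population 𝒳 𝒮) (p : 𝒳 × Bool) : ℝ :=
  if ε ≤ P.e ρ p.1 ∧ P.e ρ p.1 ≤ 1 - ε then
    (if p.2 then (P.e ρ p.1)⁻¹ else -(1 - P.e ρ p.1)⁻¹) else 0

theorem measurableSet_overlap (ρ ε : ℝ) (P : Population 𝒳 𝒮) :
    MeasurableSet {x | ε ≤ P.e ρ x ∧ P.e ρ x ≤ 1 - ε} :=
  (measurableSet_le measurable_const (measurable_e ρ P)).inter
    (measurableSet_le (measurable_e ρ P) measurable_const)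

@[fun_prop]
theorem measurable_ipw (ρ ε : ℝ) (P : Population 𝒳 𝒮) : Measurable (P.ipw ρ ε) := by
  refine Measurable.ite (measurable_fst (measurableSet_overlap ρ ε P)) ?_ measurable_const
  exact Measurable.ite (measurable_snd (measurableSet_singleton true)) (by fun_prop) (by fun_prop)

theorem abs_ipw_le (ρ : ℝ) {ε : ℝ} (hε : 0 < ε) (P : Population 𝒳 𝒮) (p : 𝒳 × Bool) :
    |P.ipw ρ ε p| ≤ ε⁻¹ := by
  unfold ipw
  split_ifs with h1 h2
  · rw [abs_of_nonneg (inv_nonneg.2 (hε.le.trans h1.1))]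
    exact inv_anti₀ hε h1.1
  · have : ε ≤ 1 - P.e ρ p.1 := by linarith [h1.2]
    rw [abs_neg, abs_of_nonneg (inv_nonneg.2 (hε.le.trans this))]
    exact inv_anti₀ hε this
  · simpa using hε.le

theorem ipw_congr {ρ ε : ℝ} {P P' : Population 𝒳 𝒮} (h : P'.e ρ = P.e ρ) :
    P'.ipw ρ ε = P.ipw ρ ε := by
  unfold ipw; rw [h]

variable [StandardBorelSpace 𝒳] [StandardBorelSpace 𝒮] {ρ ε C : ℝ} {P : Population 𝒳 𝒮}

namespace Admissible

variable [Nonempty 𝒮]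

theorem lintegral_law (hP : P.Admissible ρ ε C) (hρ₀ : 0 ≤ ρ) (hρ₁ : ρ < 1)
    {G : 𝒳 × Bool × 𝒮 × ℝ → ℝ≥0∞} (hG : Measurable G) :
    ∫⁻ w, G (XTSY w) ∂(P.law ρ)
      = ∫⁻ w, ENNReal.ofReal (P.lamClip ρ C (X w)) * G (XTSY w) ∂P.labelled := by
  rw [(Measure.map_eq_map_iff measurable_XTSY).1 (hP.map_XTSY_law hρ₀ hρ₁) G hG, reweighted,
    lintegral_withDensity_eq_lintegral_mul _ (by fun_prop) (by fun_prop)]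
  rfl

theorem lintegral_law_le (hP : P.Admissible ρ ε C) (hρ₀ : 0 ≤ ρ) (hρ₁ : ρ < 1)
    {G : 𝒳 × Bool × 𝒮 × ℝ → ℝ≥0∞} (hG : Measurable G) :
    ∫⁻ w, G (XTSY w) ∂(P.law ρ) ≤ ENNReal.ofReal C * ∫⁻ w, G (XTSY w) ∂P.labelled := by
  rw [hP.lintegral_law hρ₀ hρ₁ hG, ← lintegral_const_mul _ (by fun_prop)]
  gcongr with w
  exact lamClip_le ρ C P _

theorem integral_law (hP : P.Admissible ρ ε C) (hρ₀ : 0 ≤ ρ) (hρ₁ : ρ < 1)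
    {G : 𝒳 × Bool × 𝒮 × ℝ → ℝ} (hG : Measurable G) :
    ∫ w, G (XTSY w) ∂(P.law ρ) = ∫ w, P.lamClip ρ C (X w) * G (XTSY w) ∂P.labelled := by
  rw [← integral_map (f := G) measurable_XTSY.aemeasurable hG.aestronglyMeasurable,
    hP.map_XTSY_law hρ₀ hρ₁, reweighted,
    integral_map_withDensity measurable_XTSY (l := fun w => P.lamClip ρ C (X w)) (by fun_prop)
      (fun w => lamClip_nonneg ρ (hP.C_nonneg hρ₀ hρ₁) P _) hG]

theorem memLp_law (hP : P.Admissible ρ ε C) (hρ₀ : 0 ≤ ρ) (hρ₁ : ρ < 1)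
    {G : 𝒳 × Bool × 𝒮 × ℝ → ℝ} (hG : Measurable G) (h : MemLp (fun w => G (XTSY w)) 2 P.labelled) :
    MemLp (fun w => G (XTSY w)) 2 (P.law ρ) := by
  refine memLp_two_iff_lintegral.2 ⟨(hG.comp measurable_XTSY).aestronglyMeasurable, ?_⟩
  refine (hP.lintegral_law_le hρ₀ hρ₁ (G := fun o => ‖G o‖ₑ ^ 2) (by fun_prop)).trans_lt ?_
  exact ENNReal.mul_lt_top ENNReal.ofReal_lt_top (memLp_two_iff_lintegral.1 h).2

theorem memLp_Y_law (hP : P.Admissible ρ ε C) (hρ₀ : 0 ≤ ρ) (hρ₁ : ρ < 1) :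
    MemLp Y 2 (P.law ρ) :=
  hP.memLp_law hρ₀ hρ₁ (G := fun o => o.2.2.2) (by fun_prop) hP.memLp_Y

/-- Inverse probability weighting with `ipw` recovers the law of the potential variables. -/
theorem map_potential_law_ipw (hP : P.Admissible ρ ε C) (hε : 0 < ε) (t : Bool) :
    (P.law ρ).map (fun w => (X w, Ypot t w, Spot t w))
      = (((P.law ρ).restrict (T ⁻¹' {t})).withDensity
          fun w => ENNReal.ofReal |P.ipw ρ ε (XT w)|).map
        (fun w => (X w, Ypot t w, Spot t w)) := by
  rw [hP.map_potential_law hε t]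
  congr 1
  refine withDensity_congr_ae ?_
  refine (ae_restrict_iff' (measurable_T (measurableSet_singleton t))).2 ?_
  filter_upwards [hP.overlap] with w hw hT
  have hT' : T w = t := hT
  have hone : (condDistrib T X (P.law ρ) (X w)).real {true}
        + (condDistrib T X (P.law ρ) (X w)).real {false} = 1 := by
    have := probReal_compl_eq_one_sub (μ := condDistrib T X (P.law ρ) (X w))
      (measurableSet_singleton true)
    have hc : ({true} : Set Bool)ᶜ = {false} := by ext b; simp
    rw [hc] at this; linarith
  have he : P.e ρ (X w) = (condDistrib T X (P.law ρ) (X w)).real {true} := rfl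
  have hpos : 0 < (condDistrib T X (P.law ρ) (X w)).real {t} := by
    cases t <;> linarith [hw.1, hw.2]
  have habs : |P.ipw ρ ε (XT w)| = ((condDistrib T X (P.law ρ) (X w)).real {t})⁻¹ := by
    have hw1 : ε ≤ P.e ρ (XT w).1 ∧ P.e ρ (XT w).1 ≤ 1 - ε := hw
    have h2 : (XT w).2 = t := hT'
    have h3 : P.e ρ (XT w).1 = P.e ρ (X w) := rfl
    rw [ipw, if_pos hw1, h2, h3]
    cases t
    · have : 1 - P.e ρ (X w) = (condDistrib T X (P.law ρ) (X w)).real {false} := by linarith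
      simp only [Bool.false_eq_true, if_false, abs_neg, this]
      exact abs_of_pos (inv_pos.2 hpos)
    · simp only [if_true, he]
      exact abs_of_pos (inv_pos.2 hpos)
  rw [habs, ENNReal.ofReal_inv_of_pos hpos, ofReal_measureReal]

/-- The means over a potential arm become observed means on the fiber `T = t`, where S(t) and Y(t)
are S and Y and |w| is the inverse probability of that arm. -/
theorem integral_potential (hP : P.Admissible ρ ε C) (hε : 0 < ε) (t : Bool)
    {F : 𝒳 → 𝒮 → ℝ → ℝ} (hF : Measurable fun p : 𝒳 × ℝ × 𝒮 => F p.1 p.2.2 p.2.1) :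
    ∫ w, F (X w) (Spot t w) (Ypot t w) ∂(P.law ρ)
      = ∫ w in T ⁻¹' {t}, |P.ipw ρ ε (XT w)| * F (X w) (S w) (Y w) ∂(P.law ρ) := by
  have hm : Measurable fun w : FullData 𝒳 𝒮 => (X w, Ypot t w, Spot t w) := by fun_prop
  rw [← integral_map (f := fun p : 𝒳 × ℝ × 𝒮 => F p.1 p.2.2 p.2.1) hm.aemeasurable
      hF.aestronglyMeasurable, hP.map_potential_law_ipw hε t,
    integral_map_withDensity hm (l := fun w => |P.ipw ρ ε (XT w)|) (by fun_prop)
      (fun w => abs_nonneg _) hF]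
  refine setIntegral_congr_fun (measurable_T (measurableSet_singleton t)) fun w hT => ?_
  have hT' : T w = t := hT
  simp only [S, Y, hT']

theorem lintegral_potential_le (hP : P.Admissible ρ ε C) (hε : 0 < ε) (t : Bool)
    {F : Bool → 𝒳 → 𝒮 → ℝ≥0∞} (hF : Measurable fun p : 𝒳 × ℝ × 𝒮 => F t p.1 p.2.2) :
    ∫⁻ w, F t (X w) (Spot t w) ∂(P.law ρ)
      ≤ ENNReal.ofReal ε⁻¹ * ∫⁻ w, F (T w) (X w) (S w) ∂(P.law ρ) := by
  have hm : Measurable fun w : FullData 𝒳 𝒮 => (X w, Ypot t w, Spot t w) := by fun_prop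
  rw [(Measure.map_eq_map_iff hm).1 (hP.map_potential_law_ipw hε t) (fun p => F t p.1 p.2.2) hF,
    lintegral_withDensity_eq_lintegral_mul _ (by fun_prop)
      (show Measurable fun w => F t (X w) (Spot t w) from hF.comp hm)]
  calc _ ≤ ∫⁻ w in T ⁻¹' {t}, ENNReal.ofReal ε⁻¹ * F (T w) (X w) (S w) ∂(P.law ρ) := by
        refine setLIntegral_mono' (measurable_T (measurableSet_singleton t)) fun w hT => ?_
        have hT' : T w = t := hT
        simp only [Pi.mul_apply, S, hT']
        gcongr
        exact abs_ipw_le ρ hε P _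
    _ ≤ ∫⁻ w, ENNReal.ofReal ε⁻¹ * F (T w) (X w) (S w) ∂(P.law ρ) := setLIntegral_le_lintegral _ _
    _ = _ := lintegral_const_mul' _ _ ENNReal.ofReal_ne_top

/-- Inverse probability weighting identifies the average treatment effect. -/
theorem ate_eq (hP : P.Admissible ρ ε C) (hρ₀ : 0 ≤ ρ) (hρ₁ : ρ < 1) (hε : 0 < ε) :
    P.ate ρ = ∫ w, P.ipw ρ ε (XT w) * Y w ∂(P.law ρ) := by
  have := isProbabilityMeasure_law hρ₀ hρ₁ P
  have hi : Integrable (fun w => P.ipw ρ ε (XT w) * Y w) (P.law ρ) :=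
    ((hP.memLp_Y_law hρ₀ hρ₁).integrable one_le_two).bdd_mul (c := ε⁻¹)
      ((measurable_ipw ρ ε P).comp measurable_XT).aestronglyMeasurable
      (ae_of_all _ fun w => abs_ipw_le ρ hε P _)
  have hm := measurable_T (𝒳 := 𝒳) (𝒮 := 𝒮) (measurableSet_singleton true)
  have hc : (T ⁻¹' {true} : Set (FullData 𝒳 𝒮))ᶜ = T ⁻¹' {false} := by ext w; simp
  rw [ate, hP.integral_potential hε true (F := fun _ _ y => y) (by fun_prop),
    hP.integral_potential hε false (F := fun _ _ y => y) (by fun_prop),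
    ← integral_add_compl hm hi, hc, sub_eq_add_neg, ← integral_neg]
  have sgn : ∀ w : FullData 𝒳 𝒮, |P.ipw ρ ε (XT w)|
      = (if T w then P.ipw ρ ε (XT w) else - P.ipw ρ ε (XT w)) := fun w => by
    have he : (XT w).2 = T w := rfl
    unfold ipw
    rw [he]
    split_ifs with h1 h2
    · exact abs_of_nonneg (inv_nonneg.2 (hε.le.trans h1.1))
    · have : ε ≤ 1 - P.e ρ (XT w).1 := by linarith [h1.2]
      rw [abs_neg, neg_neg, abs_of_nonneg (inv_nonneg.2 (hε.le.trans this))]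
    all_goals simp
  congr 1
  · refine setIntegral_congr_fun hm fun w hw => ?_
    have hw' : T w = true := hw
    simp only [sgn, hw', if_true]
  · refine setIntegral_congr_fun (measurable_T (measurableSet_singleton false)) fun w hw => ?_
    have hw' : T w = false := hw
    simp [sgn, hw']

end Admissible

end Population

/-! ### The gradient of the treatment effect in a general observation scheme -/

/-- An observation scheme: what is observed of a labelled unit, and the part of it whose
unconditional law is known. The observation includes the outcome, the known part the covariates
and the treatment. -/
structure ObservationScheme (𝒳 𝒮 O K : Type*) [MeasurableSpace 𝒳] [MeasurableSpace 𝒮]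
    [MeasurableSpace O] [MeasurableSpace K] where
  /-- the observation, as a function of `(X, T, S, Y)` -/
  view : 𝒳 × Bool × 𝒮 × ℝ → O
  /-- the part with known law -/
  part : O → K
  /-- covariates and treatment -/
  xt : K → 𝒳 × Bool
  /-- the outcome -/
  outcome : O → ℝ
  measurable_view : Measurable view
  measurable_part : Measurable part
  measurable_xt : Measurable xt
  measurable_outcome : Measurable outcome
  xt_part_view : ∀ o, xt (part (view o)) = (o.1, o.2.1)
  outcome_view : ∀ o, outcome (view o) = o.2.2.2

namespace ObservationScheme

attribute [fun_prop] measurable_view measurable_part measurable_xt measurable_outcome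

variable {𝒳 𝒮 O K : Type*} [MeasurableSpace 𝒳] [MeasurableSpace 𝒮] [MeasurableSpace O]
  [MeasurableSpace K] (D : ObservationScheme 𝒳 𝒮 O K)

/-- What is observed of a labelled unit. -/
def obs (w : FullData 𝒳 𝒮) : O := D.view (XTSY w)

/-- The variables whose unconditional law is known. -/
def known (w : FullData 𝒳 𝒮) : K := D.part (D.obs w)

@[fun_prop]
theorem measurable_obs : Measurable D.obs := D.measurable_view.comp measurable_XTSY

@[fun_prop]
theorem measurable_known : Measurable D.known := D.measurable_part.comp D.measurable_obs

theorem xt_known (w : FullData 𝒳 𝒮) : D.xt (D.known w) = XT w := D.xt_part_view (XTSY w)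

theorem outcome_obs (w : FullData 𝒳 𝒮) : D.outcome (D.obs w) = Y w := D.outcome_view (XTSY w)

theorem map_XT_of_map_known {μ ν : Measure (FullData 𝒳 𝒮)} (h : μ.map D.known = ν.map D.known) :
    μ.map XT = ν.map XT := by
  have e : (XT : FullData 𝒳 𝒮 → _) = D.xt ∘ D.known := funext fun w => (D.xt_known w).symm
  rw [e, ← Measure.map_map D.measurable_xt D.measurable_known, h,
    Measure.map_map D.measurable_xt D.measurable_known]

/-- `m` is a version of the conditional mean of the outcome given the known variables, on the
labelled data. -/
def IsCondMean (P : Population 𝒳 𝒮) (m : K → ℝ) : Prop :=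
  Measurable m ∧ (fun w => m (D.known w)) =ᵐ[P.labelled]
    P.labelled[Y | MeasurableSpace.comap D.known inferInstance]

/-- The inverse probability weighted residual of the outcome. -/
noncomputable def residual (ρ ε : ℝ) (P : Population 𝒳 𝒮) (m : K → ℝ) (o : O) : ℝ :=
  P.ipw ρ ε (D.xt (D.part o)) * (D.outcome o - m (D.part o))

/-- The weighted residual, reweighted to the unconditional law. -/
noncomputable def influence (ρ ε C : ℝ) (P : Population 𝒳 𝒮) (m : K → ℝ) (o : O) : ℝ :=
  P.lamClip ρ C (D.xt (D.part o)).1 * D.residual ρ ε P m o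

theorem residual_obs (ρ ε : ℝ) (P : Population 𝒳 𝒮) (m : K → ℝ) (w : FullData 𝒳 𝒮) :
    D.residual ρ ε P m (D.obs w) = P.ipw ρ ε (XT w) * (Y w - m (D.known w)) := by
  rw [residual, D.outcome_obs, ← D.xt_known]; rfl

theorem xt_part_obs_fst (w : FullData 𝒳 𝒮) : (D.xt (D.part (D.obs w))).1 = X w :=
  congrArg Prod.fst (D.xt_known w)

theorem measurable_residual (ρ ε : ℝ) (P : Population 𝒳 𝒮) {m : K → ℝ} (hm : Measurable m) :
    Measurable (D.residual ρ ε P m) := by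
  unfold residual; fun_prop

theorem measurable_influence (ρ ε C : ℝ) (P : Population 𝒳 𝒮) {m : K → ℝ} (hm : Measurable m) :
    Measurable (D.influence ρ ε C P m) := by
  have := D.measurable_residual ρ ε P hm
  unfold influence; fun_prop

variable {ρ ε C : ℝ} {P P' : Population 𝒳 𝒮} {m : K → ℝ}

section CondMean

variable {D}

theorem IsCondMean.memLp (hm : D.IsCondMean P m) (hY : MemLp Y 2 P.labelled) :
    MemLp (fun w => m (D.known w)) 2 P.labelled :=
  (memLp_congr_ae hm.2).2 (hY.condExp one_le_two)

/-- The residual of the outcome is orthogonal to bounded functions of the known variables. -/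
theorem IsCondMean.integral_mul_residual (hm : D.IsCondMean P m) (hY : MemLp Y 2 P.labelled)
    {φ : K → ℝ} (hφ : Measurable φ) {c : ℝ} (hc : ∀ k, |φ k| ≤ c) :
    ∫ w, φ (D.known w) * (Y w - m (D.known w)) ∂P.labelled = 0 := by
  have hYi := hY.integrable one_le_two
  have hmi := (hm.memLp hY).integrable one_le_two
  have hφm : AEStronglyMeasurable (fun w => φ (D.known w)) P.labelled :=
    (hφ.comp D.measurable_known).aestronglyMeasurable
  have h1 : Integrable (fun w => φ (D.known w) * Y w) P.labelled :=
    hYi.bdd_mul (c := c) hφm (ae_of_all _ fun w => hc _)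
  have h2 : Integrable (fun w => φ (D.known w) * m (D.known w)) P.labelled :=
    hmi.bdd_mul (c := c) hφm (ae_of_all _ fun w => hc _)
  have hpull := condExp_stronglyMeasurable_mul_of_bound (μ := P.labelled)
    D.measurable_known.comap_le (f := fun w => φ (D.known w)) (g := Y)
    (hφ.comp (comap_measurable D.known)).stronglyMeasurable hYi c (ae_of_all _ fun w => hc _)
  simp only [mul_sub]
  rw [integral_sub h1 h2, sub_eq_zero]
  calc ∫ w, φ (D.known w) * Y w ∂P.labelled
      = ∫ w, (P.labelled[(fun w => φ (D.known w)) * Y |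
          MeasurableSpace.comap D.known inferInstance]) w ∂P.labelled :=
        (integral_condExp D.measurable_known.comap_le).symm
    _ = _ := by
        refine integral_congr_ae ?_
        filter_upwards [hpull, hm.2] with w h3 h4
        rw [h3, Pi.mul_apply, h4]

end CondMean

variable [StandardBorelSpace 𝒳] [StandardBorelSpace 𝒮]

section Gradient

/-- The weights are bounded functions of X and T, hence of the known variables. The density ratio
may come from any population `P'`: this makes differentiating λ along a path unnecessary. -/
theorem integral_lamClip_mul_residual (hP : P.Admissible ρ ε C) (hρ₀ : 0 ≤ ρ) (hρ₁ : ρ < 1)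
    (hε : 0 < ε) (hm : D.IsCondMean P m) (P' : Population 𝒳 𝒮) :
    ∫ w, P'.lamClip ρ C (X w) * D.residual ρ ε P m (D.obs w) ∂P.labelled = 0 := by
  have hC := hP.C_nonneg hρ₀ hρ₁
  rw [← hm.integral_mul_residual hP.memLp_Y
    (φ := fun k => P'.lamClip ρ C (D.xt k).1 * P.ipw ρ ε (D.xt k)) (c := C * ε⁻¹) (by fun_prop)]
  · refine integral_congr_ae (ae_of_all _ fun w => ?_)
    simp only [D.residual_obs, D.xt_known, mul_assoc]
    rfl
  · intro k
    rw [abs_mul, abs_of_nonneg (Population.lamClip_nonneg ρ hC P' _)]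
    exact mul_le_mul (Population.lamClip_le ρ C P' _) (Population.abs_ipw_le ρ hε P _)
      (abs_nonneg _) hC

theorem e_eq_of_mem_model (h : P' ∈ Population.model ρ ε C D.known P) : P'.e ρ = P.e ρ :=
  Population.e_congr (D.map_XT_of_map_known h.2)

theorem mem_model_self (hP : P.Admissible ρ ε C) : P ∈ Population.model ρ ε C D.known P :=
  ⟨hP, rfl⟩

variable [Nonempty 𝒮]

theorem memLp_known_law (hP : P.Admissible ρ ε C) (hρ₀ : 0 ≤ ρ) (hρ₁ : ρ < 1)
    (hm : D.IsCondMean P m) : MemLp (fun w => m (D.known w)) 2 (P.law ρ) := by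
  have hmm := hm.1
  exact hP.memLp_law hρ₀ hρ₁ (G := fun o => m (D.part (D.view o))) (by fun_prop)
    (hm.memLp hP.memLp_Y)

/-- On the model, the average treatment effect differs from its value at `P` by the reweighted
mean of the residual. -/
theorem ate_sub_ate (hP : P.Admissible ρ ε C) (hρ₀ : 0 ≤ ρ) (hρ₁ : ρ < 1) (hε : 0 < ε)
    (hm : D.IsCondMean P m) (h : P' ∈ Population.model ρ ε C D.known P) :
    P'.ate ρ - P.ate ρ
      = ∫ w, P'.lamClip ρ C (X w) * D.residual ρ ε P m (D.obs w) ∂P'.labelled := by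
  have hmm := hm.1
  have hlaw := Population.isProbabilityMeasure_law hρ₀ hρ₁ P
  have hlaw' := Population.isProbabilityMeasure_law hρ₀ hρ₁ P'
  have hknown : MemLp (fun w => m (D.known w)) 2 (P.law ρ) :=
    D.memLp_known_law hP hρ₀ hρ₁ hm
  have hknown' : MemLp (fun w => m (D.known w)) 2 (P'.law ρ) := by
    rw [show (fun w => m (D.known w)) = m ∘ D.known from rfl,
      ← memLp_map_measure_iff hmm.aestronglyMeasurable D.measurable_known.aemeasurable] at hknown ⊢
    rwa [h.2]
  have hw : Measurable fun w : FullData 𝒳 𝒮 => P.ipw ρ ε (XT w) := by fun_prop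
  have hi : ∀ (μ : Measure (FullData 𝒳 𝒮)) (f : FullData 𝒳 𝒮 → ℝ), [IsFiniteMeasure μ] →
      MemLp f 2 μ → Integrable (fun w => P.ipw ρ ε (XT w) * f w) μ := fun μ f _ hf =>
    (hf.integrable one_le_two).bdd_mul (c := ε⁻¹) hw.aestronglyMeasurable
      (ae_of_all _ fun w => Population.abs_ipw_le ρ hε P _)
  have split : ∀ Q : Population 𝒳 𝒮, Q.Admissible ρ ε C → IsFiniteMeasure (Q.law ρ) →
      MemLp (fun w => m (D.known w)) 2 (Q.law ρ) →
      ∫ w, P.ipw ρ ε (XT w) * Y w ∂(Q.law ρ) =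
        ∫ w, Q.lamClip ρ C (X w) * D.residual ρ ε P m (D.obs w) ∂Q.labelled
          + ∫ w, P.ipw ρ ε (XT w) * m (D.known w) ∂(Q.law ρ) := by
    intro Q hQ _ hQm
    have hres := D.measurable_residual ρ ε P hmm
    have h1 := hQ.integral_law hρ₀ hρ₁ (G := fun o => D.residual ρ ε P m (D.view o)) (by fun_prop)
    have h2 : ∫ w, D.residual ρ ε P m (D.obs w) ∂(Q.law ρ)
        = ∫ w, P.ipw ρ ε (XT w) * Y w ∂(Q.law ρ)
          - ∫ w, P.ipw ρ ε (XT w) * m (D.known w) ∂(Q.law ρ) := by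
      rw [← integral_sub (hi _ _ (hQ.memLp_Y_law hρ₀ hρ₁)) (hi _ _ hQm)]
      simp only [D.residual_obs, mul_sub]
    have h3 : ∫ w, D.residual ρ ε P m (D.obs w) ∂(Q.law ρ)
        = ∫ w, Q.lamClip ρ C (X w) * D.residual ρ ε P m (D.obs w) ∂Q.labelled := h1
    linarith
  -- The integrand is a function of the known variables, whose law is the same throughout the model.
  have hconst : ∫ w, P.ipw ρ ε (XT w) * m (D.known w) ∂(P'.law ρ)
      = ∫ w, P.ipw ρ ε (XT w) * m (D.known w) ∂(P.law ρ) := by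
    have hG : Measurable fun k => P.ipw ρ ε (D.xt k) * m k := by fun_prop
    simp only [← D.xt_known]
    rw [← integral_map (f := fun k => P.ipw ρ ε (D.xt k) * m k) D.measurable_known.aemeasurable
      hG.aestronglyMeasurable, h.2, integral_map (f := fun k => P.ipw ρ ε (D.xt k) * m k)
      D.measurable_known.aemeasurable hG.aestronglyMeasurable]
  rw [h.1.ate_eq hρ₀ hρ₁ hε, hP.ate_eq hρ₀ hρ₁ hε, Population.ipw_congr (D.e_eq_of_mem_model h),
    split P' h.1 inferInstance hknown', split P hP inferInstance hknown, hconst,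
    D.integral_lamClip_mul_residual hP hρ₀ hρ₁ hε hm P]
  ring

/-- A bound on the second moment of the reweighted residual that is uniform on the model as long
as the second moment of the outcome stays bounded. -/
theorem lintegral_sq_lamClip_mul_residual_le (hP : P.Admissible ρ ε C) (hρ₀ : 0 ≤ ρ) (hρ₁ : ρ < 1)
    (hε : 0 < ε) (hmm : Measurable m) (h : P' ∈ Population.model ρ ε C D.known P) :
    ∫⁻ w, ‖P'.lamClip ρ C (X w) * D.residual ρ ε P m (D.obs w)‖ₑ ^ 2 ∂P'.labelled
      ≤ ENNReal.ofReal C * (ENNReal.ofReal (ε⁻¹ ^ 2 * 2) *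
        (ENNReal.ofReal C * ∫⁻ w, ‖Y w‖ₑ ^ 2 ∂P'.labelled
          + ∫⁻ w, ‖m (D.known w)‖ₑ ^ 2 ∂(P.law ρ))) := by
  have hC := hP.C_nonneg hρ₀ hρ₁
  have hres := D.measurable_residual ρ ε P hmm
  -- In λ² one factor is bounded by C; the other turns the labelled law of `P'` into its
  -- unconditional law, where the contribution of m depends only on the known law.
  have h1 : ∀ w, ‖P'.lamClip ρ C (X w) * D.residual ρ ε P m (D.obs w)‖ₑ ^ 2
      ≤ ENNReal.ofReal C * (ENNReal.ofReal (P'.lamClip ρ C (X w))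
        * ‖D.residual ρ ε P m (D.view (XTSY w))‖ₑ ^ 2) := fun w => by
    have hl := Population.lamClip_nonneg ρ hC P' (X w)
    rw [enorm_mul, mul_pow, Real.enorm_eq_ofReal hl, sq, mul_assoc]
    gcongr
    · exact Population.lamClip_le ρ C P' _
    · rfl
  have h2 : ∀ w, ‖D.residual ρ ε P m (D.view (XTSY w))‖ₑ ^ 2
      ≤ ENNReal.ofReal (ε⁻¹ ^ 2 * 2) * (‖Y w‖ₑ ^ 2 + ‖m (D.known w)‖ₑ ^ 2) := fun w => by
    have e : ∀ r : ℝ, ‖r‖ₑ ^ 2 = ENNReal.ofReal (r ^ 2) := fun r => by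
      rw [← Real.enorm_eq_ofReal (sq_nonneg r), enorm_pow]
    have := D.residual_obs ρ ε P m w
    rw [obs] at this
    rw [this, e, e, e, ← ENNReal.ofReal_add (sq_nonneg _) (sq_nonneg _),
      ← ENNReal.ofReal_mul (by positivity)]
    refine ENNReal.ofReal_le_ofReal ?_
    have hw := abs_le.1 (Population.abs_ipw_le ρ hε P (XT w))
    have hw2 : P.ipw ρ ε (XT w) ^ 2 ≤ ε⁻¹ ^ 2 := sq_le_sq' hw.1 hw.2
    rw [mul_pow, mul_assoc]
    refine mul_le_mul hw2 ?_ (sq_nonneg _) (sq_nonneg _)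
    nlinarith [sq_nonneg (Y w + m (D.known w))]
  calc ∫⁻ w, ‖P'.lamClip ρ C (X w) * D.residual ρ ε P m (D.obs w)‖ₑ ^ 2 ∂P'.labelled
      ≤ ∫⁻ w, ENNReal.ofReal C * (ENNReal.ofReal (P'.lamClip ρ C (X w))
        * ‖D.residual ρ ε P m (D.view (XTSY w))‖ₑ ^ 2) ∂P'.labelled := lintegral_mono h1
    _ = ENNReal.ofReal C * ∫⁻ w, ‖D.residual ρ ε P m (D.view (XTSY w))‖ₑ ^ 2 ∂(P'.law ρ) := by
        rw [lintegral_const_mul _ (by fun_prop),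
          h.1.lintegral_law hρ₀ hρ₁ (G := fun o => ‖D.residual ρ ε P m (D.view o)‖ₑ ^ 2)
            (by fun_prop)]
    _ ≤ ENNReal.ofReal C * (ENNReal.ofReal (ε⁻¹ ^ 2 * 2) *
        (∫⁻ w, ‖Y w‖ₑ ^ 2 ∂(P'.law ρ) + ∫⁻ w, ‖m (D.known w)‖ₑ ^ 2 ∂(P'.law ρ))) := by
        gcongr
        rw [← lintegral_add_left (by fun_prop), ← lintegral_const_mul _ (by fun_prop)]
        exact lintegral_mono h2
    _ ≤ _ := by
        have h3 : ∫⁻ w, ‖m (D.known w)‖ₑ ^ 2 ∂(P'.law ρ)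
            = ∫⁻ w, ‖m (D.known w)‖ₑ ^ 2 ∂(P.law ρ) :=
          (Measure.map_eq_map_iff D.measurable_known).1 h.2 (fun k => ‖m k‖ₑ ^ 2) (by fun_prop)
        have h4 : ∫⁻ w, ‖Y w‖ₑ ^ 2 ∂(P'.law ρ) ≤ _ :=
          h.1.lintegral_law_le hρ₀ hρ₁ (G := fun o => ‖o.2.2.2‖ₑ ^ 2) (by fun_prop)
        rw [h3]
        gcongr
        exact h4

theorem memLp_influence (hP : P.Admissible ρ ε C) (hρ₀ : 0 ≤ ρ) (hρ₁ : ρ < 1) (hε : 0 < ε)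
    (hm : D.IsCondMean P m) : MemLp (D.influence ρ ε C P m) 2 (obsLaw D.obs P) := by
  have hmeas := D.measurable_influence ρ ε C P hm.1
  rw [obsLaw, memLp_map_measure_iff hmeas.aestronglyMeasurable D.measurable_obs.aemeasurable,
    memLp_two_iff_lintegral]
  refine ⟨(hmeas.comp D.measurable_obs).aestronglyMeasurable, ?_⟩
  have := D.lintegral_sq_lamClip_mul_residual_le hP hρ₀ hρ₁ hε hm.1 (D.mem_model_self hP)
  simp only [Function.comp_apply, influence, D.xt_part_obs_fst]
  refine this.trans_lt (ENNReal.mul_lt_top ENNReal.ofReal_lt_top (ENNReal.mul_lt_top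
    ENNReal.ofReal_lt_top (ENNReal.add_lt_top.2 ⟨ENNReal.mul_lt_top ENNReal.ofReal_lt_top ?_, ?_⟩)))
  · exact (memLp_two_iff_lintegral.1 hP.memLp_Y).2
  · exact (memLp_two_iff_lintegral.1 (D.memLp_known_law hP hρ₀ hρ₁ hm)).2

/-- `hasDerivAt_of_dqm` applies with the density ratios along the path as weights and the residual
at `P` as integrand. Constancy of the law of X comes from the known law, the uniform L² bound from
the moment condition on the submodel. -/
theorem hasDerivAt_ate (hP : P.Admissible ρ ε C) (hρ₀ : 0 ≤ ρ) (hρ₁ : ρ < 1) (hε : 0 < ε)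
    (hm : D.IsCondMean P m) {path : ℝ → Population 𝒳 𝒮} {g : O → ℝ}
    (h : IsRegularSubmodel (Population.model ρ ε C D.known P) D.obs P path g) :
    HasDerivAt (fun t => (path t).ate ρ)
      (∫ o, D.influence ρ ε C P m o * g o ∂(obsLaw D.obs P)) 0 := by
  have hC := hP.C_nonneg hρ₀ hρ₁
  have hmm := hm.1
  have hres := D.measurable_residual ρ ε P hmm
  have hprob : ∀ t, IsProbabilityMeasure (obsLaw D.obs (path t)) := fun t =>
    Measure.isProbabilityMeasure_map D.measurable_obs.aemeasurable
  obtain ⟨B, hB⟩ := h.moment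
  have hx : Measurable fun o => (D.xt (D.part o)).1 := by fun_prop
  have hint : ∀ Q Q' : Population 𝒳 𝒮, ∫ o, Q.lamClip ρ C (D.xt (D.part o)).1 *
      D.residual ρ ε P m o ∂(obsLaw D.obs Q')
      = ∫ w, Q.lamClip ρ C (X w) * D.residual ρ ε P m (D.obs w) ∂Q'.labelled := fun Q Q' => by
    have hG : Measurable fun o => Q.lamClip ρ C (D.xt (D.part o)).1 * D.residual ρ ε P m o := by
      fun_prop
    rw [obsLaw, integral_map D.measurable_obs.aemeasurable hG.aestronglyMeasurable]
    simp only [D.xt_part_obs_fst]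
  have hresP : MemLp (D.residual ρ ε P m) 2 (obsLaw D.obs P) := by
    rw [obsLaw, memLp_map_measure_iff hres.aestronglyMeasurable D.measurable_obs.aemeasurable]
    have : MemLp (fun w => P.ipw ρ ε (XT w) * (Y w - m (D.known w))) 2 P.labelled := by
      refine (hP.memLp_Y.sub (hm.memLp hP.memLp_Y)).of_le_mul (c := ε⁻¹)
        (by fun_prop) (ae_of_all _ fun w => ?_)
      rw [norm_mul]
      exact mul_le_mul_of_nonneg_right (Population.abs_ipw_le ρ hε P _) (norm_nonneg _)
    exact this.congr_norm (hres.comp D.measurable_obs).aestronglyMeasurable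
      (ae_of_all _ fun w => by rw [Function.comp_apply, D.residual_obs])
  set W := ENNReal.ofReal C * (ENNReal.ofReal (ε⁻¹ ^ 2 * 2) *
        (ENNReal.ofReal C * B + ∫⁻ w, ‖m (D.known w)‖ₑ ^ 2 ∂(P.law ρ))) with hW
  have hWtop : W < ∞ := ENNReal.mul_lt_top ENNReal.ofReal_lt_top (ENNReal.mul_lt_top
    ENNReal.ofReal_lt_top (ENNReal.add_lt_top.2 ⟨ENNReal.mul_lt_top ENNReal.ofReal_lt_top
      ENNReal.coe_lt_top, (memLp_two_iff_lintegral.1 (D.memLp_known_law hP hρ₀ hρ₁ hm)).2⟩))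
  have hlawX : ∀ R : Population 𝒳 𝒮, R.Admissible ρ ε C →
      ((obsLaw D.obs R).withDensity fun o =>
        ENNReal.ofReal (R.lamClip ρ C (D.xt (D.part o)).1)).map (fun o => (D.xt (D.part o)).1)
      = (R.law ρ).map X := fun R hR => by
    rw [hR.map_X_law hρ₀ hρ₁, Measure.map_withDensity_comp hx
      (l := fun x => ENNReal.ofReal (R.lamClip ρ C x)) (by fun_prop), obsLaw,
      Measure.map_map hx D.measurable_obs, Population.reweighted,
      Measure.map_withDensity_comp measurable_X
        (l := fun x => ENNReal.ofReal (R.lamClip ρ C x)) (by fun_prop)]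
    congr 2
    exact funext fun w => D.xt_part_obs_fst w
  have key := hasDerivAt_of_dqm (Q := fun t => obsLaw D.obs (path t)) hx
    (lam := fun t => (path t).lamClip ρ C) (fun t => by fun_prop) hC
    (fun t => Population.lamClip_nonneg ρ hC (path t)) (fun t => Population.lamClip_le ρ C (path t))
    (g := g) (h := D.residual ρ ε P m) (by simpa only [h.path_zero] using h.memLp_score)
    (by simpa only [h.path_zero] using h.dqm) hres (by simpa only [h.path_zero] using hresP)
    (θ := fun t => (path t).ate ρ) (B := W.toReal) ?_ ?_ ?_ ?_
  · simpa only [h.path_zero] using! key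
  · filter_upwards [h.mem_model] with t ht
    simp only [h.path_zero]
    rw [hlawX _ ht.1, hlawX _ hP]
    exact Population.map_X_of_map_XT (D.map_XT_of_map_known ht.2)
  · filter_upwards [h.mem_model, hB] with t ht hBt
    have hG : Measurable fun o => (path t).lamClip ρ C (D.xt (D.part o)).1
        * D.residual ρ ε P m o := by fun_prop
    have hle : ∫⁻ o, ‖(path t).lamClip ρ C (D.xt (D.part o)).1 * D.residual ρ ε P m o‖ₑ ^ 2
        ∂(obsLaw D.obs (path t)) ≤ W := by
      rw [obsLaw, lintegral_map (by fun_prop) D.measurable_obs]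
      simp only [D.xt_part_obs_fst]
      refine (D.lintegral_sq_lamClip_mul_residual_le hP hρ₀ hρ₁ hε hmm ht).trans ?_
      rw [hW]
      gcongr
    have hmem := memLp_two_iff_lintegral.2 ⟨hG.aestronglyMeasurable, hle.trans_lt hWtop⟩
    refine ⟨hmem, ?_⟩
    rw [← ENNReal.ofReal_le_iff_le_toReal hWtop.ne, hmem.ofReal_integral_sq]
    exact hle
  · filter_upwards [h.mem_model] with t ht
    rw [hint, h.path_zero, D.ate_sub_ate hP hρ₀ hρ₁ hε hm ht]
  · filter_upwards with t
    simp only [h.path_zero]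
    rw [hint, D.integral_lamClip_mul_residual hP hρ₀ hρ₁ hε hm]

end Gradient

end ObservationScheme

/-! ### Scores and the tangent space of an observation scheme -/

theorem MeasureTheory.Measure.map_withDensity_of_condExp_eq_zero {Ω K : Type*} [MeasurableSpace Ω]
    [MeasurableSpace K] {μ : Measure Ω} [IsProbabilityMeasure μ] {k : Ω → K} (hk : Measurable k)
    {f : Ω → ℝ} (hf : Integrable f μ) (h0 : ∀ w, 0 ≤ 1 + f w)
    (hz : μ[f | MeasurableSpace.comap k inferInstance] =ᵐ[μ] 0) :
    (μ.withDensity fun w => ENNReal.ofReal (1 + f w)).map k = μ.map k := by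
  ext s hs
  rw [Measure.map_apply hk hs, Measure.map_apply hk hs, withDensity_apply _ (hk hs)]
  have hi : Integrable (fun w => 1 + f w) μ := (integrable_const 1).add hf
  have hs' : MeasurableSet[MeasurableSpace.comap k inferInstance] (k ⁻¹' s) := ⟨s, hs, rfl⟩
  -- Conditional mean zero makes `f` integrate to zero over every event determined by `k`, so the
  -- tilt adds no mass there.
  have hzero : ∫ w in k ⁻¹' s, f w ∂μ = 0 := by
    rw [← setIntegral_condExp hk.comap_le hf hs',
      setIntegral_congr_ae (g := fun _ => (0 : ℝ)) (hk hs)]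
    · simp
    · filter_upwards [hz] with w hw _
      exact hw
  rw [← ofReal_integral_eq_lintegral_ofReal hi.integrableOn (ae_of_all _ h0),
    integral_add (integrable_const 1).integrableOn hf.integrableOn, hzero, add_zero]
  simp [measureReal_def]

namespace ObservationScheme

variable {𝒳 𝒮 O K : Type*} [MeasurableSpace 𝒳] [MeasurableSpace 𝒮] [MeasurableSpace O]
  [MeasurableSpace K] (D : ObservationScheme 𝒳 𝒮 O K) {ρ ε C : ℝ} {P P' : Population 𝒳 𝒮}
  {m : K → ℝ}

theorem comap_XT_le : MeasurableSpace.comap (XT : FullData 𝒳 𝒮 → 𝒳 × Bool) inferInstance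
    ≤ MeasurableSpace.comap D.known inferInstance := by
  have e : (XT : FullData 𝒳 𝒮 → _) = D.xt ∘ D.known := funext fun w => (D.xt_known w).symm
  rw [e, ← MeasurableSpace.comap_comp]
  exact MeasurableSpace.comap_mono D.measurable_xt.comap_le

/-- Tower property: tilting the kernel given (X, T) needs only this weaker centering. The stronger
one is what preserves the law of the known variables. -/
theorem condExp_XT_eq_zero {f : FullData 𝒳 𝒮 → ℝ}
    (hz : P.labelled[f | MeasurableSpace.comap D.known inferInstance] =ᵐ[P.labelled] 0) :
    P.labelled[f | MeasurableSpace.comap XT inferInstance] =ᵐ[P.labelled] 0 := by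
  have h1 := condExp_condExp_of_le (μ := P.labelled) (f := f) D.comap_XT_le
    D.measurable_known.comap_le
  have h2 := condExp_congr_ae (m := MeasurableSpace.comap XT inferInstance) hz
  rw [condExp_zero] at h2
  exact h1.symm.trans h2

variable [StandardBorelSpace 𝒳] [StandardBorelSpace 𝒮]

/-- The bounded weights are functions of the known variables and factor out; what is left is the
conditional mean of Y - m, which is zero. -/
theorem condExp_influence (hP : P.Admissible ρ ε C) (hρ₀ : 0 ≤ ρ) (hρ₁ : ρ < 1) (hε : 0 < ε)
    (hm : D.IsCondMean P m) :
    P.labelled[fun w => D.influence ρ ε C P m (D.obs w) |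
      MeasurableSpace.comap D.known inferInstance] =ᵐ[P.labelled] 0 := by
  have hC := hP.C_nonneg hρ₀ hρ₁
  have hmi := (hm.memLp hP.memLp_Y).integrable one_le_two
  have hYi := hP.memLp_Y.integrable one_le_two
  set φ : K → ℝ := fun k => P.lamClip ρ C (D.xt k).1 * P.ipw ρ ε (D.xt k) with hφ
  have hφm : Measurable φ := by fun_prop
  have hmm := hm.1
  have hpull := condExp_stronglyMeasurable_mul_of_bound (μ := P.labelled)
    D.measurable_known.comap_le (f := fun w => φ (D.known w)) (g := Y - fun w => m (D.known w))
    (hφm.comp (comap_measurable D.known)).stronglyMeasurable (hYi.sub hmi) (C * ε⁻¹)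
    (ae_of_all _ fun w => by
      rw [Real.norm_eq_abs, abs_mul, abs_of_nonneg (Population.lamClip_nonneg ρ hC P _)]
      exact mul_le_mul (Population.lamClip_le ρ C P _) (Population.abs_ipw_le ρ hε P _)
        (abs_nonneg _) hC)
  have e : (fun w => D.influence ρ ε C P m (D.obs w))
      = (fun w => φ (D.known w)) * (Y - fun w => m (D.known w)) := by
    funext w
    simp only [influence, D.residual_obs, D.xt_part_obs_fst, Pi.mul_apply, Pi.sub_apply, hφ,
      D.xt_known, mul_assoc]
    rfl
  have hsub := condExp_sub hYi hmi (MeasurableSpace.comap D.known inferInstance)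
  rw [condExp_of_stronglyMeasurable D.measurable_known.comap_le (f := fun w => m (D.known w))
      (hmm.comp (comap_measurable D.known)).stronglyMeasurable hmi] at hsub
  rw [e]
  filter_upwards [hpull, hsub, hm.2] with w h1 h2 h3
  rw [h1, Pi.mul_apply, h2, Pi.sub_apply, ← h3]
  simp

variable [Nonempty 𝒮]

/-- Populations in the model whose observed law has a prescribed bounded density. -/
theorem exists_mem_model (hP : P.Admissible ρ ε C) (hρ₀ : 0 ≤ ρ) (hρ₁ : ρ < 1)
    {h : O → ℝ} (hh : Measurable h) {M : ℝ} (hM : ∀ o, |h o| ≤ M)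
    (hz : P.labelled[fun w => h (D.obs w) | MeasurableSpace.comap D.known inferInstance]
      =ᵐ[P.labelled] 0) {t : ℝ} (ht : |t| * M ≤ 1 / 2) :
    ∃ P' ∈ Population.model ρ ε C D.known P,
      obsLaw D.obs P' = (obsLaw D.obs P).withDensity (fun o => ENNReal.ofReal (1 + t * h o)) ∧
      ∫⁻ w, ‖Y w‖ₑ ^ 2 ∂P'.labelled ≤ 2 * ∫⁻ w, ‖Y w‖ₑ ^ 2 ∂P.labelled := by
  obtain ⟨P', hP', hXT, hX, hlab⟩ := Population.exists_perturbation hP hρ₀ hρ₁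
    (h := fun o => h (D.view o)) (by fun_prop) (fun o => hM _) (D.condExp_XT_eq_zero hz) ht
  have hb : ∀ o, |t * h o| ≤ 1 / 2 := fun o => by
    rw [abs_mul]
    exact (mul_le_mul_of_nonneg_left (hM o) (abs_nonneg t)).trans ht
  have hlab' : P'.labelled.map XTSY
      = (P.labelled.withDensity fun w => ENNReal.ofReal (1 + t * h (D.obs w))).map XTSY := by
    rw [hlab]
    exact (Measure.map_withDensity_comp measurable_XTSY
      (l := fun o => ENNReal.ofReal (1 + t * h (D.view o))) (by fun_prop)).symm
  have hknown : P'.labelled.map D.known = P.labelled.map D.known := by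
    have e : D.known = (fun o => D.part (D.view o)) ∘ XTSY := rfl
    have hi : Integrable (fun w => t * h (D.obs w)) P.labelled :=
      Integrable.of_bound ((hh.comp D.measurable_obs).const_mul t).aestronglyMeasurable (1 / 2)
        (ae_of_all _ fun w => hb _)
    have hz' : P.labelled[fun w => t * h (D.obs w) | MeasurableSpace.comap D.known inferInstance]
        =ᵐ[P.labelled] 0 := by
      refine (condExp_smul t (fun w => h (D.obs w)) _).trans ?_
      filter_upwards [hz] with w hw
      simp [hw]
    rw [← Measure.map_withDensity_of_condExp_eq_zero D.measurable_known hi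
      (fun w => by linarith [(abs_le.1 (hb (D.obs w))).1]) hz', e,
      ← Measure.map_map (by fun_prop) measurable_XTSY, hlab',
      Measure.map_map (by fun_prop) measurable_XTSY]
  -- Neither law of X has moved, so the density ratio is the same. The unconditional law of the
  -- known variables is then the unchanged labelled one under the same weight.
  have hlam : P'.lamClip ρ C = P.lamClip ρ C := by
    funext x
    rw [Population.lamClip, Population.lamClip,
      Population.lam_congr (Population.map_X_of_map_XT hXT) hX]
  refine ⟨P', ⟨hP', ?_⟩, ?_, ?_⟩
  · rw [Measure.map_eq_map_iff D.measurable_known]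
    intro G hG
    have h1 := hP'.lintegral_law hρ₀ hρ₁ (G := fun o => G (D.part (D.view o))) (by fun_prop)
    have h2 := hP.lintegral_law hρ₀ hρ₁ (G := fun o => G (D.part (D.view o))) (by fun_prop)
    have h3 := (Measure.map_eq_map_iff D.measurable_known).1 hknown
      (fun k => ENNReal.ofReal (P.lamClip ρ C (D.xt k).1) * G k) (by fun_prop)
    simp only [D.xt_known] at h3
    rw [hlam] at h1
    exact h1.trans (h3.trans h2.symm)
  · have e : D.obs = D.view ∘ XTSY := rfl
    have e2 := Measure.map_withDensity_comp (μ := P.labelled) D.measurable_obs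
      (l := fun o => ENNReal.ofReal (1 + t * h o)) (by fun_prop)
    rw [obsLaw, obsLaw, ← e2, e, ← Measure.map_map D.measurable_view measurable_XTSY, hlab',
      Measure.map_map D.measurable_view measurable_XTSY]
    rfl
  · have h1 := (Measure.map_eq_map_iff measurable_XTSY).1 hlab' (fun o => ‖o.2.2.2‖ₑ ^ 2)
      (by fun_prop)
    calc ∫⁻ w, ‖Y w‖ₑ ^ 2 ∂P'.labelled
        = ∫⁻ w, ENNReal.ofReal (1 + t * h (D.obs w)) * ‖Y w‖ₑ ^ 2 ∂P.labelled := by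
          refine h1.trans ?_
          rw [lintegral_withDensity_eq_lintegral_mul _ (by fun_prop) (by fun_prop)]
          rfl
      _ ≤ ∫⁻ w, 2 * ‖Y w‖ₑ ^ 2 ∂P.labelled := by
          gcongr with w
          rw [← ENNReal.ofReal_ofNat]
          exact ENNReal.ofReal_le_ofReal (by linarith [(abs_le.1 (hb (D.obs w))).2])
      _ = _ := lintegral_const_mul _ (by fun_prop)

/-- Every bounded function of the observation whose conditional mean given the known variables
vanishes is the score of a regular submodel. -/
theorem exists_isRegularSubmodel (hP : P.Admissible ρ ε C) (hρ₀ : 0 ≤ ρ) (hρ₁ : ρ < 1)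
    {h : O → ℝ} (hh : Measurable h) {M : ℝ} (hM : ∀ o, |h o| ≤ M)
    (hz : P.labelled[fun w => h (D.obs w) | MeasurableSpace.comap D.known inferInstance]
      =ᵐ[P.labelled] 0) :
    ∃ path, IsRegularSubmodel (Population.model ρ ε C D.known P) D.obs P path h := by
  have hex : ∀ t : ℝ, ∃ P' : Population 𝒳 𝒮, (t = 0 → P' = P) ∧ (|t| * M ≤ 1 / 2 →
      P' ∈ Population.model ρ ε C D.known P ∧
      obsLaw D.obs P' = (obsLaw D.obs P).withDensity (fun o => ENNReal.ofReal (1 + t * h o)) ∧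
      ∫⁻ w, ‖Y w‖ₑ ^ 2 ∂P'.labelled ≤ 2 * ∫⁻ w, ‖Y w‖ₑ ^ 2 ∂P.labelled) := by
    intro t
    -- At t = 0 the construction could return a population with another coupling of the arms, so `P`
    -- is inserted by hand. This is harmless, as regularity looks only at observed laws; for large t
    -- the value is irrelevant.
    by_cases h0 : t = 0
    · refine ⟨P, fun _ => rfl, fun _ => ⟨D.mem_model_self hP, ?_, ?_⟩⟩
      · simp [h0]
      · exact le_mul_of_one_le_left' one_le_two
    · by_cases ht : |t| * M ≤ 1 / 2
      · obtain ⟨P', h1, h2⟩ := D.exists_mem_model hP hρ₀ hρ₁ hh hM hz ht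
        exact ⟨P', fun h => absurd h h0, fun _ => ⟨h1, h2⟩⟩
      · exact ⟨P, fun h => absurd h h0, fun h => absurd h ht⟩
  choose path hpath0 hpath using hex
  have hprob : ∀ Q : Population 𝒳 𝒮, IsProbabilityMeasure (obsLaw D.obs Q) := fun Q =>
    Measure.isProbabilityMeasure_map D.measurable_obs.aemeasurable
  have hev : ∀ᶠ t : ℝ in 𝓝 0, |t| * M ≤ 1 / 2 := by
    have : Tendsto (fun t : ℝ => |t| * M) (𝓝 0) (𝓝 0) := by
      simpa using (continuous_abs.tendsto (0 : ℝ)).mul_const M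
    filter_upwards [this.eventually (gt_mem_nhds (by norm_num : (0 : ℝ) < 1 / 2))] with t ht
    exact ht.le
  refine ⟨path, hpath0 0 rfl, hev.mono fun t ht => (hpath t ht).1,
    MemLp.of_bound hh.aestronglyMeasurable M (ae_of_all _ hM),
    tendsto_dqmRemainder_withDensity hh hM (hev.mono fun t ht => (hpath t ht).2.1),
    (2 * ∫⁻ w, ‖Y w‖ₑ ^ 2 ∂P.labelled).toNNReal, hev.mono fun t ht => ?_⟩
  rw [ENNReal.coe_toNNReal]
  · exact (hpath t ht).2.2
  · exact ENNReal.mul_ne_top (by norm_num) (memLp_two_iff_lintegral.1 hP.memLp_Y).2.ne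

/-- Square-integrable functions whose conditional mean given the known variables vanishes are limits
of scores. -/
theorem toLp_mem_closure_tangentSet (hP : P.Admissible ρ ε C) (hρ₀ : 0 ≤ ρ) (hρ₁ : ρ < 1)
    {ψ : O → ℝ} (hψ : MemLp ψ 2 (obsLaw D.obs P))
    (hz : P.labelled[fun w => ψ (D.obs w) | MeasurableSpace.comap D.known inferInstance]
      =ᵐ[P.labelled] 0) :
    hψ.toLp ψ ∈ closure (tangentSet (Population.model ρ ε C D.known P) D.obs P) := by
  rw [EMetric.mem_closure_iff]
  intro δ hδ
  -- Half of δ, because centering the approximation below can double the error.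
  obtain ⟨g, hg, -⟩ := hψ.exists_simpleFunc_eLpNorm_sub_lt (by norm_num)
    (ENNReal.half_pos hδ.ne').ne'
  obtain ⟨M, hM⟩ := g.exists_forall_norm_le
  have hM' : ∀ o, |g o| ≤ M := hM
  have hgm : Measurable g := g.measurable
  set G : FullData 𝒳 𝒮 → ℝ := fun w => g (D.obs w) with hG
  set Ψ : FullData 𝒳 𝒮 → ℝ := fun w => ψ (D.obs w) with hΨ
  obtain ⟨w₀⟩ : Nonempty (FullData 𝒳 𝒮) := nonempty_of_isProbabilityMeasure P.labelled
  obtain ⟨c₀, hc₀m, hc₀⟩ := (stronglyMeasurable_condExp (μ := P.labelled) (f := G)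
    (m := MeasurableSpace.comap D.known inferInstance)).exists_eq_measurable_comp
  -- A version of the conditional mean of g that is a function of the known variables and is bounded
  -- everywhere, so that g - c is an admissible bounded score.
  set c : K → ℝ := fun k => max (-M) (min (c₀ k) M) with hc
  have hcm : Measurable c := by
    have := hc₀m.measurable
    fun_prop
  have hcM : ∀ k, |c k| ≤ M := fun k =>
    abs_le.2 ⟨le_max_left _ _, max_le (by linarith [(abs_nonneg _).trans (hM' (D.obs w₀))])
      (min_le_right _ _)⟩
  have hGi : Integrable G P.labelled :=
    Integrable.of_bound (hgm.comp D.measurable_obs).aestronglyMeasurable M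
      (ae_of_all _ fun w => hM _)
  have hcE : (fun w => c (D.known w)) =ᵐ[P.labelled]
      P.labelled[G | MeasurableSpace.comap D.known inferInstance] := by
    have := ae_bdd_abs_condExp_of_ae_bdd_abs (μ := P.labelled)
      (m := MeasurableSpace.comap D.known inferInstance) (f := G) (R := M)
      (ae_of_all _ fun w => hM' _)
    filter_upwards [this] with w hw
    have hw' := abs_le.1 hw
    have e := congrFun hc₀ w
    simp only [Function.comp_apply] at e
    simp only [hc]
    rw [← e, min_eq_left hw'.2, max_eq_right hw'.1]
  set h : O → ℝ := fun o => g o - c (D.part o) with hh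
  have hhm : Measurable h := by fun_prop
  have hhM : ∀ o, |h o| ≤ M + M := fun o =>
    (abs_sub _ _).trans (add_le_add (hM' o) (hcM _))
  have hci : Integrable (fun w => c (D.known w)) P.labelled :=
    Integrable.of_bound (hcm.comp D.measurable_known).aestronglyMeasurable M
      (ae_of_all _ fun w => hcM _)
  have hhz : P.labelled[fun w => h (D.obs w) | MeasurableSpace.comap D.known inferInstance]
      =ᵐ[P.labelled] 0 := by
    refine (condExp_sub hGi hci _).trans ?_
    rw [condExp_of_stronglyMeasurable D.measurable_known.comap_le (f := fun w => c (D.known w))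
      (hcm.comp (comap_measurable D.known)).stronglyMeasurable hci]
    filter_upwards [hcE] with w hw
    simp [hw]
  obtain ⟨path, hpath⟩ := D.exists_isRegularSubmodel hP hρ₀ hρ₁ hhm hhM hhz
  refine ⟨_, hpath.toLp_mem_tangentSet, ?_⟩
  rw [Lp.edist_toLp_toLp]
  have hψm : AEStronglyMeasurable (ψ - h) (obsLaw D.obs P) :=
    hψ.1.sub hhm.aestronglyMeasurable
  have hψg : AEStronglyMeasurable (ψ - ⇑g) (obsLaw D.obs P) :=
    hψ.1.sub hgm.aestronglyMeasurable
  rw [obsLaw, eLpNorm_map_measure hψm D.measurable_obs.aemeasurable]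
  rw [obsLaw, eLpNorm_map_measure hψg D.measurable_obs.aemeasurable] at hg
  have hΨi : Integrable Ψ P.labelled :=
    ((memLp_map_measure_iff hψ.1 D.measurable_obs.aemeasurable).1 hψ).integrable one_le_two
  have hdi : AEStronglyMeasurable (Ψ - G) P.labelled := (hΨi.sub hGi).1
  -- Since ψ is already centered, the error is Ψ - G minus its own conditional mean, and conditional
  -- expectation contracts L².
  have hcs : (ψ - h) ∘ D.obs =ᵐ[P.labelled]
      (Ψ - G) - P.labelled[Ψ - G | MeasurableSpace.comap D.known inferInstance] := by
    filter_upwards [condExp_sub hΨi hGi _, hz, hcE] with w h1 h2 h3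
    rw [Pi.sub_apply, Pi.sub_apply, h1, Pi.sub_apply, h2, ← h3]
    simp only [Function.comp_apply, Pi.sub_apply, Pi.zero_apply, hh, hΨ, hG]
    rw [show D.part (D.obs w) = D.known w from rfl]
    ring
  rw [eLpNorm_congr_ae hcs]
  calc eLpNorm ((Ψ - G)
        - P.labelled[Ψ - G | MeasurableSpace.comap D.known inferInstance]) 2 P.labelled
      ≤ eLpNorm (Ψ - G) 2 P.labelled
        + eLpNorm (P.labelled[Ψ - G | MeasurableSpace.comap D.known inferInstance]) 2 P.labelled :=
        eLpNorm_sub_le hdi integrable_condExp.1 one_le_two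
    _ ≤ eLpNorm (Ψ - G) 2 P.labelled + eLpNorm (Ψ - G) 2 P.labelled := by
        gcongr
        exact eLpNorm_condExp_le_eLpNorm _ one_le_two
    _ < δ / 2 + δ / 2 := ENNReal.add_lt_add hg hg
    _ = δ := ENNReal.add_halves δ

/-- Only almost sure equality is required of ψ: the displayed influence functions use the
untruncated λ and 1/e, while `influence` is truncated. The function lies in the closure of the
tangent set itself, which gives both the span condition and the sharpness of the bound. -/
theorem isEfficientInfluenceFunction (hP : P.Admissible ρ ε C) (hρ₀ : 0 ≤ ρ) (hρ₁ : ρ < 1)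
    (hε : 0 < ε) (hm : D.IsCondMean P m) {ψ : O → ℝ}
    (hψ : ψ =ᵐ[obsLaw D.obs P] D.influence ρ ε C P m) :
    IsEfficientInfluenceFunction (Population.model ρ ε C D.known P) D.obs (Population.ate ρ) P ψ ∧
    efficiencyBound (Population.model ρ ε C D.known P) D.obs (Population.ate ρ) P
      = ENNReal.ofReal (∫ o, ψ o ^ 2 ∂(obsLaw D.obs P)) := by
  have hmem := (memLp_congr_ae hψ).2 (D.memLp_influence hP hρ₀ hρ₁ hε hm)
  have hz : P.labelled[fun w => ψ (D.obs w) | MeasurableSpace.comap D.known inferInstance]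
      =ᵐ[P.labelled] 0 :=
    (condExp_congr_ae (ae_of_ae_map (p := fun o => ψ o = D.influence ρ ε C P m o)
      D.measurable_obs.aemeasurable hψ)).trans
      (D.condExp_influence hP hρ₀ hρ₁ hε hm)
  have hcl := D.toLp_mem_closure_tangentSet hP hρ₀ hρ₁ hmem hz
  have hE : IsEfficientInfluenceFunction (Population.model ρ ε C D.known P) D.obs
      (Population.ate ρ) P ψ := by
    refine ⟨hmem, fun path g hg => ?_, ?_⟩
    · have e : ∫ o, ψ o * g o ∂(obsLaw D.obs P)
          = ∫ o, D.influence ρ ε C P m o * g o ∂(obsLaw D.obs P) := by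
        refine integral_congr_ae ?_
        filter_upwards [hψ] with o ho
        rw [ho]
      rw [e]
      exact D.hasDerivAt_ate hP hρ₀ hρ₁ hε hm hg
    · exact closure_mono Submodule.subset_span hcl
  exact ⟨hE, hE.efficiencyBound_eq hcl⟩

end ObservationScheme

/-! ### The three settings as observation schemes -/

namespace ObservationScheme

variable (𝒳 𝒮 : Type*) [MeasurableSpace 𝒳] [MeasurableSpace 𝒮]

/-- No surrogates: `(X, T, Y)` is observed, the law of `(X, T)` is known. -/
def withoutSurrogates : ObservationScheme 𝒳 𝒮 (𝒳 × Bool × ℝ) (𝒳 × Bool) where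
  view o := (o.1, o.2.1, o.2.2.2)
  part o := (o.1, o.2.1)
  xt k := k
  outcome o := o.2.2
  measurable_view := by fun_prop
  measurable_part := by fun_prop
  measurable_xt := by fun_prop
  measurable_outcome := by fun_prop
  xt_part_view _ := rfl
  outcome_view _ := rfl

/-- Surrogates on the labelled data only: `(X, T, S, Y)` is observed, the law of `(X, T)` is
known. -/
def labelledSurrogates : ObservationScheme 𝒳 𝒮 (𝒳 × Bool × 𝒮 × ℝ) (𝒳 × Bool) where
  view o := o
  part o := (o.1, o.2.1)
  xt k := k
  outcome o := o.2.2.2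
  measurable_view := by fun_prop
  measurable_part := by fun_prop
  measurable_xt := by fun_prop
  measurable_outcome := by fun_prop
  xt_part_view _ := rfl
  outcome_view _ := rfl

/-- Surrogates on all data: `(X, T, S, Y)` is observed, the law of `(X, T, S)` is known. -/
def fullSurrogates : ObservationScheme 𝒳 𝒮 (𝒳 × Bool × 𝒮 × ℝ) (𝒳 × Bool × 𝒮) where
  view o := o
  part o := (o.1, o.2.1, o.2.2.1)
  xt k := (k.1, k.2.1)
  outcome o := o.2.2.2
  measurable_view := by fun_prop
  measurable_part := by fun_prop
  measurable_xt := by fun_prop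
  measurable_outcome := by fun_prop
  xt_part_view _ := rfl
  outcome_view _ := rfl

end ObservationScheme

/-! ### Efficient influence functions in the three settings -/

namespace Population

variable {𝒳 𝒮 : Type*} [MeasurableSpace 𝒳] [MeasurableSpace 𝒮]

theorem measurable_mu (P : Population 𝒳 𝒮) : Measurable fun p : 𝒳 × Bool => P.mu p.2 p.1 := by
  have h : StronglyMeasurable fun q : (𝒳 × Bool) × ℝ => q.2 := measurable_snd.stronglyMeasurable
  exact (h.integral_kernel_prod_right' (κ := condDistrib Y XT P.labelled)).measurable

theorem measurable_muTilde (P : Population 𝒳 𝒮) :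
    Measurable fun p : 𝒳 × Bool × 𝒮 => P.muTilde p.2.1 p.1 p.2.2 := by
  have h : StronglyMeasurable fun q : (𝒳 × Bool × 𝒮) × ℝ => q.2 :=
    measurable_snd.stronglyMeasurable
  exact (h.integral_kernel_prod_right' (κ := condDistrib Y XTS P.labelled)).measurable

@[fun_prop]
theorem measurable_mu_comp (P : Population 𝒳 𝒮) (t : Bool) : Measurable (P.mu t) :=
  P.measurable_mu.comp (measurable_id.prodMk measurable_const)

theorem measurable_muTilde_comp (P : Population 𝒳 𝒮) (t : Bool) :
    Measurable fun p : 𝒳 × 𝒮 => P.muTilde t p.1 p.2 :=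
  P.measurable_muTilde.comp (measurable_fst.prodMk (measurable_const.prodMk measurable_snd))

theorem measurable_ind : Measurable ind := measurable_of_finite _

theorem measurable_psiI (ρ : ℝ) (P : Population 𝒳 𝒮) : Measurable (P.psiI ρ) := by
  have h : Measurable fun o : 𝒳 × Bool × ℝ => ind o.2.1 :=
    measurable_ind.comp (measurable_fst.comp measurable_snd)
  unfold psiI
  fun_prop

theorem measurable_psiTilde (ρ : ℝ) (P : Population 𝒳 𝒮) : Measurable (P.psiTilde ρ) := by
  have h : Measurable fun o : 𝒳 × Bool × 𝒮 × ℝ => ind o.2.1 :=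
    measurable_ind.comp (measurable_fst.comp measurable_snd)
  have hm : ∀ t, Measurable fun o : 𝒳 × Bool × 𝒮 × ℝ => P.muTilde t o.1 o.2.2.1 := fun t =>
    (P.measurable_muTilde_comp t).comp (by fun_prop : Measurable fun o : 𝒳 × Bool × 𝒮 × ℝ =>
      (o.1, o.2.2.1))
  unfold psiTilde
  fun_prop

variable {ρ ε C : ℝ} {P : Population 𝒳 𝒮}

theorem mu_ae_eq_condExp (hY : MemLp Y 2 P.labelled) : (fun w => P.mu (T w) (X w))
    =ᵐ[P.labelled] P.labelled[Y | MeasurableSpace.comap XT inferInstance] :=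
  (condExp_ae_eq_integral_condDistrib' measurable_XT (hY.integrable one_le_two)).symm

theorem muTilde_ae_eq_condExp (hY : MemLp Y 2 P.labelled) :
    (fun w => P.muTilde (T w) (X w) (S w))
      =ᵐ[P.labelled] P.labelled[Y | MeasurableSpace.comap XTS inferInstance] :=
  (condExp_ae_eq_integral_condDistrib' measurable_XTS (hY.integrable one_le_two)).symm

variable [StandardBorelSpace 𝒳] [StandardBorelSpace 𝒮]

/-- Both treatment arms of the influence functions at once. -/
theorem Admissible.ae_arms_eq (hP : P.Admissible ρ ε C) (hρ₀ : 0 ≤ ρ) (hρ₁ : ρ < 1) :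
    ∀ᵐ w ∂P.labelled, ∀ (y : ℝ) (a : Bool → ℝ),
      ind (T w) * P.lam ρ (X w) / P.e ρ (X w) * (y - a true)
        - (1 - ind (T w)) * P.lam ρ (X w) / (1 - P.e ρ (X w)) * (y - a false)
      = P.lamClip ρ C (X w) * (P.ipw ρ ε (XT w) * (y - a (T w))) := by
  filter_upwards [hP.lamClip_ae_eq hρ₀ hρ₁,
    hP.ae_of_law (measurableSet_overlap ρ ε P) hP.overlap] with w h1 h2 y a
  rw [h1]
  -- On labelled data overlap is available only where λ ≠ 0; elsewhere both sides vanish.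
  by_cases h0 : P.lam ρ (X w) = 0
  · simp [h0]
  have hw : ε ≤ P.e ρ (XT w).1 ∧ P.e ρ (XT w).1 ≤ 1 - ε := h2 h0
  rw [ipw, if_pos hw]
  have hT : (XT w).2 = T w := rfl
  have hX : P.e ρ (XT w).1 = P.e ρ (X w) := rfl
  rw [hT, hX]
  cases T w <;> simp only [ind, Bool.false_eq_true, if_true, if_false] <;> ring

theorem Admissible.psiI_ae_eq (hP : P.Admissible ρ ε C) (hρ₀ : 0 ≤ ρ) (hρ₁ : ρ < 1) :
    ∀ᵐ w ∂P.labelled, P.psiI ρ (XTY w)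
      = P.lamClip ρ C (X w) * (P.ipw ρ ε (XT w) * (Y w - P.mu (T w) (X w))) := by
  filter_upwards [hP.ae_arms_eq hρ₀ hρ₁] with w h
  exact h (Y w) fun t => P.mu t (X w)

theorem Admissible.psiTilde_ae_eq (hP : P.Admissible ρ ε C) (hρ₀ : 0 ≤ ρ) (hρ₁ : ρ < 1) :
    ∀ᵐ w ∂P.labelled, P.psiTilde ρ (XTSY w)
      = P.lamClip ρ C (X w) * (P.ipw ρ ε (XT w) * (Y w - P.muTilde (T w) (X w) (S w))) := by
  filter_upwards [hP.ae_arms_eq hρ₀ hρ₁] with w h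
  exact h (Y w) fun t => P.muTilde t (X w) (S w)

variable [Nonempty 𝒮]

theorem Admissible.efficiency_psiI (hP : P.Admissible ρ ε C) (hρ₀ : 0 ≤ ρ) (hρ₁ : ρ < 1)
    (hε : 0 < ε) :
    IsEfficientInfluenceFunction (model ρ ε C XT P) XTY (ate ρ) P (P.psiI ρ) ∧
    P.boundI ρ ε C = ENNReal.ofReal (∫ w, P.psiI ρ (XTY w) ^ 2 ∂P.labelled) := by
  let D := ObservationScheme.withoutSurrogates 𝒳 𝒮
  have hm : D.IsCondMean P (fun p => P.mu p.2 p.1) := ⟨P.measurable_mu, mu_ae_eq_condExp hP.memLp_Y⟩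
  have hψ : P.psiI ρ =ᵐ[obsLaw D.obs P] D.influence ρ ε C P (fun p => P.mu p.2 p.1) :=
    (ae_map_iff D.measurable_obs.aemeasurable
      (p := fun o => P.psiI ρ o = D.influence ρ ε C P (fun p => P.mu p.2 p.1) o)
      (measurableSet_eq_fun (measurable_psiI ρ P)
        (D.measurable_influence ρ ε C P P.measurable_mu))).2 (hP.psiI_ae_eq hρ₀ hρ₁)
  obtain ⟨h1, h2⟩ := D.isEfficientInfluenceFunction hP hρ₀ hρ₁ hε hm hψ
  refine ⟨h1, h2.trans ?_⟩
  rw [obsLaw, integral_map D.measurable_obs.aemeasurable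
    ((measurable_psiI ρ P).pow_const 2).aestronglyMeasurable]
  rfl

theorem Admissible.efficiency_psiII (hP : P.Admissible ρ ε C) (hρ₀ : 0 ≤ ρ) (hρ₁ : ρ < 1)
    (hε : 0 < ε) :
    IsEfficientInfluenceFunction (model ρ ε C XT P) XTSY (ate ρ) P (P.psiII ρ) ∧
    P.boundII ρ ε C = ENNReal.ofReal (∫ w, P.psiII ρ (XTSY w) ^ 2 ∂P.labelled) := by
  let D := ObservationScheme.labelledSurrogates 𝒳 𝒮
  have hm : D.IsCondMean P (fun p => P.mu p.2 p.1) := ⟨P.measurable_mu, mu_ae_eq_condExp hP.memLp_Y⟩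
  have hmeas : Measurable (P.psiII ρ) :=
    (measurable_psiI ρ P).comp (by fun_prop : Measurable fun o : 𝒳 × Bool × 𝒮 × ℝ =>
      (o.1, o.2.1, o.2.2.2))
  have hψ : P.psiII ρ =ᵐ[obsLaw D.obs P] D.influence ρ ε C P (fun p => P.mu p.2 p.1) :=
    (ae_map_iff D.measurable_obs.aemeasurable
      (p := fun o => P.psiII ρ o = D.influence ρ ε C P (fun p => P.mu p.2 p.1) o)
      (measurableSet_eq_fun hmeas
        (D.measurable_influence ρ ε C P P.measurable_mu))).2 (hP.psiI_ae_eq hρ₀ hρ₁)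
  obtain ⟨h1, h2⟩ := D.isEfficientInfluenceFunction hP hρ₀ hρ₁ hε hm hψ
  refine ⟨h1, h2.trans ?_⟩
  rw [obsLaw, integral_map D.measurable_obs.aemeasurable (hmeas.pow_const 2).aestronglyMeasurable]
  rfl

theorem Admissible.efficiency_psiTilde (hP : P.Admissible ρ ε C) (hρ₀ : 0 ≤ ρ) (hρ₁ : ρ < 1)
    (hε : 0 < ε) :
    IsEfficientInfluenceFunction (model ρ ε C XTS P) XTSY (ate ρ) P (P.psiTilde ρ) ∧
    P.boundTilde ρ ε C = ENNReal.ofReal (∫ w, P.psiTilde ρ (XTSY w) ^ 2 ∂P.labelled) := by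
  let D := ObservationScheme.fullSurrogates 𝒳 𝒮
  have hm : D.IsCondMean P (fun p => P.muTilde p.2.1 p.1 p.2.2) :=
    ⟨P.measurable_muTilde, muTilde_ae_eq_condExp hP.memLp_Y⟩
  have hψ : P.psiTilde ρ =ᵐ[obsLaw D.obs P]
      D.influence ρ ε C P (fun p => P.muTilde p.2.1 p.1 p.2.2) :=
    (ae_map_iff D.measurable_obs.aemeasurable
      (p := fun o => P.psiTilde ρ o = D.influence ρ ε C P (fun p => P.muTilde p.2.1 p.1 p.2.2) o)
      (measurableSet_eq_fun (measurable_psiTilde ρ P)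
        (D.measurable_influence ρ ε C P P.measurable_muTilde))).2 (hP.psiTilde_ae_eq hρ₀ hρ₁)
  obtain ⟨h1, h2⟩ := D.isEfficientInfluenceFunction hP hρ₀ hρ₁ hε hm hψ
  refine ⟨h1, h2.trans ?_⟩
  rw [obsLaw, integral_map D.measurable_obs.aemeasurable
    ((measurable_psiTilde ρ P).pow_const 2).aestronglyMeasurable]
  rfl

end Population

/-! ### Conditional variance through conditional distributions -/

section CondVariance

variable {Ω 𝒳 : Type*} [MeasurableSpace Ω] [MeasurableSpace 𝒳] {μ : Measure Ω}
  [IsFiniteMeasure μ] {X : Ω → 𝒳} {Z : Ω → ℝ}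

theorem variance_condDistrib_eq (x : 𝒳) : variance id (condDistrib Z X μ x)
    = ∫ z, (z - ∫ z', z' ∂(condDistrib Z X μ x)) ^ 2 ∂(condDistrib Z X μ x) :=
  variance_eq_integral aemeasurable_id

theorem measurable_integral_condDistrib :
    Measurable fun x => ∫ z, z ∂(condDistrib Z X μ x) :=
  (StronglyMeasurable.integral_condDistrib (f := fun p : 𝒳 × ℝ => p.2)
    measurable_snd.stronglyMeasurable).measurable

theorem measurable_variance_condDistrib :
    Measurable fun x => variance id (condDistrib Z X μ x) := by
  have hN := measurable_integral_condDistrib (μ := μ) (X := X) (Z := Z)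
  have hF : Measurable fun p : 𝒳 × ℝ => (p.2 - ∫ z, z ∂(condDistrib Z X μ p.1)) ^ 2 :=
    (measurable_snd.sub (hN.comp measurable_fst)).pow_const 2
  have := (StronglyMeasurable.integral_condDistrib (X := X) (Y := Z) (μ := μ)
    hF.stronglyMeasurable).measurable
  simpa only [variance_condDistrib_eq] using! this

/-- A weighted squared deviation from the conditional mean has the same integral as the weighted
conditional variance. -/
theorem integral_mul_variance_condDistrib (hX : Measurable X) (hZ : MemLp Z 2 μ)
    {M : 𝒳 → ℝ} (hM : (fun w => M (X w)) =ᵐ[μ] μ[Z | MeasurableSpace.comap X inferInstance])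
    {g : 𝒳 → ℝ} (hg : Measurable g) {c : ℝ} (hc : ∀ x, |g x| ≤ c) :
    Integrable (fun w => g (X w) * variance id (condDistrib Z X μ (X w))) μ ∧
    ∫ w, g (X w) * (Z w - M (X w)) ^ 2 ∂μ
      = ∫ w, g (X w) * variance id (condDistrib Z X μ (X w)) ∂μ := by
  set N : 𝒳 → ℝ := fun x => ∫ z, z ∂(condDistrib Z X μ x) with hN
  have hNm : Measurable N := measurable_integral_condDistrib
  have hZi := hZ.integrable one_le_two
  have hNE : (fun w => N (X w)) =ᵐ[μ] μ[Z | MeasurableSpace.comap X inferInstance] :=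
    (condExp_ae_eq_integral_condDistrib' hX hZi).symm
  have hNL : MemLp (fun w => N (X w)) 2 μ := (memLp_congr_ae hNE).2 (hZ.condExp one_le_two)
  set F : 𝒳 × ℝ → ℝ := fun p => g p.1 * (p.2 - N p.1) ^ 2 with hF
  have hFm : Measurable F := by fun_prop
  have hFi : Integrable (fun w => F (X w, Z w)) μ :=
    (hZ.sub hNL).integrable_sq.bdd_mul (c := c) (hg.comp hX).aestronglyMeasurable
      (ae_of_all _ fun w => hc _)
  have hE := condExp_prod_ae_eq_integral_condDistrib hX hZi.1.aemeasurable
    hFm.stronglyMeasurable hFi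
  have hV : (fun w => g (X w) * variance id (condDistrib Z X μ (X w)))
      =ᵐ[μ] μ[fun w => F (X w, Z w) | MeasurableSpace.comap X inferInstance] := by
    filter_upwards [hE] with w hw
    rw [hw, variance_condDistrib_eq, ← integral_const_mul]
  refine ⟨integrable_condExp.congr hV.symm, ?_⟩
  rw [integral_congr_ae hV, integral_condExp hX.comap_le]
  refine integral_congr_ae ?_
  filter_upwards [hM, hNE] with w h1 h2
  simp only [hF, h1, h2]

end CondVariance

/-! ### The efficiency gain from surrogates -/

namespace Population

variable {𝒳 𝒮 : Type*} [MeasurableSpace 𝒳] [MeasurableSpace 𝒮] {ρ ε C : ℝ} {P : Population 𝒳 𝒮}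

theorem measurable_condVar (ρ : ℝ) (P : Population 𝒳 𝒮) (t : Bool) :
    Measurable (P.condVar ρ t) := measurable_variance_condDistrib

theorem memLp_mu (hY : MemLp Y 2 P.labelled) :
    MemLp (fun w => P.mu (T w) (X w)) 2 P.labelled :=
  (memLp_congr_ae (mu_ae_eq_condExp hY)).2 (hY.condExp one_le_two)

theorem memLp_muTilde (hY : MemLp Y 2 P.labelled) :
    MemLp (fun w => P.muTilde (T w) (X w) (S w)) 2 P.labelled :=
  (memLp_congr_ae (muTilde_ae_eq_condExp hY)).2 (hY.condExp one_le_two)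

/-- `μ` and `μ̃` have the same mean against bounded functions of covariates and treatment. -/
theorem integral_mul_muTilde_eq (hY : MemLp Y 2 P.labelled) {φ : 𝒳 × Bool → ℝ}
    (hφ : Measurable φ) {c : ℝ} (hc : ∀ p, |φ p| ≤ c) :
    ∫ w, φ (XT w) * P.muTilde (T w) (X w) (S w) ∂P.labelled
      = ∫ w, φ (XT w) * P.mu (T w) (X w) ∂P.labelled := by
  have h1 := ObservationScheme.IsCondMean.integral_mul_residual
    (D := ObservationScheme.labelledSurrogates 𝒳 𝒮) (m := fun p => P.mu p.2 p.1)
    ⟨P.measurable_mu, mu_ae_eq_condExp hY⟩ hY hφ hc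
  have h2 := ObservationScheme.IsCondMean.integral_mul_residual
    (D := ObservationScheme.fullSurrogates 𝒳 𝒮) (m := fun p => P.muTilde p.2.1 p.1 p.2.2)
    ⟨P.measurable_muTilde, muTilde_ae_eq_condExp hY⟩ hY
    (φ := fun k => φ (k.1, k.2.1)) (by fun_prop) (fun k => hc _)
  have h1' : ∫ w, φ (XT w) * (Y w - P.mu (T w) (X w)) ∂P.labelled = 0 := h1
  have h2' : ∫ w, φ (XT w) * (Y w - P.muTilde (T w) (X w) (S w)) ∂P.labelled = 0 := h2
  have hi : ∀ f : FullData 𝒳 𝒮 → ℝ, MemLp f 2 P.labelled →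
      Integrable (fun w => φ (XT w) * f w) P.labelled := fun f hf =>
    (hf.integrable one_le_two).bdd_mul (c := c) (hφ.comp measurable_XT).aestronglyMeasurable
      (ae_of_all _ fun w => hc _)
  simp only [mul_sub] at h1' h2'
  rw [integral_sub (hi _ hY) (hi _ (memLp_mu hY))] at h1'
  rw [integral_sub (hi _ hY) (hi _ (memLp_muTilde hY))] at h2'
  linarith

/-- The residual with surrogates is orthogonal to square-integrable functions of `(X, T, S)`. -/
theorem integral_mul_sub_muTilde_eq_zero (hY : MemLp Y 2 P.labelled) {f : 𝒳 × Bool × 𝒮 → ℝ}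
    (hf : Measurable f) (hf2 : MemLp (fun w => f (XTS w)) 2 P.labelled) :
    ∫ w, f (XTS w) * (Y w - P.muTilde (T w) (X w) (S w)) ∂P.labelled = 0 := by
  have hm2 := memLp_muTilde hY
  have hres : MemLp (Y - fun w => P.muTilde (T w) (X w) (S w)) 2 P.labelled := hY.sub hm2
  have hpull := condExp_mul_of_stronglyMeasurable_left (μ := P.labelled)
    (m := MeasurableSpace.comap XTS inferInstance) (f := fun w => f (XTS w))
    (hf.comp (comap_measurable XTS)).stronglyMeasurable (hf2.integrable_mul hres)
    (hres.integrable one_le_two)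
  have hsub := condExp_sub (hY.integrable one_le_two) (hm2.integrable one_le_two)
    (MeasurableSpace.comap XTS inferInstance)
  rw [condExp_of_stronglyMeasurable measurable_XTS.comap_le
    (f := fun w => P.muTilde (T w) (X w) (S w))
    (P.measurable_muTilde.comp (comap_measurable XTS)).stronglyMeasurable
    (hm2.integrable one_le_two)] at hsub
  have hz : P.labelled[(fun w => f (XTS w)) * (Y - fun w => P.muTilde (T w) (X w) (S w)) |
      MeasurableSpace.comap XTS inferInstance] =ᵐ[P.labelled] fun _ => 0 := by
    filter_upwards [hpull, hsub, muTilde_ae_eq_condExp hY] with w h1 h2 h3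
    rw [h1, Pi.mul_apply, h2, Pi.sub_apply, ← h3]
    simp
  have := integral_congr_ae hz
  rw [integral_condExp measurable_XTS.comap_le] at this
  simpa using this

variable [StandardBorelSpace 𝒳] [StandardBorelSpace 𝒮]

/-- The second moment of the influence function splits orthogonally. -/
theorem Admissible.integral_sq_psiI_sub (hP : P.Admissible ρ ε C) (hρ₀ : 0 ≤ ρ) (hρ₁ : ρ < 1)
    (hε : 0 < ε) :
    ∫ w, P.psiI ρ (XTY w) ^ 2 ∂P.labelled - ∫ w, P.psiTilde ρ (XTSY w) ^ 2 ∂P.labelled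
      = ∫ w, (P.lamClip ρ C (X w) * P.ipw ρ ε (XT w)) ^ 2
          * (P.muTilde (T w) (X w) (S w) - P.mu (T w) (X w)) ^ 2 ∂P.labelled := by
  have hC := hP.C_nonneg hρ₀ hρ₁
  set a : 𝒳 × Bool → ℝ := fun p => P.lamClip ρ C p.1 * P.ipw ρ ε p with ha
  have ham : Measurable a := by fun_prop
  have hac : ∀ p, |a p| ≤ C * ε⁻¹ := fun p => by
    rw [abs_mul, abs_of_nonneg (lamClip_nonneg ρ hC P _)]
    exact mul_le_mul (lamClip_le ρ C P _) (abs_ipw_le ρ hε P _) (abs_nonneg _) hC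
  have hbdd : ∀ f : FullData 𝒳 𝒮 → ℝ, MemLp f 2 P.labelled →
      MemLp (fun w => a (XT w) * f w) 2 P.labelled := fun f hf =>
    hf.of_le_mul (c := C * ε⁻¹) ((ham.comp measurable_XT).aestronglyMeasurable.mul hf.1)
      (ae_of_all _ fun w => by
        rw [norm_mul]; exact mul_le_mul_of_nonneg_right (hac _) (norm_nonneg _))
  have hr := hP.memLp_Y.sub (memLp_muTilde hP.memLp_Y)
  have hd := (memLp_muTilde hP.memLp_Y).sub (memLp_mu hP.memLp_Y)
  have har := hbdd _ hr
  have had := hbdd _ hd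
  have haad := hbdd _ had
  -- The cross term: with a = λ w, both a² and μ̃ - μ are functions of (X, T, S), to which Y - μ̃ is
  -- orthogonal.
  have hcross := integral_mul_sub_muTilde_eq_zero hP.memLp_Y
    (f := fun p => a (p.1, p.2.1) * (a (p.1, p.2.1) * (P.muTilde p.2.1 p.1 p.2.2 - P.mu p.2.1 p.1)))
    (by
      have h1 := P.measurable_muTilde
      have h2 : Measurable fun p : 𝒳 × Bool × 𝒮 => P.mu p.2.1 p.1 :=
        P.measurable_mu.comp (measurable_fst.prodMk (measurable_fst.comp measurable_snd))
      fun_prop) haad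
  have e1 : ∫ w, P.psiI ρ (XTY w) ^ 2 ∂P.labelled
      = ∫ w, ((a (XT w) * (Y w - P.muTilde (T w) (X w) (S w))) ^ 2
        + (2 * (a (XT w) * (a (XT w) * (P.muTilde (T w) (X w) (S w) - P.mu (T w) (X w)))
            * (Y w - P.muTilde (T w) (X w) (S w)))
          + (a (XT w) * (P.muTilde (T w) (X w) (S w) - P.mu (T w) (X w))) ^ 2)) ∂P.labelled := by
    refine integral_congr_ae ?_
    filter_upwards [hP.psiI_ae_eq hρ₀ hρ₁] with w hw
    have : a (XT w) = P.lamClip ρ C (X w) * P.ipw ρ ε (XT w) := rfl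
    rw [hw, this]
    ring
  have e2 : ∫ w, P.psiTilde ρ (XTSY w) ^ 2 ∂P.labelled
      = ∫ w, (a (XT w) * (Y w - P.muTilde (T w) (X w) (S w))) ^ 2 ∂P.labelled := by
    refine integral_congr_ae ?_
    filter_upwards [hP.psiTilde_ae_eq hρ₀ hρ₁] with w hw
    have : a (XT w) = P.lamClip ρ C (X w) * P.ipw ρ ε (XT w) := rfl
    rw [hw, this]
    ring
  have i1 : Integrable (fun w => (a (XT w) * (Y w - P.muTilde (T w) (X w) (S w))) ^ 2)
    P.labelled := har.integrable_sq
  have i2 : Integrable (fun w => 2 * (a (XT w) * (a (XT w) * (P.muTilde (T w) (X w) (S w)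
      - P.mu (T w) (X w))) * (Y w - P.muTilde (T w) (X w) (S w)))) P.labelled :=
    (haad.integrable_mul hr).const_mul 2
  have i3 : Integrable (fun w => (a (XT w) * (P.muTilde (T w) (X w) (S w)
      - P.mu (T w) (X w))) ^ 2) P.labelled := had.integrable_sq
  have hcross' : ∫ w, a (XT w) * (a (XT w) * (P.muTilde (T w) (X w) (S w)
      - P.mu (T w) (X w))) * (Y w - P.muTilde (T w) (X w) (S w)) ∂P.labelled = 0 := hcross
  have i23 := i2.add i3
  simp only [Pi.add_def] at i23
  rw [e1, e2, integral_add i1 i23, integral_add i2 i3, integral_const_mul, hcross']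
  simp only [mul_zero, zero_add, add_sub_cancel_left]
  refine integral_congr_ae (ae_of_all _ fun w => ?_)
  simp only [ha, XT]
  ring

namespace Admissible

theorem integrable_law_iff (hP : P.Admissible ρ ε C) (hρ₀ : 0 ≤ ρ) (hρ₁ : ρ < 1)
    {G : 𝒳 → ℝ} (hG : Measurable G) :
    Integrable (fun w => G (X w)) (P.law ρ)
      ↔ Integrable (fun w => P.lamClip ρ C (X w) * G (X w)) P.labelled := by
  have hl : Measurable fun w : FullData 𝒳 𝒮 => ENNReal.ofReal (P.lamClip ρ C (X w)) := by fun_prop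
  have h1 : ∀ μ : Measure (FullData 𝒳 𝒮), Integrable (fun w => G (X w)) μ
      ↔ Integrable G (μ.map X) := fun μ =>
    (integrable_map_measure hG.aestronglyMeasurable measurable_X.aemeasurable).symm
  rw [h1, hP.map_X_law hρ₀ hρ₁, ← h1, reweighted, integrable_withDensity_iff_integrable_smul' hl
    (ae_of_all _ fun w => ENNReal.ofReal_lt_top)]
  simp only [smul_eq_mul, ENNReal.toReal_ofReal (lamClip_nonneg ρ (hP.C_nonneg hρ₀ hρ₁) P _)]

variable [Nonempty 𝒮]

theorem memLp_potential (hP : P.Admissible ρ ε C) (hρ₀ : 0 ≤ ρ) (hρ₁ : ρ < 1) (hε : 0 < ε)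
    {F : Bool → 𝒳 → 𝒮 → ℝ} (hF : Measurable fun p : 𝒳 × Bool × 𝒮 => F p.2.1 p.1 p.2.2)
    (h : MemLp (fun w => F (T w) (X w) (S w)) 2 P.labelled) (t : Bool) :
    MemLp (fun w => F t (X w) (Spot t w)) 2 (P.law ρ) := by
  have hFt : Measurable fun p : 𝒳 × 𝒮 => F t p.1 p.2 :=
    hF.comp (measurable_fst.prodMk (measurable_const.prodMk measurable_snd))
  have hm : MemLp (fun w => F (T w) (X w) (S w)) 2 (P.law ρ) :=
    hP.memLp_law hρ₀ hρ₁ (G := fun o => F o.2.1 o.1 o.2.2.1)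
      (hF.comp (by fun_prop : Measurable fun o : 𝒳 × Bool × 𝒮 × ℝ => (o.1, o.2.1, o.2.2.1))) h
  refine memLp_two_iff_lintegral.2
    ⟨(hFt.comp (measurable_X.prodMk (measurable_Spot t))).aestronglyMeasurable, ?_⟩
  refine (hP.lintegral_potential_le hε t (F := fun b x s => ‖F b x s‖ₑ ^ 2)
    ((hFt.comp (by fun_prop : Measurable fun p : 𝒳 × ℝ × 𝒮 =>
      (p.1, p.2.2))).enorm.pow_const 2)).trans_lt ?_
  exact ENNReal.mul_lt_top ENNReal.ofReal_lt_top (memLp_two_iff_lintegral.1 hm).2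

/-- `μ(t, X)` is the conditional mean of `μ̃(t, X, S(t))` given `X`. -/
theorem mu_ae_eq_condExp_muTilde (hP : P.Admissible ρ ε C) (hρ₀ : 0 ≤ ρ) (hρ₁ : ρ < 1)
    (hε : 0 < ε) (t : Bool) :
    (fun w => P.mu t (X w)) =ᵐ[P.law ρ] (P.law ρ)[fun w => P.muTilde t (X w) (Spot t w) |
      MeasurableSpace.comap X inferInstance] := by
  have := isProbabilityMeasure_law hρ₀ hρ₁ P
  have hC := hP.C_nonneg hρ₀ hρ₁
  have hZ := hP.memLp_potential hρ₀ hρ₁ hε (F := P.muTilde) P.measurable_muTilde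
    (memLp_muTilde hP.memLp_Y) t
  have hmuXT : Measurable fun p : 𝒳 × Bool × 𝒮 => P.mu p.2.1 p.1 :=
    P.measurable_mu.comp (measurable_fst.prodMk (measurable_fst.comp measurable_snd))
  have hM := hP.memLp_potential hρ₀ hρ₁ hε (F := fun b x _ => P.mu b x) hmuXT
    (memLp_mu hP.memLp_Y) t
  -- Both the potential arm and the unconditional law are traded for weights on the labelled data.
  -- There μ̃ and μ have equal means against functions of (X, T).
  have key : ∀ A : Set 𝒳, MeasurableSet A → ∀ (F : Bool → 𝒳 → 𝒮 → ℝ),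
      Measurable (fun p : 𝒳 × Bool × 𝒮 => F p.2.1 p.1 p.2.2) →
      ∫ w in X ⁻¹' A, F t (X w) (Spot t w) ∂(P.law ρ)
        = ∫ w, (P.lamClip ρ C (XT w).1 * (if (XT w).2 = t then |P.ipw ρ ε (XT w)|
          * A.indicator 1 (XT w).1 else 0)) * F (T w) (X w) (S w) ∂P.labelled := by
    intro A hA F hF
    have hFt : Measurable fun p : 𝒳 × 𝒮 => F t p.1 p.2 :=
      hF.comp (measurable_fst.prodMk (measurable_const.prodMk measurable_snd))
    have hind : Measurable (A.indicator (1 : 𝒳 → ℝ)) := measurable_one.indicator hA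
    have h1 := hP.integral_potential hε t
      (F := fun x s _ => A.indicator 1 x * F t x s)
      ((hind.comp measurable_fst).mul (hFt.comp (by fun_prop :
        Measurable fun p : 𝒳 × ℝ × 𝒮 => (p.1, p.2.2))))
    have h2 : ∫ w in X ⁻¹' A, F t (X w) (Spot t w) ∂(P.law ρ)
        = ∫ w, A.indicator 1 (X w) * F t (X w) (Spot t w) ∂(P.law ρ) := by
      rw [← integral_indicator (measurable_X hA)]
      refine integral_congr_ae (ae_of_all _ fun w => ?_)
      by_cases hw : X w ∈ A
      · simp [Set.indicator, hw]
      · simp [Set.indicator, hw]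
    have hG : Measurable fun o : 𝒳 × Bool × 𝒮 × ℝ => (if o.2.1 = t then |P.ipw ρ ε (o.1, o.2.1)|
          * A.indicator 1 o.1 else 0) * F o.2.1 o.1 o.2.2.1 := by
      refine Measurable.mul (Measurable.ite ?_ (by fun_prop) measurable_const)
        (hF.comp (by fun_prop : Measurable fun o : 𝒳 × Bool × 𝒮 × ℝ => (o.1, o.2.1, o.2.2.1)))
      exact (measurable_fst.comp measurable_snd) (measurableSet_singleton t)
    have h3 := hP.integral_law hρ₀ hρ₁ hG
    rw [h2, h1, ← integral_indicator (measurable_T (measurableSet_singleton t))]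
    refine (integral_congr_ae (ae_of_all _ fun w => ?_)).trans (h3.trans
      (integral_congr_ae (ae_of_all _ fun w => ?_)))
    · change (T ⁻¹' {t}).indicator (fun w => |P.ipw ρ ε (XT w)|
          * (A.indicator 1 (X w) * F t (X w) (S w))) w
        = (if T w = t then |P.ipw ρ ε (XT w)| * A.indicator 1 (X w) else 0)
          * F (T w) (X w) (S w)
      by_cases hw : T w = t
      · rw [Set.indicator_of_mem (show w ∈ T ⁻¹' {t} from hw), if_pos hw, hw, mul_assoc]
      · rw [Set.indicator_of_notMem (show w ∉ T ⁻¹' {t} from hw), if_neg hw, zero_mul]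
    · exact (mul_assoc _ _ _).symm
  refine ae_eq_condExp_of_forall_setIntegral_eq measurable_X.comap_le
    (hZ.integrable one_le_two) (fun s _ _ => (hM.integrable one_le_two).integrableOn) ?_
    (((P.measurable_mu_comp t).comp (comap_measurable X)).stronglyMeasurable.aestronglyMeasurable)
  rintro _ ⟨A, hA, rfl⟩ -
  rw [key A hA P.muTilde P.measurable_muTilde, key A hA (fun b x _ => P.mu b x) hmuXT]
  refine (integral_mul_muTilde_eq hP.memLp_Y (φ := fun p => P.lamClip ρ C p.1 *
    (if p.2 = t then |P.ipw ρ ε p| * A.indicator 1 p.1 else 0)) ?_ (c := C * ε⁻¹) ?_).symm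
  · refine Measurable.mul (by fun_prop) (Measurable.ite
      (measurable_snd (measurableSet_singleton t)) ?_ measurable_const)
    have hind : Measurable (A.indicator (1 : 𝒳 → ℝ)) := measurable_one.indicator hA
    fun_prop
  · intro p
    rw [abs_mul, abs_of_nonneg (lamClip_nonneg ρ hC P _)]
    refine mul_le_mul (lamClip_le ρ C P _) ?_ (abs_nonneg _) hC
    split_ifs
    · rw [abs_mul, abs_abs]
      have h1 : |A.indicator (1 : 𝒳 → ℝ) p.1| ≤ 1 := by
        by_cases hp : p.1 ∈ A <;> simp [Set.indicator, hp]
      exact (mul_le_mul (abs_ipw_le ρ hε P p) h1 (abs_nonneg _) (inv_nonneg.2 hε.le)).trans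
        (mul_one _).le
    · simpa using hε.le

/-- Of the weight λ² w², one λ passes from labelled to unconditional data and one |w| passes from
the observed arm to S(t). The remaining λ |w| depends on X once t is fixed, so conditioning on X
gives the variance of μ̃(t, X, S(t)). Returning to the labelled law restores the second λ. -/
theorem integral_gain (hP : P.Admissible ρ ε C) (hρ₀ : 0 ≤ ρ) (hρ₁ : ρ < 1) (hε : 0 < ε) :
    Integrable (fun w => P.gain ρ (X w)) P.labelled ∧
    ∫ w, (P.lamClip ρ C (X w) * P.ipw ρ ε (XT w)) ^ 2
        * (P.muTilde (T w) (X w) (S w) - P.mu (T w) (X w)) ^ 2 ∂P.labelled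
      = ∫ w, P.gain ρ (X w) ∂P.labelled := by
  have := isProbabilityMeasure_law hρ₀ hρ₁ P
  have hC := hP.C_nonneg hρ₀ hρ₁
  have hmuT := P.measurable_muTilde
  have hmuXT : Measurable fun p : 𝒳 × Bool × 𝒮 => P.mu p.2.1 p.1 :=
    P.measurable_mu.comp (measurable_fst.prodMk (measurable_fst.comp measurable_snd))
  have hV := measurable_condVar ρ P
  set g : Bool → 𝒳 → ℝ := fun t x => P.lamClip ρ C x * |P.ipw ρ ε (x, t)| with hg
  have hgm : ∀ t, Measurable (g t) := fun t => by fun_prop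
  have hgc : ∀ t x, |g t x| ≤ C * ε⁻¹ := fun t x => by
    rw [abs_mul, abs_of_nonneg (lamClip_nonneg ρ hC P _), abs_abs]
    exact mul_le_mul (lamClip_le ρ C P _) (abs_ipw_le ρ hε P _) (abs_nonneg _) hC
  have hvar : ∀ t, Integrable (fun w => g t (X w) * P.condVar ρ t (X w)) (P.law ρ) ∧
      ∫ w, g t (X w) * (P.muTilde t (X w) (Spot t w) - P.mu t (X w)) ^ 2 ∂(P.law ρ)
        = ∫ w, g t (X w) * P.condVar ρ t (X w) ∂(P.law ρ) := fun t =>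
    integral_mul_variance_condDistrib measurable_X
      (hP.memLp_potential hρ₀ hρ₁ hε (F := P.muTilde) hmuT (memLp_muTilde hP.memLp_Y) t)
      (hP.mu_ae_eq_condExp_muTilde hρ₀ hρ₁ hε t) (hgm t) (hgc t)
  have hlab : ∀ t, Integrable (fun w => P.lamClip ρ C (X w) *
        (g t (X w) * P.condVar ρ t (X w))) P.labelled ∧
      ∫ w, P.lamClip ρ C (X w) * (g t (X w) * P.condVar ρ t (X w)) ∂P.labelled
        = ∫ w, g t (X w) * P.condVar ρ t (X w) ∂(P.law ρ) := fun t =>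
    ⟨(hP.integrable_law_iff hρ₀ hρ₁ ((hgm t).mul (hV t))).1 (hvar t).1,
      (hP.integral_law hρ₀ hρ₁ (G := fun o => g t o.1 * P.condVar ρ t o.1)
        (((hgm t).mul (hV t)).comp measurable_fst)).symm⟩
  have hgain : (fun w => P.gain ρ (X w)) =ᵐ[P.labelled] fun w =>
      P.lamClip ρ C (X w) * (g true (X w) * P.condVar ρ true (X w))
      + P.lamClip ρ C (X w) * (g false (X w) * P.condVar ρ false (X w)) := by
    filter_upwards [hP.lamClip_ae_eq hρ₀ hρ₁,
      hP.ae_of_law (measurableSet_overlap ρ ε P) hP.overlap] with w h1 h2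
    simp only [gain, hg, h1]
    by_cases h0 : P.lam ρ (X w) = 0
    · simp [h0]
    have hw := h2 h0
    have hw' : ε ≤ 1 - P.e ρ (X w) := by linarith [hw.2]
    have ht : |P.ipw ρ ε (X w, true)| = (P.e ρ (X w))⁻¹ := by
      simp only [ipw, hw, and_self, if_true]
      exact abs_of_nonneg (inv_nonneg.2 (hε.le.trans hw.1))
    have hf : |P.ipw ρ ε (X w, false)| = (1 - P.e ρ (X w))⁻¹ := by
      simp only [ipw, hw, and_self, if_true, Bool.false_eq_true, if_false, abs_neg]
      exact abs_of_nonneg (inv_nonneg.2 (hε.le.trans hw'))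
    rw [ht, hf]
    ring
  have hsq : Integrable (fun w => P.lamClip ρ C (X w) * P.ipw ρ ε (XT w) ^ 2
      * (P.muTilde (T w) (X w) (S w) - P.mu (T w) (X w)) ^ 2) (P.law ρ) := by
    have hd : MemLp (fun w => P.muTilde (T w) (X w) (S w) - P.mu (T w) (X w)) 2 (P.law ρ) := by
      refine hP.memLp_law hρ₀ hρ₁ (G := fun o => P.muTilde o.2.1 o.1 o.2.2.1 - P.mu o.2.1 o.1)
        ?_ ((memLp_muTilde hP.memLp_Y).sub (memLp_mu hP.memLp_Y))
      exact (hmuT.sub hmuXT).comp (by fun_prop :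
        Measurable fun o : 𝒳 × Bool × 𝒮 × ℝ => (o.1, o.2.1, o.2.2.1))
    refine hd.integrable_sq.bdd_mul (c := C * ε⁻¹ ^ 2) (f := fun w => P.lamClip ρ C (X w) *
      P.ipw ρ ε (XT w) ^ 2) (Measurable.aestronglyMeasurable (by fun_prop))
      (ae_of_all _ fun w => ?_)
    rw [norm_mul, norm_pow, Real.norm_eq_abs, Real.norm_eq_abs,
      abs_of_nonneg (lamClip_nonneg ρ hC P _)]
    exact mul_le_mul (lamClip_le ρ C P _) (pow_le_pow_left₀ (abs_nonneg _)
      (abs_ipw_le ρ hε P _) 2) (by positivity) hC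
  -- On the fiber `T = t`, w² = |w| · |w|: one factor is absorbed by `integral_potential`, the other
  -- stays in `g t`.
  have harm : ∀ t, ∫ w in T ⁻¹' {t}, P.lamClip ρ C (X w) * P.ipw ρ ε (XT w) ^ 2
      * (P.muTilde (T w) (X w) (S w) - P.mu (T w) (X w)) ^ 2 ∂(P.law ρ)
      = ∫ w, g t (X w) * (P.muTilde t (X w) (Spot t w) - P.mu t (X w)) ^ 2 ∂(P.law ρ) := by
    intro t
    have hFt : Measurable fun p : 𝒳 × ℝ × 𝒮 => P.muTilde t p.1 p.2.2 :=
      (P.measurable_muTilde_comp t).comp (by fun_prop : Measurable fun p : 𝒳 × ℝ × 𝒮 =>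
        (p.1, p.2.2))
    have hgt := hgm t
    rw [hP.integral_potential hε t (F := fun x s _ => g t x * (P.muTilde t x s - P.mu t x) ^ 2)
      (by fun_prop)]
    refine setIntegral_congr_fun (measurable_T (measurableSet_singleton t)) fun w hT => ?_
    have hT' : T w = t := hT
    simp only [hg, XT, hT']
    rw [← sq_abs (P.ipw ρ ε (X w, t))]
    ring
  refine ⟨((hlab true).1.add (hlab false).1).congr hgain.symm, ?_⟩
  rw [integral_congr_ae hgain, integral_add (hlab true).1 (hlab false).1, (hlab true).2,
    (hlab false).2, ← (hvar true).2, ← (hvar false).2, ← harm, ← harm]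
  have hm := measurable_T (𝒳 := 𝒳) (𝒮 := 𝒮) (measurableSet_singleton true)
  have hc : (T ⁻¹' {true} : Set (FullData 𝒳 𝒮))ᶜ = T ⁻¹' {false} := by ext w; simp
  rw [← hc, integral_add_compl hm hsq]
  have h := hP.integral_law hρ₀ hρ₁ (G := fun o => P.lamClip ρ C o.1 * P.ipw ρ ε (o.1, o.2.1) ^ 2
      * (P.muTilde o.2.1 o.1 o.2.2.1 - P.mu o.2.1 o.1) ^ 2) (by
    have h1 := (hmuT.sub hmuXT).comp (by fun_prop :
        Measurable fun o : 𝒳 × Bool × 𝒮 × ℝ => (o.1, o.2.1, o.2.2.1))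
    exact Measurable.mul (by fun_prop) (h1.pow_const 2))
  refine Eq.trans (integral_congr_ae (ae_of_all _ fun w => ?_)) h.symm
  simp only [XT, XTSY]
  ring

end Admissible

end Population

theorem theorem9 {𝒳 𝒮 : Type*} [MeasurableSpace 𝒳] [StandardBorelSpace 𝒳]
    [MeasurableSpace 𝒮] [StandardBorelSpace 𝒮]
    (ρ ε C : ℝ) (hρ_nonneg : 0 ≤ ρ) (hρ_lt : ρ < 1) (hε_pos : 0 < ε) (hε_lt : ε < 1 / 2)
    (P : Population 𝒳 𝒮) (hP : P.Admissible ρ ε C) :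
    -- the efficient influence functions and the bounds of settings I and II
    (IsEfficientInfluenceFunction (Population.model ρ ε C FullData.XT P) FullData.XTY
        (Population.ate ρ) P (P.psiI ρ) ∧
      P.boundI ρ ε C = ENNReal.ofReal (∫ w, P.psiI ρ (FullData.XTY w) ^ 2 ∂P.labelled)) ∧
    (IsEfficientInfluenceFunction (Population.model ρ ε C FullData.XT P) FullData.XTSY
        (Population.ate ρ) P (P.psiII ρ) ∧
      P.boundII ρ ε C = ENNReal.ofReal (∫ w, P.psiII ρ (FullData.XTSY w) ^ 2 ∂P.labelled)) ∧
    P.boundI ρ ε C = P.boundII ρ ε C ∧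
    -- the efficient influence function and the bound with surrogates on all data
    (IsEfficientInfluenceFunction (Population.model ρ ε C FullData.XTS P) FullData.XTSY
        (Population.ate ρ) P (P.psiTilde ρ) ∧
      P.boundTilde ρ ε C
        = ENNReal.ofReal (∫ w, P.psiTilde ρ (FullData.XTSY w) ^ 2 ∂P.labelled)) ∧
    -- the efficiency gain from surrogates
    Integrable (fun w => P.gain ρ (FullData.X w)) P.labelled ∧
    (P.boundI ρ ε C).toReal - (P.boundTilde ρ ε C).toReal
      = ∫ w, P.gain ρ (FullData.X w) ∂P.labelled ∧
    (P.boundII ρ ε C).toReal - (P.boundTilde ρ ε C).toReal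
      = ∫ w, P.gain ρ (FullData.X w) ∂P.labelled := by
  -- A probability law on the full data forces the surrogate space to be inhabited, as the
  -- conditional distributions require.
  have hne : Nonempty 𝒮 := by
    obtain ⟨w⟩ : Nonempty (FullData 𝒳 𝒮) := nonempty_of_isProbabilityMeasure P.labelled
    exact ⟨FullData.S w⟩
  have h1 := hP.efficiency_psiI hρ_nonneg hρ_lt hε_pos
  have h2 := hP.efficiency_psiII hρ_nonneg hρ_lt hε_pos
  have h3 := hP.efficiency_psiTilde hρ_nonneg hρ_lt hε_pos
  obtain ⟨hint, hgain⟩ := hP.integral_gain hρ_nonneg hρ_lt hε_pos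
  have h12 : P.boundI ρ ε C = P.boundII ρ ε C := h1.2.trans h2.2.symm
  have hdiff : (P.boundI ρ ε C).toReal - (P.boundTilde ρ ε C).toReal
      = ∫ w, P.gain ρ (FullData.X w) ∂P.labelled := by
    rw [h1.2, h3.2, ENNReal.toReal_ofReal (integral_nonneg fun w => sq_nonneg _),
      ENNReal.toReal_ofReal (integral_nonneg fun w => sq_nonneg _),
      hP.integral_sq_psiI_sub hρ_nonneg hρ_lt hε_pos, hgain]
  exact ⟨h1, h2, h12, h3, hint, hdiff, h12 ▸ hdiff⟩
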